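/- The Maker-Breaker domination game is played on a finite simple graph $G$ by two players, Dominator and Staller, who alternately claim unclaimed vertices; Dominator wins if at some point the vertices she has claimed form a dominating set of $G$, and otherwise Staller wins. The feedback edge number $\mathrm{fen}(G)$ is the minimum size of a set $F$ of edges such that $G\setminus F$ is a forest. 1. (Linear kernel after Dominator's first move.) Consider the following problem: given a graph $G$ and a vertex $v$ of $G$, decide whether Dominator has a winning strategy in the game on $G$ in the position where she has claimed $v$, no other vertex has been claimed, and it is Staller's turn. This problem has a linear kernel with respect to $\mathrm{fen}(G)$: there are constants $a,b$ and a polynomial-time algorithm that transforms every instance $(G,v)$ into an instance $(G',v')$ of the same problem such that Dominator wins on $(G',v')$ if and only if she wins on $(G,v)$, $\mathrm{fen}(G')\le \mathrm{fen}(G)$, and $|V(G')|+|E(G')|\le a\cdot \mathrm{fen}(G)+b$. 2. (Fixed-parameter tractability.) The problem of deciding, given a graph $G$ and the player who moves first, whether Dominator has a winning strategy in the game on $G$ is fixed-parameter tractable with respect to $\mathrm{fen}(G)$: there are a computable function $f$, a polynomial $p$ and an algorithm that decides every instance $x=(G,\text{first player})$ in time at most $f(\mathrm{fen}(G))\cdot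 p(|x|)$, where $|x|$ is the size of the input. -/

import Mathlib

namespace MBDom

/-! ### The Maker-Breaker domination game -/

/-- `D` is a dominating set of `G`: every vertex is in `D` or adjacent to a vertex of `D`. -/
def IsDominating {V : Type*} (G : SimpleGraph V) (D : Finset V) : Prop :=
  ∀ v, v ∈ D ∨ ∃ u ∈ D, G.Adj u v

/-- The two players. -/
inductive Player where
  | dominator
  | staller

/-- `DominatorWins G p D S`: in the position where Dominator has claimed `D`, Staller has claimed
`S` and `p` is to move, Dominator has a winning strategy, that is, she can force that at some point
her vertices form a dominating set. -/
inductive DominatorWins {V : Type*} [DecidableEq V] (G : SimpleGraph V) :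
    Player → Finset V → Finset V → Prop where
  | dominating (p : Player) (D S : Finset V) (h : IsDominating G D) : DominatorWins G p D S
  | dominator_move (D S : Finset V) (v : V) (hD : v ∉ D) (hS : v ∉ S)
      (h : DominatorWins G Player.staller (insert v D) S) :
      DominatorWins G Player.dominator D S
  | staller_move (D S : Finset V) (hne : ∃ v, v ∉ D ∧ v ∉ S)
      (h : ∀ v, v ∉ D → v ∉ S → DominatorWins G Player.dominator D (insert v S)) :
      DominatorWins G Player.staller D S

/-- The feedback edge number: the least size of a set of edges whose removal leaves a forest. -/
noncomputable def feedbackEdgeNumber {V : Type*} (G : SimpleGraph V) : ℕ :=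
  sInf {k | ∃ F : Finset (Sym2 V),
    (F : Set (Sym2 V)) ⊆ G.edgeSet ∧ (G.deleteEdges (F : Set (Sym2 V))).IsAcyclic ∧ F.card = k}

/-! ### A model of computation with a cost measure

Programs of a WHILE language on binary trees, in variable-free form. Every elementary operation,
every duplication of a value and every test is charged the size of the value it is applied to, so
that the cost of a computation is, up to a polynomial, the running time of a Turing machine
carrying it out (and Turing machines can be simulated with polynomial overhead). -/

/-- The data values: binary trees. -/
inductive Data where
  | nil
  | cons (a b : Data)

namespace Data

/-- The number of nodes. -/
def size : Data → ℕ
  | nil => 1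
  | cons a b => a.size + b.size + 1

/-- First component (`nil` has components `nil` and `nil`). -/
def hd : Data → Data
  | nil => nil
  | cons a _ => a

/-- Second component. -/
def tl : Data → Data
  | nil => nil
  | cons _ b => b

/-- Booleans as data. -/
def ofBool : Bool → Data
  | false => nil
  | true => cons nil nil

/-- Lists of data values as data. -/
def ofList : List Data → Data
  | [] => nil
  | a :: l => cons a (ofList l)

/-- Natural numbers as data, in unary. -/
def ofNat : ℕ → Data
  | 0 => nil
  | n + 1 => cons nil (ofNat n)

end Data

/-- Programs. Each one transforms an input value into an output value (if it terminates). -/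
inductive Code where
  | nil
  | id
  | hd
  | tl
  | cons (f g : Code)
  | comp (f g : Code)
  | ite (b f g : Code)
  | loop (b f : Code)

/-- `Runs c x y t`: on input `x`, the program `c` terminates with output `y`, at total cost `t`.
`comp f g` runs `g`, then `f`; `ite b f g` runs `f` if the output of `b` is not `nil`, and `g`
otherwise; `loop b f` repeatedly replaces the current value by the output of `f` on it, as long as
the output of `b` on the current value is not `nil`. -/
inductive Runs : Code → Data → Data → ℕ → Prop where
  | nil (x : Data) : Runs Code.nil x Data.nil x.size
  | id (x : Data) : Runs Code.id x x x.size
  | hd (x : Data) : Runs Code.hd x x.hd x.size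
  | tl (x : Data) : Runs Code.tl x x.tl x.size
  | cons {f g : Code} {x y z : Data} {s t : ℕ} (hf : Runs f x y s) (hg : Runs g x z t) :
      Runs (Code.cons f g) x (Data.cons y z) (x.size + s + t + 1)
  | comp {f g : Code} {x y z : Data} {s t : ℕ} (hg : Runs g x y s) (hf : Runs f y z t) :
      Runs (Code.comp f g) x z (s + t + 1)
  | ite_true {b f g : Code} {x y u v : Data} {s t : ℕ} (hb : Runs b x (Data.cons u v) s)
      (hf : Runs f x y t) : Runs (Code.ite b f g) x y (x.size + s + t + 1)
  | ite_false {b f g : Code} {x y : Data} {s t : ℕ} (hb : Runs b x Data.nil s)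
      (hg : Runs g x y t) : Runs (Code.ite b f g) x y (x.size + s + t + 1)
  | loop_stop {b f : Code} {x : Data} {s : ℕ} (hb : Runs b x Data.nil s) :
      Runs (Code.loop b f) x x (x.size + s + 1)
  | loop_step {b f : Code} {x y z u v : Data} {s t r : ℕ} (hb : Runs b x (Data.cons u v) s)
      (hf : Runs f x y t) (hr : Runs (Code.loop b f) y z r) :
      Runs (Code.loop b f) x z (x.size + s + t + r + 1)

/-! ### Parameterized problems

A parameterized problem is given by a type `I` of instances, an encoding of the instances as data,
the set of yes-instances and the parameter. -/

/-- The problem is decided by one program, in time `f (parameter) * p (input size)` with `f`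
computable and `p` a polynomial. -/
def IsFPT {I : Type} (encode : I → Data) (yes : I → Prop) (param : I → ℕ) : Prop :=
  ∃ (c : Code) (f : ℕ → ℕ) (p : Polynomial ℕ), Computable f ∧
    ∀ x : I, ∃ (answer : Bool) (t : ℕ), Runs c (encode x) (Data.ofBool answer) t ∧
      (answer = true ↔ yes x) ∧ t ≤ f (param x) * p.eval (encode x).size

/-- There is a polynomial-time program that turns every instance `x` into an equivalent instance
`y` of the same problem, with parameter at most that of `x`, whose size (measured by `instSize`)
is bounded by a linear function of the parameter of `x`. -/
def HasLinearKernel {I : Type} (encode : I → Data) (yes : I → Prop) (param : I → ℕ)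
    (instSize : I → ℕ) : Prop :=
  ∃ (c : Code) (p : Polynomial ℕ) (a b : ℕ),
    ∀ x : I, ∃ (y : I) (t : ℕ), Runs c (encode x) (encode y) t ∧ t ≤ p.eval (encode x).size ∧
      (yes y ↔ yes x) ∧ param y ≤ param x ∧ instSize y ≤ a * param x + b

/-! ### The game as a parameterized problem -/

/-- A finite simple graph with vertices `0, …, n - 1`. -/
structure FinGraph where
  n : ℕ
  graph : SimpleGraph (Fin n)

namespace FinGraph

open Classical in
/-- The adjacency matrix, as the list of its rows. -/
noncomputable def encode (G : FinGraph) : Data :=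
  Data.ofList (List.ofFn fun i : Fin G.n =>
    Data.ofList (List.ofFn fun j : Fin G.n => Data.ofBool (decide (G.graph.Adj i j))))

/-- Number of vertices plus number of edges. -/
noncomputable def size (G : FinGraph) : ℕ := G.n + G.graph.edgeSet.ncard

end FinGraph

/-- An instance of the game: a graph and the player who moves first. -/
structure GameInstance where
  G : FinGraph
  first : Player

namespace GameInstance

noncomputable def encode (x : GameInstance) : Data :=
  Data.cons (match x.first with
    | Player.dominator => Data.ofBool true
    | Player.staller => Data.ofBool false) x.G.encode

/-- Dominator has a winning strategy on the graph, with the given player moving first. -/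
def DominatorWins (x : GameInstance) : Prop := MBDom.DominatorWins x.G.graph x.first ∅ ∅

noncomputable def fen (x : GameInstance) : ℕ := feedbackEdgeNumber x.G.graph

end GameInstance

/-- An instance of the game after the first move of Dominator: a graph and the vertex that
Dominator has claimed. It is Staller's turn. -/
structure StartedInstance where
  G : FinGraph
  v : Fin G.n

namespace StartedInstance

noncomputable def encode (x : StartedInstance) : Data :=
  Data.cons x.G.encode (Data.ofNat x.v)

/-- Dominator has a winning strategy in the position where she has claimed `v`, no other vertex is
claimed and it is Staller's turn. -/
def DominatorWins (x : StartedInstance) : Prop :=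
  MBDom.DominatorWins x.G.graph Player.staller {x.v} ∅

noncomputable def fen (x : StartedInstance) : ℕ := feedbackEdgeNumber x.G.graph

noncomputable def size (x : StartedInstance) : ℕ := x.G.size

end StartedInstance

end MBDom

namespace MBDom

/-! ### A positional game on a hypergraph -/

section Hypergraph

variable {V : Type*} [DecidableEq V]

/-! Domination is a hitting game: Dominator has to claim a vertex of every closed neighbourhood.
`DW` keeps only the free vertices and the edges not yet hit, at Staller's turns. Positions are then
easy to compare. Larger edges, fewer edges and an additional move never harm Dominator (`DW.mono`,
`DW.claim`), and she may reserve two vertices as a pair that takes care of every edge containing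
both (`DW.pair`). Staller's weapons are the threat and the double threat (`DW.force`,
`DW.no_double_threat`).

Once Dominator's vertex `v` is fixed, three reductions apply. A leaf and its neighbour may be
deleted, because a move of Staller at the neighbour forces Dominator to the leaf, and conversely the
two form a pair; at `v` only the leaf goes. An isolated vertex other than `v` loses the game. The
main rule removes two consecutive vertices from a long path of vertices of degree two
(`Contraction.win_iff`). Moves on such a path cut it into arms. An arm that ends next to a vertex of
Dominator has a dominated end, and from three vertices on its length does not matter (`tail_congr`).
An arm that ends at a vertex of Staller has in effect a leaf there, so that only the parity of its
length matters (`leaf_congr`). Hence a strategy can be carried from one long path to another of the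
same parity (`LongPaths.transfer`). A move of Staller in the exchanged middle part is translated
into a move in the common part that splits the path with the same parities, and a double threat
forces the answer to be next to it.

No rule increases the feedback edge number `k`. In an irreducible graph without isolated free
vertices every vertex except `v` has degree at least two, so the degrees exceed two by at most `2 *
k + 2` in total. Let `X` consist of `v`, the vertices of degree at least three and the ends of the
feedback edges. Its size and its degree sum are linear in `k`, the distance layers around `X` do not
grow, and a vertex at distance `16` would yield a path to which the main rule applies. So the whole
graph lies within distance `15` of `X` (`card_le_of_reduced`).

Running times are handled by the predicate `PT`, which is closed under composition and under folds
whose accumulator stays of polynomial size (`PT.foldl`); the kernelization is assembled from such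
pieces. For fixed-parameter tractability every first move of Dominator is tried, or, if Staller
begins, an isolated vertex claimed by Dominator is added. Each resulting game is replaced by its
kernel, `2 ^ N` is computed for the largest kernel, and the kernels are solved by tabulating all
positions in time polynomial in `2 ^ N` and the input (`PT.exists_two_pow`, `solve_iff`). -/

/-- The edges that do not contain `d`. -/
def avoid (H : Set (Finset V)) (d : V) : Set (Finset V) := {e | e ∈ H ∧ d ∉ e}

/-- With free vertices `U`, edges `H` not yet hit by Dominator, and Staller to move, Dominator can
hit every edge. -/
inductive DW : Finset V → Set (Finset V) → Prop
  | done (U : Finset V) (H : Set (Finset V)) (h : ∀ e, e ∉ H) : DW U H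
  | move (U : Finset V) (H : Set (Finset V)) (hU : U.Nonempty) (r : V → V)
      (h1 : ∀ s ∈ U, r s ∈ U.erase s)
      (h2 : ∀ s ∈ U, DW ((U.erase s).erase (r s)) (avoid H (r s))) : DW U H

theorem DW.of_replies {U : Finset V} {H : Set (Finset V)} (hU : U.Nonempty)
    (h : ∀ s ∈ U, ∃ d ∈ U.erase s, DW ((U.erase s).erase d) (avoid H d)) : DW U H := by
  classical
  choose! r h1 h2 using h
  exact DW.move U H hU r h1 h2

theorem DW.reply {U : Finset V} {H : Set (Finset V)} (h : DW U H) {e : Finset V} (he : e ∈ H)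
    {s : V} (hs : s ∈ U) : ∃ d ∈ U.erase s, DW ((U.erase s).erase d) (avoid H d) := by
  cases h with
  | done _ _ h => exact absurd he (h e)
  | move _ _ hU r h1 h2 => exact ⟨r s, h1 s hs, h2 s hs⟩

theorem DW.nonempty {U : Finset V} {H : Set (Finset V)} (h : DW U H) {e : Finset V} (he : e ∈ H) :
    U.Nonempty := by
  cases h with
  | done _ _ h => exact absurd he (h e)
  | move _ _ hU r h1 h2 => exact hU

/-- Dominator follows the strategy of the smaller game. When Staller moves outside of `U`, she
credits Staller with some vertex of `U` instead. That vertex is lost in the imagined game but still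
free in the real one, so the invariant persists. -/
theorem DW.mono_of_subset {U : Finset V} {H : Set (Finset V)} (h : DW U H) :
    ∀ {U' : Finset V} {H' : Set (Finset V)}, U ⊆ U' → (∀ e' ∈ H', ∃ e ∈ H, e ∩ U ⊆ e') →
      DW U' H' := by
  induction h with
  | done U H h =>
    intro U' H' _ hH
    exact DW.done _ _ fun e he => by obtain ⟨e0, h0, _⟩ := hH e he; exact h e0 h0
  | move U H hU r h1 h2 ih =>
    intro U' H' hUU hH
    obtain ⟨s0, hs0⟩ := hU
    refine DW.of_replies ⟨s0, hUU hs0⟩ fun s hs => ?_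
    -- `t` is the move credited to Staller: `s` itself if it lies in `U`, an arbitrary vertex of `U`
    -- otherwise.
    have key : ∀ t ∈ U, (s ∈ U → t = s) →
        ∃ d ∈ U'.erase s, DW ((U'.erase s).erase d) (avoid H' d) := by
      intro t ht hts
      have hr := h1 t ht
      rw [Finset.mem_erase] at hr
      have hrs : r t ≠ s := by
        rintro rfl
        exact hr.1 (hts hr.2).symm
      refine ⟨r t, Finset.mem_erase.2 ⟨hrs, hUU hr.2⟩, ih t ht ?_ ?_⟩
      · intro x hx
        simp only [Finset.mem_erase] at hx ⊢
        refine ⟨hx.1, ?_, hUU hx.2.2⟩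
        rintro rfl
        exact hx.2.1 (hts hx.2.2).symm
      · rintro e' ⟨he', hd⟩
        obtain ⟨e, he, hee⟩ := hH e' he'
        refine ⟨e, ⟨he, fun hde => hd (hee (Finset.mem_inter.2 ⟨hde, hr.2⟩))⟩, ?_⟩
        intro x hx
        simp only [Finset.mem_inter, Finset.mem_erase] at hx
        exact hee (Finset.mem_inter.2 ⟨hx.1, hx.2.2.2⟩)
    by_cases hsU : s ∈ U
    · exact key s hsU fun _ => rfl
    · exact key s0 hs0 fun h => absurd h hsU

theorem avoid_avoid (H : Set (Finset V)) (c d : V) : avoid (avoid H c) d = avoid (avoid H d) c := by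
  ext e; simp only [avoid, Set.mem_ofPred_eq]; tauto

/-- An additional move never harms Dominator. -/
theorem DW.claim {U : Finset V} {H : Set (Finset V)} (h : DW U H) :
    ∀ {d : V}, d ∈ U → DW (U.erase d) (avoid H d) := by
  induction h with
  | done U H h => exact fun _ => DW.done _ _ fun e he => h e he.1
  | move U H hU r h1 h2 ih =>
    intro d hd
    by_cases hH : ∀ e, e ∉ avoid H d
    · exact DW.done _ _ hH
    push Not at hH
    obtain ⟨e, he⟩ := hH
    have hne : (U.erase d).Nonempty := by
      by_contra hemp
      have hU1 : U = {d} := by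
        rw [Finset.not_nonempty_iff_eq_empty] at hemp
        rw [← Finset.insert_erase hd, hemp]; rfl
      have := h1 d hd
      rw [hU1] at this
      simp at this
    refine DW.of_replies hne fun s hs => ?_
    have hs' := Finset.mem_erase.1 hs
    have hr := Finset.mem_erase.1 (h1 s hs'.2)
    by_cases hrd : r s = d
    -- The strategy asks for the vertex that is already claimed. Any free `d2` may be taken instead;
    -- it is in turn an additional move.
    · have h3 := h2 s hs'.2
      rw [hrd, Finset.erase_right_comm] at h3
      have hne2 : ((U.erase d).erase s).Nonempty := h3.nonempty he
      obtain ⟨d2, hd2⟩ := hne2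
      refine ⟨d2, hd2, ?_⟩
      have h4 := ih s hs'.2 (d := d2) (by rw [hrd, Finset.erase_right_comm]; exact hd2)
      rw [hrd] at h4
      rwa [Finset.erase_right_comm (a := s) (b := d)] at h4
    · refine ⟨r s, ?_, ?_⟩
      · simp only [Finset.mem_erase]; exact ⟨hr.1, hrd, hr.2⟩
      · have h4 := ih s hs'.2 (d := d) (by
          simp only [Finset.mem_erase]; exact ⟨fun h => hrd h.symm, fun h => hs'.1 h.symm, hd⟩)
        rw [avoid_avoid] at h4
        have : ((U.erase d).erase s).erase (r s) = ((U.erase s).erase (r s)).erase d := by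
          ext x; simp only [Finset.mem_erase]; tauto
        rwa [this]

/-- Dominator profits from larger edges and from fewer edges; vertices in no edge are immaterial. -/
theorem DW.mono {U U' : Finset V} {H H' : Set (Finset V)} (h : DW U H)
    (hH : ∀ e' ∈ H', ∃ e ∈ H, e ∩ U ⊆ e' ∩ U') : DW U' H' := by
  have h1 : DW U {e ∈ H | e ∩ U ⊆ U'} :=
    h.mono_of_subset subset_rfl fun e he => ⟨e, he.1, Finset.inter_subset_left⟩
  -- The vertices outside of `U'` are given to Dominator one by one. They lie in none of the edges
  -- that were kept, so no edge disappears.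
  have h2 : ∀ W : Finset V, W ⊆ U \ U' → DW (U \ W) {e ∈ H | e ∩ U ⊆ U'} := by
    intro W
    induction W using Finset.induction_on with
    | empty => intro _; simpa using h1
    | insert a W ha ih =>
      intro hW
      have hW' := Finset.insert_subset_iff.1 hW
      have h3 := (ih hW'.2).claim (d := a) (by
        have := Finset.mem_sdiff.1 hW'.1
        simp [this.1, ha])
      rw [Finset.sdiff_insert]
      refine h3.mono_of_subset subset_rfl fun e he => ⟨e, ⟨he, fun hae => ?_⟩,
        Finset.inter_subset_left⟩
      have := Finset.mem_sdiff.1 hW'.1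
      exact this.2 (he.2 (Finset.mem_inter.2 ⟨hae, this.1⟩))
  refine (h2 _ subset_rfl).mono_of_subset (fun x hx => ?_) fun e' he' => ?_
  · simp only [Finset.mem_sdiff] at hx; tauto
  · obtain ⟨e, he, hee⟩ := hH e' he'
    refine ⟨e, ⟨he, hee.trans Finset.inter_subset_right⟩, fun x hx => ?_⟩
    simp only [Finset.mem_inter, Finset.mem_sdiff] at hx
    exact (Finset.mem_inter.1 (hee (Finset.mem_inter.2 ⟨hx.1, hx.2.1⟩))).1

/-- Dominator answers `a` by `b` and `b` by `a`, and otherwise plays on the remaining vertices. If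
nothing else is left to hit, she takes one of the two in the next round. -/
theorem DW.pair_aux {U : Finset V} {H : Set (Finset V)} (h : DW U H) :
    ∀ {U' : Finset V} {H' : Set (Finset V)} {a b : V}, a ≠ b → a ∈ U' → b ∈ U' →
      U = (U'.erase a).erase b → H = {e | e ∈ H' ∧ ¬ (a ∈ e ∧ b ∈ e)} → DW U' H' := by
  induction h with
  | done U H h =>
    intro U' H' a b hab ha hb hU hH
    subst hU hH
    refine DW.of_replies ⟨a, ha⟩ fun s hs => ?_
    have key : ∀ d ∈ U'.erase s, (d = a ∨ d = b) →
        ∃ d ∈ U'.erase s, DW ((U'.erase s).erase d) (avoid H' d) := by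
      intro d hd hdab
      refine ⟨d, hd, DW.done _ _ ?_⟩
      rintro e ⟨he, hde⟩
      refine h e ⟨he, ?_⟩
      rcases hdab with rfl | rfl <;> tauto
    by_cases has : a = s
    · exact key b (Finset.mem_erase.2 ⟨fun h => hab (has.trans h.symm), hb⟩) (Or.inr rfl)
    · exact key a (Finset.mem_erase.2 ⟨has, ha⟩) (Or.inl rfl)
  | move U H hU r h1 h2 ih =>
    intro U' H' a b hab ha hb hU' hH
    subst hU' hH
    refine DW.of_replies ⟨a, ha⟩ fun s hs => ?_
    have hDW : DW ((U'.erase a).erase b) {e | e ∈ H' ∧ ¬ (a ∈ e ∧ b ∈ e)} := DW.move _ _ hU r h1 h2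
    by_cases has : s = a
    · refine ⟨b, Finset.mem_erase.2 ⟨fun h => hab (has.symm.trans h.symm), hb⟩, ?_⟩
      rw [has]
      exact hDW.mono_of_subset subset_rfl fun e he =>
        ⟨e, ⟨he.1, fun h => he.2 h.2⟩, Finset.inter_subset_left⟩
    by_cases hbs : s = b
    · refine ⟨a, Finset.mem_erase.2 ⟨fun h => has h.symm, ha⟩, ?_⟩
      rw [hbs, Finset.erase_right_comm]
      exact hDW.mono_of_subset subset_rfl fun e he =>
        ⟨e, ⟨he.1, fun h => he.2 h.1⟩, Finset.inter_subset_left⟩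
    have hsU : s ∈ (U'.erase a).erase b := by simp only [Finset.mem_erase]; tauto
    have hr := h1 s hsU
    simp only [Finset.mem_erase] at hr
    refine ⟨r s, Finset.mem_erase.2 ⟨hr.1, hr.2.2.2⟩, ih s hsU hab ?_ ?_ ?_ ?_⟩
    · simp only [Finset.mem_erase]; tauto
    · simp only [Finset.mem_erase]; tauto
    · ext x; simp only [Finset.mem_erase]; tauto
    · ext e; simp only [avoid, Set.mem_ofPred_eq]; tauto

/-- Dominator can hit every edge that contains two given fresh vertices. -/
theorem DW.pair {U U' : Finset V} {H H' : Set (Finset V)} (h : DW U H) {a b : V} (hab : a ≠ b)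
    (haU : a ∉ U) (hbU : b ∉ U) (ha : a ∈ U') (hb : b ∈ U')
    (hH : ∀ e' ∈ H', (∃ e ∈ H, e ∩ U ⊆ e' ∩ U') ∨ (a ∈ e' ∧ b ∈ e')) : DW U' H' := by
  refine DW.pair_aux (U := (U'.erase a).erase b) (H := {e | e ∈ H' ∧ ¬ (a ∈ e ∧ b ∈ e)}) ?_
    hab ha hb rfl rfl
  refine h.mono fun e' he' => ?_
  obtain ⟨e, he, hee⟩ := (hH e' he'.1).resolve_right he'.2
  refine ⟨e, he, fun x hx => ?_⟩
  have hxU := (Finset.mem_inter.1 hx).2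
  have := hee hx
  simp only [Finset.mem_erase, Finset.mem_inter] at this ⊢
  exact ⟨this.1, fun h => hbU (h ▸ hxU), fun h => haU (h ▸ hxU), this.2⟩

/-- An edge without free vertices could never be hit any more. -/
theorem DW.exists_mem {U : Finset V} {H : Set (Finset V)} (h : DW U H) :
    ∀ {e : Finset V}, e ∈ H → ∃ x ∈ e, x ∈ U := by
  induction h with
  | done U H h => exact fun {e} he => absurd he (h e)
  | move U H hU r h1 h2 ih =>
    intro e he
    obtain ⟨s, hs⟩ := hU
    by_cases hr : r s ∈ e
    · exact ⟨_, hr, (Finset.mem_erase.1 (h1 s hs)).2⟩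
    · obtain ⟨x, hx, hxU⟩ := ih s hs (e := e) ⟨he, hr⟩
      simp only [Finset.mem_erase] at hxU
      exact ⟨x, hx, hxU.2.2⟩

/-- Every edge has two free vertices when Staller is to move. -/
theorem DW.exists_ne {U : Finset V} {H : Set (Finset V)} (h : DW U H) {e : Finset V} (he : e ∈ H)
    (x : V) : ∃ y ∈ e, y ∈ U ∧ y ≠ x := by
  by_contra hcon
  push Not at hcon
  obtain ⟨z, hz, hzU⟩ := h.exists_mem he
  have hzx := hcon z hz hzU
  subst hzx
  obtain ⟨d, hd, h'⟩ := h.reply he hzU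
  rw [Finset.mem_erase] at hd
  have hde : d ∉ e := fun hde => hd.1 (hcon d hde hd.2)
  obtain ⟨y, hy, hyU⟩ := h'.exists_mem (e := e) ⟨he, hde⟩
  simp only [Finset.mem_erase] at hyU
  exact hyU.2.1 (hcon y hy hyU.2.2)

/-- A threat has to be answered. -/
theorem DW.force {U : Finset V} {H : Set (Finset V)} (h : DW U H) {e : Finset V} (he : e ∈ H)
    {s d : V} (hs : s ∈ U) (hed : ∀ x ∈ e, x ∈ U → x = s ∨ x = d) :
    DW ((U.erase s).erase d) (avoid H d) := by
  obtain ⟨d', hd', h'⟩ := h.reply he hs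
  rw [Finset.mem_erase] at hd'
  by_cases hde : d' ∈ e
  · rcases hed d' hde hd'.2 with rfl | rfl
    · exact absurd rfl hd'.1
    · exact h'
  · obtain ⟨y, hy, hyU, hyd⟩ := h'.exists_ne (e := e) ⟨he, hde⟩ d
    simp only [Finset.mem_erase] at hyU
    rcases hed y hy hyU.2.2 with rfl | rfl
    · exact absurd rfl hyU.2.1
    · exact absurd rfl hyd

/-- A double threat through `x` cannot be met. -/
theorem DW.no_double_threat {U : Finset V} {H : Set (Finset V)} (h : DW U H) {e₁ e₂ : Finset V}
    (h₁ : e₁ ∈ H) (h₂ : e₂ ∈ H) {x : V} (hx : x ∈ U) (y : V)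
    (hy : ∀ z ∈ e₁, z ∈ U → z = x ∨ z = y) (hy2 : y ∉ e₂ ∨ y ∉ U)
    (z : V) (hz : ∀ w ∈ e₂, w ∈ U → w = x ∨ w = z) : False := by
  obtain ⟨d, hd, h'⟩ := h.reply h₁ hx
  rw [Finset.mem_erase] at hd
  by_cases hde : d ∈ e₁
  · have hdy : d = y := (hy d hde hd.2).resolve_left hd.1
    subst hdy
    obtain ⟨w, hw, hwU, hwz⟩ := h'.exists_ne (e := e₂) ⟨h₂, by tauto⟩ z
    simp only [Finset.mem_erase] at hwU
    rcases hz w hw hwU.2.2 with h | h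
    · exact hwU.2.1 h
    · exact hwz h
  · obtain ⟨w, hw, hwU, hwz⟩ := h'.exists_ne (e := e₁) ⟨h₁, hde⟩ y
    simp only [Finset.mem_erase] at hwU
    rcases hy w hw hwU.2.2 with h | h
    · exact hwU.2.1 h
    · exact hwz h

/-! ### Paths -/

/-- The sets of three consecutive entries of a list. -/
def triples : List V → Set (Finset V)
  | a :: b :: c :: l => insert {a, b, c} (triples (b :: c :: l))
  | _ => ∅

theorem mem_triples_iff {e : Finset V} : ∀ {L : List V}, e ∈ triples L ↔
    ∃ P Q a b c, L = P ++ a :: b :: c :: Q ∧ e = {a, b, c}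
  | [] => by simp [triples]
  | [_] => by simp [triples, List.cons_eq_append_iff]
  | [_, _] => by simp [triples, List.cons_eq_append_iff]
  | a :: b :: c :: l => by
    rw [triples, Set.mem_insert_iff, mem_triples_iff (L := b :: c :: l)]
    constructor
    · rintro (rfl | ⟨P, Q, x, y, z, h, rfl⟩)
      · exact ⟨[], l, a, b, c, rfl, rfl⟩
      · exact ⟨a :: P, Q, x, y, z, by rw [h]; rfl, rfl⟩
    · rintro ⟨P, Q, x, y, z, h, rfl⟩
      rcases P with _ | ⟨p, P⟩
      · simp only [List.nil_append, List.cons.injEq] at h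
        obtain ⟨rfl, rfl, rfl, rfl⟩ := h
        exact Or.inl rfl
      · simp only [List.cons_append, List.cons.injEq] at h
        exact Or.inr ⟨P, Q, x, y, z, h.2, rfl⟩

theorem subset_of_mem_triples {L : List V} {e : Finset V} (h : e ∈ triples L) :
    ∀ x ∈ e, x ∈ L := by
  obtain ⟨P, Q, a, b, c, rfl, rfl⟩ := mem_triples_iff.1 h
  simp only [Finset.mem_insert, Finset.mem_singleton]
  rintro x (rfl | rfl | rfl) <;> simp

theorem triples_append_right {L M : List V} : triples M ⊆ triples (L ++ M) := by
  intro e he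
  obtain ⟨P, Q, a, b, c, rfl, rfl⟩ := mem_triples_iff.1 he
  exact mem_triples_iff.2 ⟨L ++ P, Q, a, b, c, by simp, rfl⟩

theorem triples_append_left {L M : List V} : triples L ⊆ triples (L ++ M) := by
  intro e he
  obtain ⟨P, Q, a, b, c, rfl, rfl⟩ := mem_triples_iff.1 he
  exact mem_triples_iff.2 ⟨P, Q ++ M, a, b, c, by simp, rfl⟩

theorem triples_reverse (L : List V) : triples L.reverse = triples L := by
  have key : ∀ L : List V, triples L ⊆ triples L.reverse := by
    intro L e he
    obtain ⟨P, Q, a, b, c, rfl, rfl⟩ := mem_triples_iff.1 he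
    refine mem_triples_iff.2 ⟨Q.reverse, P.reverse, c, b, a, by simp, ?_⟩
    ext x; simp only [Finset.mem_insert, Finset.mem_singleton]; tauto
  refine (key L).antisymm' ?_
  simpa using key L.reverse

theorem avoid_union (H K : Set (Finset V)) (d : V) : avoid (H ∪ K) d = avoid H d ∪ avoid K d := by
  ext e; simp only [avoid, Set.mem_ofPred_eq, Set.mem_union]; tauto

theorem avoid_triples_of_notMem {L : List V} {d : V} (h : d ∉ L) : avoid (triples L) d = triples L := by
  ext e
  exact ⟨fun he => he.1, fun he => ⟨he, fun hd => h (subset_of_mem_triples he d hd)⟩⟩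

/-- A vertex of Dominator cuts the path into independent pieces. The vertex next to `d` on either
side keeps no triple of its own: these are the dominated ends. -/
theorem avoid_triples {P Q : List V} {d : V} (hP : d ∉ P) (hQ : d ∉ Q) :
    avoid (triples (P ++ d :: Q)) d = triples P ∪ triples Q := by
  ext e
  constructor
  · rintro ⟨he, hd⟩
    obtain ⟨A, B, x, y, z, h, rfl⟩ := mem_triples_iff.1 he
    simp only [Finset.mem_insert, Finset.mem_singleton, not_or] at hd
    rcases List.append_eq_append_iff.1 h with ⟨C, hC, hC2⟩ | ⟨C, hC, hC2⟩
    · right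
      rcases C with _ | ⟨c, C⟩
      · simp at hC2; tauto
      · simp only [List.cons_append, List.cons.injEq] at hC2
        exact mem_triples_iff.2 ⟨C, B, x, y, z, hC2.2, rfl⟩
    · left
      have h3 : ∀ {l m : List V}, x :: y :: z :: l = m ++ d :: Q → ∃ m', m = x :: y :: z :: m' := by
        rintro l (_ | ⟨m1, _ | ⟨m2, _ | ⟨m3, m⟩⟩⟩) hm
        · simp at hm; tauto
        · simp at hm; tauto
        · simp at hm; tauto
        · simp at hm; exact ⟨m, by simp [hm]⟩
      obtain ⟨m', rfl⟩ := h3 hC2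
      exact mem_triples_iff.2 ⟨A, m', x, y, z, hC, rfl⟩
  · rintro (he | he)
    · exact ⟨triples_append_left he, fun h => hP (subset_of_mem_triples he d h)⟩
    · refine ⟨?_, fun h => hQ (subset_of_mem_triples he d h)⟩
      have := triples_append_right (L := P ++ [d]) he
      simpa using this

/-- A path that is attached to nothing does not matter. -/
theorem DW.isolated : ∀ {Y : List V} {c : V} {U U' : Finset V} {H H' : Set (Finset V)},
    DW U H → Y.Nodup → (∀ y ∈ Y, y ∉ U) → (∀ y ∈ Y, y ∈ U') →
    (∀ e' ∈ H', (∃ e ∈ H, e ∩ U ⊆ e' ∩ U') ∨ e' ∈ triples (c :: Y)) → DW U' H'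
  | [], c, U, U', H, H', h, _, _, _, hH => h.mono fun e' he' => by simpa [triples] using hH e' he'
  | [y], c, U, U', H, H', h, _, _, _, hH => h.mono fun e' he' => by simpa [triples] using hH e' he'
  | y₁ :: y₂ :: Y, c, U, U', H, H', h, hnd, hU, hU', hH => by
    simp only [List.nodup_cons, List.mem_cons, not_or] at hnd
    simp only [List.mem_cons, forall_eq_or_imp] at hU hU'
    -- The pair `y₁`, `y₂` serves the first two triples. The next one starts at `y₂`, which takes
    -- over the role of `c`.
    have h1 : DW ((U'.erase y₁).erase y₂) {e | e ∈ H' ∧ ¬ (y₁ ∈ e ∧ y₂ ∈ e)} := by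
      refine DW.isolated (Y := Y) (c := y₂) h hnd.2.2 hU.2.2 (fun y hy => ?_) fun e' he' => ?_
      · simp only [Finset.mem_erase]
        exact ⟨fun h => hnd.2.1 (h ▸ hy), fun h => hnd.1.2 (h ▸ hy), hU'.2.2 y hy⟩
      · rcases hH e' he'.1 with ⟨e, he, hee⟩ | h3
        · left
          refine ⟨e, he, fun x hx => ?_⟩
          have hxU := (Finset.mem_inter.1 hx).2
          have := hee hx
          simp only [Finset.mem_inter, Finset.mem_erase] at this ⊢
          exact ⟨this.1, fun h => hU.2.1 (h ▸ hxU), fun h => hU.1 (h ▸ hxU), this.2⟩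
        · right
          rw [triples, Set.mem_insert_iff] at h3
          rcases h3 with rfl | h3
          · simp at he'
          · rcases Y with _ | ⟨y₃, Y⟩
            · simp [triples] at h3
            · rw [triples, Set.mem_insert_iff] at h3
              rcases h3 with rfl | h3
              · simp at he'
              · exact h3
    exact h1.pair_aux hnd.1.1 hU'.1 hU'.2.1 rfl rfl

end Hypergraph


/-! ### Paths attached to the rest at one end -/

section Paths

variable {V : Type*} [DecidableEq V]

/-- A path that has been separated from the edges `A` does not matter. -/
theorem DW.cut {W W' : Finset V} {K H' A : Set (Finset V)} {Q : List V} {c : V} (h : DW W K)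
    (hA : A ⊆ K) (hQ : ∀ e ∈ A, ∀ x ∈ Q, x ∉ e) (hW : ∀ e ∈ A, ∀ x ∈ e, x ∈ W → x ∈ W')
    (hnd : Q.Nodup) (hQW : ∀ x ∈ Q, x ∈ W') (hH : ∀ e' ∈ H', e' ∈ A ∨ e' ∈ triples (c :: Q)) :
    DW W' H' := by
  have h1 : DW (W \ Q.toFinset) A := h.mono fun e he => ⟨e, hA he, fun x hx => by
    simp only [Finset.mem_inter, Finset.mem_sdiff, List.mem_toFinset] at hx ⊢
    exact ⟨hx.1, hx.2, fun hxQ => hQ e he x hxQ hx.1⟩⟩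
  refine h1.isolated (Y := Q) (c := c) hnd (fun y hy => by simp [hy]) hQW fun e' he' => ?_
  rcases hH e' he' with h | h
  · refine Or.inl ⟨e', h, fun x hx => ?_⟩
    simp only [Finset.mem_inter, Finset.mem_sdiff] at hx ⊢
    exact ⟨hx.1, hW e' h x hx.1 hx.2.1⟩
  · exact Or.inr h

/-- The edges `C` meet the path `Y`, which is attached to `b`, only in its first vertex, and
contain `b` then. -/
def Attached (C : Set (Finset V)) (b : V) (Y : List V) : Prop :=
  ∀ e ∈ C, ∀ y ∈ Y, y ∈ e → b ∈ e ∧ Y.head? = some y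

theorem Attached.avoid {C : Set (Finset V)} {b : V} {Y : List V} (h : Attached C b Y) (d : V) :
    Attached (avoid C d) b Y := fun e he => h e he.1

/-- The last vertex has no triple of its own, so the path has a dominated end. Dominator copies her
replies from the shorter path. As soon as she claims `b` or a vertex of the path, everything beyond
it is cut off and is won by pairs, whatever its length. Only exchanges off the path need the
induction on the size of `U`. -/
theorem tail_snoc {b z : V} {Y : List V} (hnd : (b :: (Y ++ [z])).Nodup) (hlen : 3 ≤ Y.length) :
    ∀ (n : ℕ) (U : Finset V) (C : Set (Finset V)), U.card = n → (∀ y ∈ Y ++ [z], y ∉ U) →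
      Attached C b (Y ++ [z]) → DW (U ∪ Y.toFinset) (C ∪ triples (b :: Y)) →
      DW (U ∪ (Y ++ [z]).toFinset) (C ∪ triples (b :: (Y ++ [z]))) := by
  intro n
  induction n using Nat.strong_induction_on with
  | _ n ih =>
  intro U C hn hU hC h
  obtain ⟨y₁, y₂, Y', hY⟩ : ∃ y₁ y₂ Y', Y = y₁ :: y₂ :: Y' := by
    rcases Y with _ | ⟨y₁, _ | ⟨y₂, Y'⟩⟩
    · simp at hlen
    · simp at hlen
    · exact ⟨y₁, y₂, Y', rfl⟩
  have hedge : ({b, y₁, y₂} : Finset V) ∈ C ∪ triples (b :: Y) := by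
    rw [hY]; exact Or.inr (Or.inl rfl)
  have hC1 : ∀ e ∈ C, ∀ y ∈ Y ++ [z], y ∈ e → b ∈ e ∧ y = y₁ := fun e he y hy hye => by
    have := hC e he y hy hye
    simp [hY] at this
    exact ⟨this.1, this.2.symm⟩
  refine DW.of_replies ⟨y₁, by simp [hY]⟩ fun s hs => ?_
  simp only [Finset.mem_union, List.mem_toFinset] at hs
  -- Dominator claims `d`, with `P` before it and `R` behind it on the path; `Q` is `R` without a
  -- vertex of Staller directly behind `d`. The side of `b` is won by `hDW`, the other side by pairs
  -- in `Q`.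
  have onY : ∀ (d : V) (P R Q : List V) (c : V) (W : Finset V) (K : Set (Finset V)),
      b :: (Y ++ [z]) = P ++ d :: R → (R = Q ∧ s ∉ Q ∨ R = s :: Q ∧ c = s) →
      d ∈ U ∪ (Y ++ [z]).toFinset → DW W K → avoid C d ∪ triples P ⊆ K →
      (s ∉ W ∨ ∀ e ∈ avoid C d ∪ triples P, s ∉ e) → s ≠ d → W ⊆ U ∪ Y.toFinset →
      ∃ d ∈ (U ∪ (Y ++ [z]).toFinset).erase s, DW (((U ∪ (Y ++ [z]).toFinset).erase s).erase d)
        (avoid (C ∪ triples (b :: (Y ++ [z]))) d) := by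
    intro d P R Q c W K hP hR hd hDW hA hs' hsd hW
    have hnd' : (P ++ d :: R).Nodup := hP ▸ hnd
    have hQR : ∀ x ∈ Q, x ∈ R ∧ x ≠ s := by
      rcases hR with ⟨rfl, h⟩ | ⟨rfl, rfl⟩
      · exact fun x hx => ⟨hx, fun hxs => h (hxs ▸ hx)⟩
      · simp only [List.nodup_append, List.nodup_cons, List.mem_cons] at hnd'
        exact fun x hx => ⟨List.mem_cons_of_mem _ hx, fun hxs => hnd'.2.1.2.1 (hxs ▸ hx)⟩
    have hQnd : Q.Nodup := by
      rcases hR with ⟨rfl, h⟩ | ⟨rfl, rfl⟩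
      · exact (List.nodup_cons.1 (List.nodup_append.1 hnd').2.1).2
      · exact (List.nodup_cons.1 (List.nodup_cons.1 (List.nodup_append.1 hnd').2.1).2).2
    have hRY : ∀ x ∈ R, x ∈ Y ++ [z] ∧ x ≠ d := by
      intro x hx
      have h1 : x ∈ b :: (Y ++ [z]) := by rw [hP]; simp [hx]
      have h2 : x ≠ d := by
        rintro rfl
        exact (List.nodup_cons.1 (List.nodup_append.1 hnd').2.1).1 hx
      refine ⟨(List.mem_cons.1 h1).resolve_left ?_, h2⟩
      rintro rfl
      rcases P with _ | ⟨p, P⟩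
      · simp only [List.nil_append, List.cons.injEq] at hP
        exact h2 hP.1
      · simp only [List.cons_append, List.cons.injEq] at hP
        rw [← hP.1] at hnd'
        simp [hx] at hnd'
    have hav : avoid (C ∪ triples (b :: (Y ++ [z]))) d = avoid C d ∪ triples P ∪ triples R := by
      rw [avoid_union, hP, avoid_triples, Set.union_assoc]
      · intro h; exact (List.nodup_append.1 hnd').2.2 d h d (by simp) rfl
      · exact (List.nodup_cons.1 (List.nodup_append.1 hnd').2.1).1
    refine ⟨d, Finset.mem_erase.2 ⟨hsd.symm, hd⟩, hDW.cut (Q := Q) (c := c) hA ?_ ?_ hQnd ?_ ?_⟩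
    · rintro e (he | he) x hx hxe
      · obtain ⟨hbe, rfl⟩ := hC1 e he.1 x (hRY x (hQR x hx).1).1 hxe
        rcases P with _ | ⟨p, _ | ⟨p', P⟩⟩
        · simp only [List.nil_append, List.cons.injEq] at hP
          exact he.2 (hP.1 ▸ hbe)
        · simp only [hY, List.cons_append, List.nil_append, List.cons.injEq] at hP
          exact (hRY x (hQR x hx).1).2 hP.2.1
        · simp only [hY, List.cons_append, List.cons.injEq] at hP
          rw [← hP.2.1] at hnd'
          simp [(hQR x hx).1] at hnd'
      · have := subset_of_mem_triples he x hxe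
        exact (List.nodup_append.1 hnd').2.2 x this x (by simp [(hQR x hx).1]) rfl
    · intro e he x hxe hxW
      have hxU := hW hxW
      simp only [Finset.mem_erase, Finset.mem_union, List.mem_toFinset, List.mem_append] at hxU ⊢
      refine ⟨?_, ?_, by tauto⟩
      · rintro rfl
        rcases he with he | he
        · exact he.2 hxe
        · exact (List.nodup_append.1 hnd').2.2 x (subset_of_mem_triples he x hxe) x (by simp) rfl
      · rintro rfl
        rcases hs' with h | h
        · exact h hxW
        · exact h e he hxe
    · intro x hx
      simp only [Finset.mem_erase, Finset.mem_union, List.mem_toFinset]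
      exact ⟨(hRY x (hQR x hx).1).2, (hQR x hx).2, Or.inr (hRY x (hQR x hx).1).1⟩
    · rw [hav]
      rintro e' (h | h)
      · exact Or.inl h
      · right
        rcases hR with ⟨rfl, -⟩ | ⟨rfl, rfl⟩
        · exact triples_append_right (L := [c]) h
        · exact h
  have hWsub : ∀ s d, ((U ∪ Y.toFinset).erase s).erase d ⊆ U ∪ Y.toFinset := fun s d =>
    (Finset.erase_subset _ _).trans (Finset.erase_subset _ _)
  rcases hs with hsU | hsY
  · have hsY : s ∉ Y ++ [z] := fun h => hU s h hsU
    obtain ⟨d, hd, hd'⟩ := h.reply hedge (s := s) (by simp [hsU])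
    simp only [Finset.mem_erase, Finset.mem_union, List.mem_toFinset] at hd
    by_cases hdb : d = b
    · subst hdb
      by_cases hdU : d ∈ U
      · refine onY d [] (Y ++ [z]) (Y ++ [z]) d _ _ rfl (Or.inl ⟨rfl, hsY⟩) (by simp [hdU]) hd' ?_
          (Or.inl (by simp)) hd.1.symm (hWsub _ _)
        rw [avoid_union]
        simp [triples]
      · exact absurd (hd.2.resolve_left hdU) (by simp at hnd; tauto)
    rcases hd.2 with hdU | hdY
    · have hdY : d ∉ b :: (Y ++ [z]) := by
        rw [List.mem_cons]; rintro (h | h)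
        · exact hdb h
        · exact hU d h hdU
      refine ⟨d, by simp [hd.1, hdU], ?_⟩
      have e1 : ∀ L : List V, (∀ y ∈ L, y ∈ Y ++ [z]) → ((U ∪ L.toFinset).erase s).erase d =
          (U.erase s).erase d ∪ L.toFinset := by
        intro L hL
        ext x
        simp only [Finset.mem_erase, Finset.mem_union, List.mem_toFinset]
        constructor
        · tauto
        · rintro (h | h)
          · tauto
          · exact ⟨fun h' => hdY (List.mem_cons_of_mem _ (hL d (h' ▸ h))),
              fun h' => hsY (hL s (h' ▸ h)), Or.inr h⟩
      rw [e1 _ (fun y hy => hy), avoid_union, avoid_triples_of_notMem hdY]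
      rw [e1 _ (fun y hy => by simp [hy]), avoid_union, avoid_triples_of_notMem (by
        simp at hdY; simp; tauto)] at hd'
      refine ih _ ?_ _ _ rfl (fun y hy hyU => hU y hy ?_) (hC.avoid d) hd'
      · rw [← hn, Finset.card_erase_of_mem (by simp [hd.1, hdU])]
        have := Finset.card_erase_lt_of_mem hsU
        omega
      · simp at hyU; exact hyU.2.2
    · obtain ⟨P, Q, hPQ⟩ := List.append_of_mem hdY
      refine onY d (b :: P) (Q ++ [z]) (Q ++ [z]) d _ _ (by simp [hPQ]) (Or.inl ⟨rfl, fun h => ?_⟩)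
        (by simp [hdY]) hd' ?_ (Or.inl (by simp)) hd.1.symm (hWsub _ _)
      · refine hsY ?_
        rw [hPQ]; simp at h ⊢; tauto
      · rw [avoid_union, hPQ]
        have hh := hnd
        rw [hPQ] at hh
        have := avoid_triples (P := b :: P) (Q := Q) (d := d)
          (by intro h; simp [List.nodup_append] at hh; simp at h; grind)
          (by intro h; simp [List.nodup_append] at hh; grind)
        rw [List.cons_append] at this
        rw [this]
        exact Set.union_subset_union_right _ Set.subset_union_left
  · obtain ⟨P, Q, hPQ⟩ := List.append_of_mem hsY
    have hpre : ∀ d (P' R' : List V), b :: (Y ++ [z]) = P' ++ d :: R' →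
        avoid C d ∪ triples P' ⊆ avoid (C ∪ triples (b :: Y)) d := by
      intro d P' R' h
      rw [avoid_union]
      refine Set.union_subset_union_right _ fun e he => ⟨?_, fun hde => ?_⟩
      · have h1 : b :: Y = (P' ++ d :: R').dropLast := by
          rw [← h, ← List.cons_append, List.dropLast_concat]
        rw [h1, List.dropLast_append_of_ne_nil (by simp)]
        exact triples_append_left he
      · rw [h] at hnd
        exact (List.nodup_append.1 hnd).2.2 d (subset_of_mem_triples he d hde) d (by simp) rfl
    have hlenPQ : Y.length = P.length + Q.length := by
      have := congrArg List.length hPQ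
      simp at this; omega
    have hsb : s ≠ b := by rintro rfl; exact (List.nodup_cons.1 hnd).1 hsY
    have hnd2 : (b :: P ++ s :: Q).Nodup := by rw [hPQ] at hnd; exact hnd
    -- Near the end Dominator takes the vertex `p` before `s`, and no move is made in the shorter
    -- game. As `Y` has at least three vertices, `P` is not empty and `p` lies on `Y`.
    by_cases hQ : Q.length ≤ 2
    · obtain ⟨P₀, p, rfl⟩ : ∃ P₀ p, P = P₀ ++ [p] := by
        rcases List.eq_nil_or_concat P with rfl | ⟨P₀, p, rfl⟩
        · simp at hlenPQ; omega
        · exact ⟨P₀, p, by simp⟩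
      have hpY : p ∈ Y ++ [z] := by rw [hPQ]; simp
      have hYP : b :: (Y ++ [z]) = (b :: P₀) ++ p :: (s :: Q) := by simp [hPQ]
      have hps : s ≠ p := by
        rintro rfl; simp [List.nodup_append] at hnd2
      refine onY p (b :: P₀) (s :: Q) Q s _ _ hYP (Or.inr ⟨rfl, rfl⟩) (by simp at hpY; simp; tauto)
        h ((hpre _ _ _ hYP).trans fun e he => he.1) (Or.inr ?_) hps subset_rfl
      rintro e (he | he) hse
      · obtain ⟨-, rfl⟩ := hC1 e he.1 s hsY hse
        rw [hY] at hPQ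
        rcases P₀ with _ | ⟨p', P₀⟩
        · simp at hPQ; exact hps hPQ.1
        · simp at hPQ
          rw [← hPQ.1] at hnd2
          simp at hnd2
      · have := subset_of_mem_triples he s hse
        have h3 := (List.nodup_append.1 hnd2).2.2 s (by simp at this ⊢; tauto) s (by simp)
        exact h3 rfl
    · obtain ⟨q₁, q₂, Q₀, rfl⟩ : ∃ q₁ q₂ Q₀, Q = q₁ :: q₂ :: Q₀ ++ [z] := by
        rcases List.eq_nil_or_concat Q with rfl | ⟨Q', q, rfl⟩
        · simp at hQ
        · simp only [List.concat_eq_append] at hPQ hQ ⊢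
          have : z = q := by
            rw [← List.cons_append, ← List.append_assoc] at hPQ
            simpa using (List.append_inj' hPQ rfl).2
          subst this
          rcases Q' with _ | ⟨q₁, _ | ⟨q₂, Q₀⟩⟩
          · simp at hQ
          · simp at hQ
          · exact ⟨q₁, q₂, Q₀, rfl⟩
      have hYQ : Y = P ++ s :: q₁ :: q₂ :: Q₀ := by
        have : Y ++ [z] = (P ++ s :: q₁ :: q₂ :: Q₀) ++ [z] := by rw [hPQ]; simp
        exact List.append_cancel_right this
      obtain ⟨P₁, p, hP₁⟩ : ∃ P₁ p, b :: P = P₁ ++ [p] := by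
        rcases List.eq_nil_or_concat (b :: P) with h | ⟨P₀, p, h⟩
        · simp at h
        · exact ⟨P₀, p, by simpa using h⟩
      have hbY : b :: (Y ++ [z]) = P₁ ++ p :: s :: q₁ :: q₂ :: (Q₀ ++ [z]) := by
        rw [hPQ, ← List.cons_append, hP₁]; simp
      have hbY' : b :: Y = P₁ ++ p :: s :: q₁ :: q₂ :: Q₀ := by
        rw [hYQ, ← List.cons_append, hP₁]; simp
      have hnd3 := hnd
      rw [hbY] at hnd3
      simp only [List.nodup_append, List.nodup_cons, List.mem_cons, not_or] at hnd3
      obtain ⟨d, hd, hd'⟩ := h.reply hedge (s := s) (by simp [hYQ])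
      have hd2 : d ∈ U ∪ (Y ++ [z]).toFinset := by
        simp at hd ⊢; tauto
      rw [Finset.mem_erase] at hd
      have hsn : s ∉ ((U ∪ Y.toFinset).erase s).erase d := by simp
      -- After any other reply Staller takes `q₁`, a double threat at `{p, s, q₁}` and `{s, q₁,
      -- q₂}`.
      have hcases : d = p ∨ d = q₁ ∨ d = q₂ := by
        by_contra hcon
        push Not at hcon
        refine hd'.no_double_threat (e₁ := {p, s, q₁}) (e₂ := {s, q₁, q₂}) ?_ ?_ (x := q₁) ?_ p ?_ ?_
          q₂ ?_
        · refine ⟨Or.inr (mem_triples_iff.2 ⟨P₁, q₂ :: Q₀, p, s, q₁, hbY', rfl⟩), ?_⟩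
          simp; tauto
        · refine ⟨Or.inr (mem_triples_iff.2 ⟨P₁ ++ [p], Q₀, s, q₁, q₂, by simp [hbY'], rfl⟩), ?_⟩
          simp; tauto
        · simp only [Finset.mem_erase]
          refine ⟨fun h => hcon.2.1 h.symm, fun h => hnd3.2.1.2.1.1 h.symm, by simp [hYQ]⟩
        · simp
        · left
          simp
          tauto
        · simp
      rcases hcases with rfl | rfl | rfl
      · exact onY d P₁ _ _ s _ _ hbY (Or.inr ⟨rfl, rfl⟩) hd2 hd' (hpre _ _ _ hbY) (Or.inl hsn)
          hd.1.symm (hWsub _ _)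
      · have hbY2 : b :: (Y ++ [z]) = (P₁ ++ [p, s]) ++ d :: q₂ :: (Q₀ ++ [z]) := by simp [hbY]
        refine onY d _ _ _ s _ _ hbY2 (Or.inl ⟨rfl, ?_⟩) hd2 hd' (hpre _ _ _ hbY2) (Or.inl hsn)
          hd.1.symm (hWsub _ _)
        simp only [List.mem_cons, not_or]; tauto
      · have hbY2 : b :: (Y ++ [z]) = (P₁ ++ [p, s, q₁]) ++ d :: (Q₀ ++ [z]) := by simp [hbY]
        refine onY d _ _ _ s _ _ hbY2 (Or.inl ⟨rfl, ?_⟩) hd2 hd' (hpre _ _ _ hbY2) (Or.inl hsn)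
          hd.1.symm (hWsub _ _)
        tauto

theorem tail_append {b : V} {U : Finset V} {C : Set (Finset V)} : ∀ {W Y : List V},
    (b :: (Y ++ W)).Nodup → 3 ≤ Y.length → (∀ y ∈ Y ++ W, y ∉ U) → Attached C b (Y ++ W) →
    DW (U ∪ Y.toFinset) (C ∪ triples (b :: Y)) →
    DW (U ∪ (Y ++ W).toFinset) (C ∪ triples (b :: (Y ++ W)))
  | [], Y, _, _, _, _, h => by simpa using h
  | w :: W, Y, hnd, hlen, hU, hC, h => by
    have e : Y ++ w :: W = (Y ++ [w]) ++ W := by simp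
    rw [e] at hnd hU hC ⊢
    refine tail_append hnd (by simp; omega) hU hC ?_
    refine tail_snoc ?_ hlen _ U C rfl (fun y hy => hU y (by simp at hy ⊢; tauto)) ?_ h
    · rw [← List.cons_append] at hnd
      exact (List.nodup_append.1 hnd).1
    · intro e he y hy hye
      have := hC e he y (by simp at hy ⊢; tauto) hye
      refine ⟨this.1, ?_⟩
      rw [← this.2]
      cases Y <;> simp

/-- The length of a long path with a dominated end does not matter. -/
theorem tail_congr {b : V} {U : Finset V} {C : Set (Finset V)} {W W' Y : List V}
    (hnd : (b :: (Y ++ W)).Nodup) (hnd' : (b :: (Y ++ W')).Nodup) (hlen : 3 ≤ Y.length)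
    (hU' : ∀ y ∈ Y ++ W', y ∉ U)
    (hC : Attached C b (Y ++ W)) (hC' : Attached C b (Y ++ W'))
    (h : DW (U ∪ (Y ++ W).toFinset) (C ∪ triples (b :: (Y ++ W)))) :
    DW (U ∪ (Y ++ W').toFinset) (C ∪ triples (b :: (Y ++ W'))) := by
  -- Cutting back to `Y` costs nothing: its triples are among those of the longer path, and none of
  -- them, nor any edge of `C`, contains a vertex of `W`.
  refine tail_append hnd' hlen hU' hC' (h.mono fun e he => ⟨e, ?_, fun x hx => ?_⟩)
  · exact he.imp id fun h => triples_append_left (L := b :: Y) h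
  · rw [← List.cons_append] at hnd
    simp only [Finset.mem_inter, Finset.mem_union, List.mem_toFinset, List.mem_append] at hx ⊢
    refine ⟨hx.1, hx.2.imp id fun hxY => hxY.resolve_right fun hxW => ?_⟩
    rcases he with he | he
    · have := (hC e he x (by simp [hxW]) hx.1).2
      rcases Y with _ | ⟨y, Y⟩
      · simp at hlen
      · simp only [List.cons_append, List.head?_cons, Option.some.injEq] at this
        subst this
        exact (List.nodup_append.1 hnd).2.2 y (by simp) y hxW rfl
    · exact (List.nodup_append.1 hnd).2.2 x (subset_of_mem_triples he x hx.1) x hxW rfl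

/-- The old end `c` is not free and never hits anything, so any vertex may stand in its place. -/
theorem leaf_end_congr {b c c' : V} {U : Finset V} {C : Set (Finset V)} {Y : List V} (hc : c ∉ U)
    (h : DW U (C ∪ triples (b :: Y ++ [c]))) : DW U (C ∪ triples (b :: Y ++ [c'])) := by
  refine h.mono fun e he => ?_
  rcases he with he | he
  · exact ⟨e, Or.inl he, subset_rfl⟩
  · obtain ⟨P, Q, x, y, z, hP, rfl⟩ := mem_triples_iff.1 he
    rcases List.eq_nil_or_concat Q with rfl | ⟨Q, q, rfl⟩
    · have h2 : b :: Y ++ [c'] = (P ++ [x, y]) ++ [z] := by rw [hP]; simp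
      have h3 := (List.append_inj' h2 rfl).1
      have h4 : c' = z := by simpa using (List.append_inj' h2 rfl).2
      refine ⟨{x, y, c}, Or.inr (mem_triples_iff.2 ⟨P, [], x, y, c, by rw [h3]; simp, rfl⟩), ?_⟩
      intro w hw
      simp only [Finset.mem_inter, Finset.mem_insert, Finset.mem_singleton] at hw ⊢
      refine ⟨?_, hw.2⟩
      rcases hw.1 with h | h | h
      · tauto
      · tauto
      · exact absurd (h ▸ hw.2) hc
    · have h2 : b :: Y ++ [c'] = (P ++ x :: y :: z :: Q) ++ [q] := by rw [hP]; simp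
      have h3 := (List.append_inj' h2 rfl).1
      exact ⟨_, Or.inr (mem_triples_iff.2 ⟨P, Q ++ [c], x, y, z, by rw [h3]; simp, rfl⟩), subset_rfl⟩

/-- As `c` is lost to Dominator, `u` is in effect a leaf with neighbour `w`. If Staller takes `w`,
Dominator has to take `u`, and the path then ends at the lost vertex `w`. Conversely, `w` and `u`
form a pair. -/
theorem leaf_trim {b c u w : V} {U : Finset V} {C : Set (Finset V)} {Y : List V}
    (hnd : (b :: (Y ++ [w, u, c])).Nodup) (hU : ∀ y ∈ Y ++ [w, u, c], y ∉ U)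
    (hC : ∀ e ∈ C, u ∉ e) :
    DW (U ∪ (Y ++ [w, u]).toFinset) (C ∪ triples (b :: (Y ++ [w, u]) ++ [c])) ↔
      DW (U ∪ Y.toFinset) (C ∪ triples (b :: Y ++ [w])) := by
  have e1 : b :: (Y ++ [w, u]) ++ [c] = (b :: Y ++ [w]) ++ u :: [c] := by simp
  have e2 : b :: (Y ++ [w, u]) ++ [c] = (b :: Y) ++ w :: [u, c] := by simp
  have hnd' := hnd
  simp only [List.nodup_cons, List.nodup_append, List.mem_append, List.mem_cons, not_or] at hnd'
  simp only [List.mem_append, List.mem_cons] at hU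
  have a1 : avoid (triples (b :: (Y ++ [w, u]) ++ [c])) u = triples (b :: Y ++ [w]) := by
    rw [e1, avoid_triples]
    · simp [triples]
    · simp
      grind
    · simp
      grind
  have a2 : avoid (triples (b :: (Y ++ [w, u]) ++ [c])) w = triples (b :: Y) := by
    rw [e2, avoid_triples]
    · simp [triples]
    · simp
      grind
    · simp
      grind
  constructor
  · intro h
    have h1 := h.force (e := {w, u, c}) (s := w) (d := u) ?_ (by simp) ?_
    · refine h1.mono fun e he => ⟨e, ?_, ?_⟩
      · rw [avoid_union, a1]
        exact he.imp (fun h => ⟨h, hC e h⟩) id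
      · intro x hx
        simp at hx ⊢
        tauto
    · refine Or.inr (mem_triples_iff.2 ?_)
      rcases List.eq_nil_or_concat Y with rfl | ⟨Y, y, rfl⟩
      · exact ⟨[b], [], w, u, c, by simp, rfl⟩
      · exact ⟨b :: Y ++ [y], [], w, u, c, by simp, rfl⟩
    · intro x hx hxU
      simp at hx hxU
      rcases hx with h | h | rfl
      · tauto
      · tauto
      · grind
  · intro h
    refine h.pair (a := w) (b := u) (by grind) ?_ ?_ (by simp) (by simp) ?_
    · simp
      grind
    · simp
      grind
    · intro e he
      rcases he with he | he
      · refine Or.inl ⟨e, Or.inl he, fun x hx => ?_⟩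
        simp at hx ⊢
        tauto
      · by_cases hw : w ∈ e
        · by_cases hu : u ∈ e
          · exact Or.inr ⟨hw, hu⟩
          · refine Or.inl ⟨e, Or.inr (a1 ▸ ⟨he, hu⟩), fun x hx => ?_⟩
            simp at hx ⊢
            tauto
        · refine Or.inl ⟨e, Or.inr ?_, fun x hx => ?_⟩
          · have : e ∈ triples (b :: Y) := a2 ▸ ⟨he, hw⟩
            exact triples_append_left this
          · simp at hx ⊢
            tauto

theorem leaf_drop {b : V} {U : Finset V} {C : Set (Finset V)} {Y : List V} (n : ℕ) :
    ∀ {W : List V} {c : V}, W.length = 2 * n → (b :: (Y ++ W ++ [c])).Nodup →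
      (∀ y ∈ Y ++ W ++ [c], y ∉ U) → (∀ e ∈ C, ∀ w ∈ W, w ∉ e) →
      (DW (U ∪ (Y ++ W).toFinset) (C ∪ triples (b :: (Y ++ W) ++ [c])) ↔
        DW (U ∪ Y.toFinset) (C ∪ triples (b :: Y ++ [c]))) := by
  induction n with
  | zero =>
    intro W c hW _ _ _
    obtain rfl : W = [] := by simpa using hW
    simp
  | succ n ih =>
    intro W c hW hnd hU hC
    obtain ⟨W, w, u, rfl⟩ : ∃ W' w u, W = W' ++ [w, u] := by
      rcases List.eq_nil_or_concat W with rfl | ⟨W', u, rfl⟩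
      · simp at hW
      rcases List.eq_nil_or_concat W' with rfl | ⟨W', w, rfl⟩
      · simp at hW; omega
      · exact ⟨W', w, u, by simp⟩
    have hn : W.length = 2 * n := by simp at hW; omega
    have e3 : Y ++ (W ++ [w, u]) = (Y ++ W) ++ [w, u] := by simp
    have e4 : Y ++ (W ++ [w, u]) ++ [c] = (Y ++ W) ++ [w, u, c] := by simp
    rw [e4] at hnd hU
    rw [e3, leaf_trim hnd hU fun e he => hC e he u (by simp), ih hn ?_ ?_ ?_]
    · constructor
      · exact leaf_end_congr (by have := hU w (by simp); simp; simp [List.nodup_append] at hnd; grind)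
      · exact leaf_end_congr (by have := hU c (by simp); simp; simp [List.nodup_append] at hnd; grind)
    · refine hnd.sublist ?_
      simp
    · exact fun y hy => hU y (by simp at hy ⊢; tauto)
    · exact fun e he x hx => hC e he x (by simp [hx])

/-- Only the parity of the length of a path with a free end matters. -/
theorem leaf_congr {b c c' : V} {U : Finset V} {C : Set (Finset V)} {W W' Y : List V}
    (hY : 2 ≤ Y.length) (hpar : W.length % 2 = W'.length % 2)
    (hnd : (b :: (Y ++ W ++ [c])).Nodup) (hnd' : (b :: (Y ++ W' ++ [c'])).Nodup)
    (hU : ∀ y ∈ Y ++ W ++ [c], y ∉ U) (hU' : ∀ y ∈ Y ++ W' ++ [c'], y ∉ U)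
    (hC : Attached C b (Y ++ W)) (hC' : Attached C b (Y ++ W'))
    (h : DW (U ∪ (Y ++ W).toFinset) (C ∪ triples (b :: (Y ++ W) ++ [c]))) :
    DW (U ∪ (Y ++ W').toFinset) (C ∪ triples (b :: (Y ++ W') ++ [c'])) := by
  have key : ∀ {Y W W' : List V}, Y ≠ [] → W.length % 2 = 0 → W'.length % 2 = 0 →
      (b :: (Y ++ W ++ [c])).Nodup → (b :: (Y ++ W' ++ [c'])).Nodup →
      (∀ y ∈ Y ++ W ++ [c], y ∉ U) → (∀ y ∈ Y ++ W' ++ [c'], y ∉ U) →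
      Attached C b (Y ++ W) → Attached C b (Y ++ W') →
      DW (U ∪ (Y ++ W).toFinset) (C ∪ triples (b :: (Y ++ W) ++ [c])) →
      DW (U ∪ (Y ++ W').toFinset) (C ∪ triples (b :: (Y ++ W') ++ [c'])) := by
    intro Y W W' hY hW hW' hnd hnd' hU hU' hC hC' h
    have hav : ∀ {W : List V}, (b :: (Y ++ W)).Nodup → Attached C b (Y ++ W) →
        ∀ e ∈ C, ∀ w ∈ W, w ∉ e := by
      intro W hnd hC e he w hw hwe
      have := (hC e he w (by simp [hw]) hwe).2
      rcases Y with _ | ⟨y, Y⟩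
      · exact hY rfl
      · simp only [List.cons_append, List.head?_cons, Option.some.injEq] at this
        subst this
        simp [hw] at hnd
    have e1 : ∀ {W : List V} {c : V}, (b :: (Y ++ W ++ [c])).Nodup → (b :: (Y ++ W)).Nodup :=
      fun h => h.sublist (by simp)
    rw [leaf_drop (W.length / 2) (by omega) hnd hU (hav (e1 hnd) hC)] at h
    rw [leaf_drop (W'.length / 2) (by omega) hnd' hU' (hav (e1 hnd') hC')]
    refine leaf_end_congr ?_ h
    simp only [Finset.mem_union, List.mem_toFinset, not_or]
    refine ⟨hU c (by simp), fun hc => ?_⟩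
    simp [List.nodup_append] at hnd
    grind
  rcases Nat.mod_two_eq_zero_or_one W.length with hW | hW
  · exact key (by rintro rfl; simp at hY) hW (by omega) hnd hnd' hU hU' hC hC' h
  -- For odd lengths the last vertex of `Y` moves into the variable parts, which makes them even.
  -- One vertex of `Y` has to remain, hence the bound `2`.
  · obtain ⟨Y, y, rfl⟩ : ∃ Y' y, Y = Y' ++ [y] := by
      rcases List.eq_nil_or_concat Y with rfl | ⟨Y', y, rfl⟩
      · simp at hY
      · exact ⟨Y', y, by simp⟩
    simp only [List.append_assoc, List.singleton_append] at *
    exact key (Y := Y) (W := y :: W) (W' := y :: W') (by rintro rfl; simp at hY)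
      (by simp; omega) (by simp; omega) (by simpa using hnd) (by simpa using hnd')
      (by simpa using hU) (by simpa using hU') hC hC' h

end Paths


/-! ### Exchanging the two arms of a path that has been cut -/

section Paths

variable {V : Type*} [DecidableEq V]

/-- The path `P` attached to `a`, continued by the entries of `lc`, may be replaced by `P'`,
continued by `lc'`, without harm for Dominator. -/
def Repl (a : V) (P lc P' lc' : List V) : Prop :=
  ∀ (U : Finset V) (C : Set (Finset V)), (∀ y ∈ P ++ lc, y ∉ U) → (∀ y ∈ P' ++ lc', y ∉ U) →
    Attached C a P → Attached C a P' → DW (U ∪ P.toFinset) (C ∪ triples (a :: P ++ lc)) →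
    DW (U ∪ P'.toFinset) (C ∪ triples (a :: P' ++ lc'))

theorem Repl.refl (a : V) (P lc : List V) : Repl a P lc P lc := fun _ _ _ _ _ _ h => h

/-- Nothing follows the arm: it ends next to a vertex of Dominator, and its length is immaterial. -/
theorem Repl.tail {a : V} {Y W W' : List V} (hY : 3 ≤ Y.length) (hnd : (a :: (Y ++ W)).Nodup)
    (hnd' : (a :: (Y ++ W')).Nodup) : Repl a (Y ++ W) [] (Y ++ W') [] := by
  intro U C hU hU' hC hC' h
  simp only [List.append_nil] at *
  exact tail_congr hnd hnd' hY hU' hC hC' h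

/-- The arm is followed by a vertex of Staller, so the parity of its length has to be kept. -/
theorem Repl.leaf {a c c' : V} {Y W W' : List V} (hY : 2 ≤ Y.length)
    (hpar : W.length % 2 = W'.length % 2) (hnd : (a :: (Y ++ W ++ [c])).Nodup)
    (hnd' : (a :: (Y ++ W' ++ [c'])).Nodup) : Repl a (Y ++ W) [c] (Y ++ W') [c'] := by
  intro U C hU hU' hC hC' h
  exact leaf_congr hY hpar hnd hnd' hU hU' hC hC' h

theorem Attached.union_triples {C : Set (Finset V)} {b : V} {Q L : List V} (h : Attached C b Q)
    (hL : ∀ y ∈ Q, y ∉ L) : Attached (C ∪ triples L) b Q := by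
  rintro e (he | he) y hy hye
  · exact h e he y hy hye
  · exact absurd (subset_of_mem_triples he y hye) (hL y hy)

/-- The arms are exchanged one after the other, while the other arm counts as part of the fixed
edges. In between, the old left arm stands next to the new right arm, which explains the mixed
disjointness hypotheses. -/
theorem Repl.both {U W W' : Finset V} {C K H' : Set (Finset V)} {a b : V}
    {P lc Q rc P' lc' Q' rc' : List V} (hl : Repl a P lc P' lc') (hr : Repl b Q rc Q' rc')
    (h : DW W K)
    (h1 : ∀ y ∈ P ++ lc, y ∉ U ∧ y ∉ b :: Q' ++ rc') (h1' : ∀ y ∈ P' ++ lc', y ∉ U ∧ y ∉ b :: Q' ++ rc')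
    (h2 : ∀ y ∈ Q ++ rc, y ∉ U ∧ y ∉ a :: P ++ lc) (h2' : ∀ y ∈ Q' ++ rc', y ∉ U ∧ y ∉ a :: P ++ lc)
    (hC1 : Attached C a P) (hC1' : Attached C a P') (hC2 : Attached C b Q) (hC2' : Attached C b Q')
    (hW : ∀ e ∈ C ∪ triples (a :: P ++ lc) ∪ triples (b :: Q ++ rc), ∀ x ∈ e, x ∈ W →
      x ∈ U ∪ P.toFinset ∪ Q.toFinset)
    (hK : C ∪ triples (a :: P ++ lc) ∪ triples (b :: Q ++ rc) ⊆ K)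
    (hW' : U ∪ P'.toFinset ∪ Q'.toFinset ⊆ W')
    (hH' : H' ⊆ C ∪ triples (a :: P' ++ lc') ∪ triples (b :: Q' ++ rc')) : DW W' H' := by
  have s1 : DW (U ∪ P.toFinset ∪ Q.toFinset)
      (C ∪ triples (a :: P ++ lc) ∪ triples (b :: Q ++ rc)) :=
    h.mono fun e he => ⟨e, hK he, fun x hx => Finset.mem_inter.2 ⟨(Finset.mem_inter.1 hx).1,
      hW e he x (Finset.mem_inter.1 hx).1 (Finset.mem_inter.1 hx).2⟩⟩
  have s2 := hr _ _ (fun y hy => ?_) (fun y hy => ?_) (hC2.union_triples fun y hy => ?_)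
    (hC2'.union_triples fun y hy => ?_) s1
  rotate_left
  · have := h2 y hy
    simp at this ⊢; tauto
  · have := h2' y hy
    simp at this ⊢; tauto
  · exact (h2 y (by simp [hy])).2
  · exact (h2' y (by simp [hy])).2
  rw [Finset.union_right_comm, Set.union_right_comm] at s2
  have s3 := hl _ _ (fun y hy => ?_) (fun y hy => ?_) (hC1.union_triples fun y hy => ?_)
    (hC1'.union_triples fun y hy => ?_) s2
  rotate_left
  · have := h1 y hy
    simp at this ⊢; tauto
  · have := h1' y hy
    simp at this ⊢; tauto
  · exact (h1 y (by simp [hy])).2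
  · exact (h1' y (by simp [hy])).2
  rw [Finset.union_right_comm, Set.union_right_comm] at s3
  exact s3.mono_of_subset hW' fun e he => ⟨e, hH' he, Finset.inter_subset_left⟩

/-- Two long paths `A ++ M ++ B` and `A ++ M' ++ B` between `a` and `b`, where the edges `C` meet
the paths only at their ends. -/
structure LongPaths (U : Finset V) (C : Set (Finset V)) (a : V) (A M M' B : List V) (b : V) :
    Prop where
  nodup : (a :: (A ++ M ++ M' ++ B) ++ [b]).Nodup
  le_left : 6 ≤ A.length
  le_right : 6 ≤ B.length
  parity : M.length % 2 = M'.length % 2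
  disj : ∀ x ∈ A ++ M ++ M' ++ B, x ∉ U
  attached : ∀ e ∈ C, ∀ x ∈ A ++ M ++ M' ++ B, x ∈ e →
    (A.head? = some x ∧ a ∈ e) ∨ (B.getLast? = some x ∧ b ∈ e)

/-- Through this symmetry every argument at the end `a` also applies at `b`. -/
theorem LongPaths.reverse {U : Finset V} {C : Set (Finset V)} {a b : V} {A M M' B : List V}
    (h : LongPaths U C a A M M' B b) :
    LongPaths U C b B.reverse M.reverse M'.reverse A.reverse a where
  nodup := by
    have := List.nodup_reverse.2 h.nodup
    refine (List.Perm.nodup_iff ?_).1 this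
    simp only [List.reverse_append, List.reverse_cons, List.cons_append, List.nil_append,
      List.append_assoc, List.reverse_nil]
    refine List.Perm.cons _ (List.Perm.append_left _ ?_)
    simp only [← List.append_assoc]
    exact List.Perm.append_right _ (List.Perm.append_right _ List.perm_append_comm)
  le_left := by simpa using h.le_right
  le_right := by simpa using h.le_left
  parity := by simpa using h.parity
  disj := fun x hx => h.disj x (by simp at hx ⊢; tauto)
  attached := fun e he x hx hxe => by
    have := h.attached e he x (by simp at hx ⊢; tauto) hxe
    simpa [or_comm] using this

/-- The edges of a path between `a` and `b`. -/
def pathEdges (a : V) (X : List V) (b : V) : Set (Finset V) := triples (a :: X ++ [b])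

theorem pathEdges_reverse (a : V) (X : List V) (b : V) :
    pathEdges b X.reverse a = pathEdges a X b := by
  unfold pathEdges
  rw [← triples_reverse (a :: X ++ [b])]
  simp

theorem avoid_pathEdges {a b d : V} {P Q : List V} (h : (a :: (P ++ d :: Q) ++ [b]).Nodup) :
    avoid (pathEdges a (P ++ d :: Q) b) d = triples (a :: P) ∪ triples (b :: Q.reverse) := by
  have e : a :: (P ++ d :: Q) ++ [b] = (a :: P) ++ d :: (Q ++ [b]) := by simp
  unfold pathEdges
  rw [e] at h ⊢
  rw [avoid_triples]
  · rw [← triples_reverse (Q ++ [b])]; simp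
  · exact fun h' => (List.nodup_append.1 h).2.2 d h' d (by simp) rfl
  · exact (List.nodup_cons.1 (List.nodup_append.1 h).2.1).1

section
variable {U : Finset V} {C : Set (Finset V)} {a b : V} {A M M' B : List V}

theorem LongPaths.nodup_left (h : LongPaths U C a A M M' B b) :
    (a :: (A ++ M ++ B) ++ [b]).Nodup := h.nodup.sublist (by simp)

theorem LongPaths.nodup_right (h : LongPaths U C a A M M' B b) :
    (a :: (A ++ M' ++ B) ++ [b]).Nodup := h.nodup.sublist (by simp)

theorem attached_left {X P R : List V} (hnd : X.Nodup) (hX : X = P ++ R) (hR : R ≠ [])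
    (h : ∀ e ∈ C, ∀ x ∈ X, x ∈ e → (X.head? = some x ∧ a ∈ e) ∨ (X.getLast? = some x ∧ b ∈ e)) :
    Attached C a P := by
  subst hX
  intro e he y hy hye
  rcases h e he y (by simp [hy]) hye with ⟨h1, h2⟩ | ⟨h1, -⟩
  · refine ⟨h2, ?_⟩
    rcases P with _ | ⟨p, P⟩
    · simp at hy
    · simpa using h1
  · rw [List.getLast?_append_of_ne_nil _ hR] at h1
    exact absurd rfl ((List.nodup_append.1 hnd).2.2 y hy y (List.mem_of_getLast? h1))

theorem attached_right {X P R : List V} (hnd : X.Nodup) (hX : X = P ++ R) (hP : P ≠ [])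
    (h : ∀ e ∈ C, ∀ x ∈ X, x ∈ e → (X.head? = some x ∧ a ∈ e) ∨ (X.getLast? = some x ∧ b ∈ e)) :
    Attached C b R.reverse := by
  refine attached_left (X := X.reverse) (R := P.reverse) (b := a) (List.nodup_reverse.2 hnd)
    (by simp [hX]) (by simpa using hP) fun e he x hx hxe => ?_
  have := h e he x (by simpa using hx) hxe
  simpa [or_comm] using this

theorem LongPaths.attached_path (h : LongPaths U C a A M M' B b) {N : List V}
    (hN : ∀ x ∈ N, x ∈ M ∨ x ∈ M') : ∀ e ∈ C, ∀ x ∈ A ++ N ++ B, x ∈ e →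
      ((A ++ N ++ B).head? = some x ∧ a ∈ e) ∨ ((A ++ N ++ B).getLast? = some x ∧ b ∈ e) := by
  intro e he x hx hxe
  have := h.attached e he x (by simp at hx ⊢; grind) hxe
  have hA := h.le_left
  have hB := h.le_right
  rw [List.getLast?_append_of_ne_nil _ (by rintro rfl; simp at hB), List.append_assoc,
    List.head?_append_of_ne_nil _ (by rintro rfl; simp at hA)]
  exact this

set_option maxHeartbeats 1000000 in
/-- Dominator takes `d`, and `d'` on the other path. -/
theorem LongPaths.reply (h : LongPaths U C a A M M' B b) {s s' d d' : V}
    {P lc ex rc Q P' lc' rc' Q' : List V}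
    (hX : A ++ M ++ B = P ++ (lc ++ ex) ++ d :: (rc ++ Q))
    (hX' : A ++ M' ++ B = P' ++ lc' ++ d' :: (rc' ++ Q')) (hl : Repl a P lc P' lc')
    (hr : Repl b Q.reverse rc.reverse Q'.reverse rc'.reverse) (hC : avoid C d = avoid C d')
    (hex : ∀ e ∈ C, ∀ x ∈ ex, x ∉ e)
    (hs : ∀ x ∈ lc ++ rc, x = s) (hs' : s' ∈ lc' ++ rc' ∨ s' ∈ U ∧ s' = s)
    (hcross : ∀ y ∈ P ++ lc, y ∉ rc' ++ Q')
    (hDW : DW (((U ∪ (A ++ M ++ B).toFinset).erase s).erase d)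
      (avoid (C ∪ pathEdges a (A ++ M ++ B) b) d)) :
    DW (((U ∪ (A ++ M' ++ B).toFinset).erase s').erase d')
      (avoid (C ∪ pathEdges a (A ++ M' ++ B) b) d') := by
  have hnd := h.nodup_left
  have hnd' := h.nodup_right
  have hU : ∀ x ∈ A ++ M ++ B, x ∉ U := fun x hx => h.disj x (by simp at hx ⊢; tauto)
  have hU' : ∀ x ∈ A ++ M' ++ B, x ∉ U := fun x hx => h.disj x (by simp at hx ⊢; tauto)
  have hatt := h.attached_path (N := M) (fun x hx => Or.inl hx)
  have hatt' := h.attached_path (N := M') (fun x hx => Or.inr hx)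
  rw [hX] at hnd hU hatt hDW
  rw [hX'] at hnd' hU' hatt' ⊢
  have hndX : (P ++ (lc ++ ex) ++ d :: (rc ++ Q)).Nodup := hnd.sublist (by simp)
  have hndX' : (P' ++ lc' ++ d' :: (rc' ++ Q')).Nodup := hnd'.sublist (by simp)
  rw [avoid_union, avoid_pathEdges hnd] at hDW
  rw [avoid_union, avoid_pathEdges hnd', ← hC]
  have ha : ∀ x ∈ P ++ (lc ++ ex) ++ d :: (rc ++ Q), x ≠ a ∧ x ≠ b := by
    rintro x hx; constructor
    · rintro rfl; simp at hnd hx; grind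
    · rintro rfl; simp [List.nodup_append] at hnd hx; grind
  have ha' : ∀ x ∈ P' ++ lc' ++ d' :: (rc' ++ Q'), x ≠ a ∧ x ≠ b := by
    rintro x hx; constructor
    · rintro rfl; simp at hnd' hx; grind
    · rintro rfl; simp [List.nodup_append] at hnd' hx; grind
  -- `P` and `Q` are the two arms. A vertex in `lc` or `rc` is held by Staller and ends its arm; an
  -- empty list means a dominated end. The vertices `ex` lie in none of the edges that are kept, so
  -- they may be dropped.
  refine Repl.both (U := U.erase s) (C := MBDom.avoid C d) hl hr hDW ?_ ?_ ?_ ?_ ?_ ?_ ?_ ?_ ?_ ?_ ?_ ?_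
  · intro y hy
    have h1 := ha y (by simp at hy ⊢; tauto)
    have h2 := hcross y hy
    have h3 := hU y (by simp at hy ⊢; tauto)
    simp at h2 ⊢; tauto
  · intro y hy
    have h1 := ha' y (by simp at hy ⊢; tauto)
    have h3 := hU' y (by simp at hy ⊢; tauto)
    have h4 := (List.nodup_append.1 hndX').2.2 y hy
    simp at h4 ⊢; grind
  · intro y hy
    have h1 := ha y (by simp at hy ⊢; tauto)
    have h3 := hU y (by simp at hy ⊢; tauto)
    have h4 : y ∉ P ++ lc := fun h' => (List.nodup_append.1 hndX).2.2 y (by simp at h' ⊢; tauto) y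
      (by simp at hy ⊢; tauto) rfl
    simp at h4 ⊢; tauto
  · intro y hy
    have h1 := ha' y (by simp at hy ⊢; tauto)
    have h3 := hU' y (by simp at hy ⊢; tauto)
    have h4 : y ∉ P ++ lc := fun h' => hcross y h' (by simp at hy ⊢; tauto)
    simp at h4 ⊢; tauto
  · exact (attached_left hndX (R := lc ++ ex ++ d :: (rc ++ Q)) (by simp) (by simp) hatt).avoid d
  · exact (attached_left hndX' (R := lc' ++ d' :: (rc' ++ Q')) (by simp) (by simp) hatt').avoid d
  · exact (attached_right hndX (P := P ++ (lc ++ ex) ++ d :: rc) (by simp) (by simp) hatt).avoid d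
  · exact (attached_right hndX' (P := P' ++ lc' ++ d' :: rc') (by simp) (by simp) hatt').avoid d
  · intro e he x hxe hx
    have hxe : x ∉ ex := by
      intro hx'
      rcases he with (he | he) | he
      · exact hex e he.1 x hx' hxe
      · have h1 := subset_of_mem_triples he x hxe
        have h2 := ha x (by simp [hx'])
        simp [List.nodup_append] at hndX h1
        grind
      · have h1 := subset_of_mem_triples he x hxe
        have h2 := ha x (by simp [hx'])
        simp [List.nodup_append] at hndX h1
        grind
    simp only [Finset.mem_erase, Finset.mem_union, List.mem_toFinset, List.mem_append,
      List.mem_cons, List.mem_reverse] at hx hs ⊢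
    grind
  · simp only [List.reverse_append, List.cons_append, Set.union_assoc]
    refine Set.union_subset_union_right _ (Set.union_subset_union_left _ ?_)
    rw [← List.append_assoc, ← List.cons_append]
    exact triples_append_left
  · intro x hx
    have h5 : s' ∉ P' ∧ s' ∉ Q' ∧ (s' ∈ U → s' = s) := by
      rcases hs' with hs' | ⟨hs1, hs2⟩
      · have h6 := hU' s' (by simp at hs' ⊢; tauto)
        refine ⟨fun h7 => ?_, fun h7 => ?_, fun h7 => absurd h7 h6⟩
        · simp [List.nodup_append] at hndX' hs'
          grind
        · simp [List.nodup_append] at hndX' hs'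
          grind
      · refine ⟨fun h7 => hU' s' (by simp [h7]) hs1, fun h7 => hU' s' (by simp [h7]) hs1, fun _ => hs2⟩
    have h6 : d' ∉ P' ∧ d' ∉ Q' ∧ d' ∉ U := by
      refine ⟨fun h7 => ?_, fun h7 => ?_, hU' _ (by simp)⟩
      · simp [List.nodup_append] at hndX'
        grind
      · simp [List.nodup_append] at hndX'
        grind
    simp only [Finset.mem_erase, Finset.mem_union, List.mem_toFinset, List.mem_append,
      List.mem_cons, List.mem_reverse] at hx ⊢
    grind
  · simp only [List.reverse_append, List.cons_append, Set.union_assoc]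
    exact subset_rfl

theorem avoid_pathEdges_end {X : List V} (h : (a :: X ++ [b]).Nodup) :
    avoid (pathEdges a X b) a = triples (b :: X.reverse) := by
  unfold pathEdges
  rw [List.cons_append] at h ⊢
  rw [← List.nil_append (a :: (X ++ [b])), avoid_triples (by simp) (List.nodup_cons.1 h).1,
    ← triples_reverse (X ++ [b])]
  simp [triples]

/-- Dominator takes the end `a` of the path. -/
theorem LongPaths.reply_end (h : LongPaths U C a A M M' B b) {s s' : V} {rc rc' Q Q' : List V}
    (hX : A ++ M ++ B = rc ++ Q) (hX' : A ++ M' ++ B = rc' ++ Q')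
    (hr : Repl b Q.reverse rc.reverse Q'.reverse rc'.reverse)
    (hs : ∀ x ∈ rc, x = s) (hs' : s' ∈ rc' ∨ s' ∈ U ∧ s' = s)
    (hDW : DW (((U ∪ (A ++ M ++ B).toFinset).erase s).erase a)
      (avoid (C ∪ pathEdges a (A ++ M ++ B) b) a)) :
    DW (((U ∪ (A ++ M' ++ B).toFinset).erase s').erase a)
      (avoid (C ∪ pathEdges a (A ++ M' ++ B) b) a) := by
  have hnd := h.nodup_left
  have hnd' := h.nodup_right
  have hU : ∀ x ∈ A ++ M ++ B, x ∉ U := fun x hx => h.disj x (by simp at hx ⊢; tauto)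
  have hU' : ∀ x ∈ A ++ M' ++ B, x ∉ U := fun x hx => h.disj x (by simp at hx ⊢; tauto)
  have hatt := h.attached_path (N := M) (fun x hx => Or.inl hx)
  have hatt' := h.attached_path (N := M') (fun x hx => Or.inr hx)
  rw [hX] at hnd hU hatt hDW
  rw [hX'] at hnd' hU' hatt' ⊢
  have hndX : (rc ++ Q).Nodup := hnd.sublist (by simp)
  have hndX' : (rc' ++ Q').Nodup := hnd'.sublist (by simp)
  have hb : ∀ {X Q rc : List V}, X.Nodup → X = rc ++ Q → (∀ e ∈ C, ∀ x ∈ X, x ∈ e →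
      (X.head? = some x ∧ a ∈ e) ∨ (X.getLast? = some x ∧ b ∈ e)) →
      Attached (MBDom.avoid C a) b Q.reverse := by
    intro X Q rc hnd hX hatt e he y hy hye
    rcases hatt e he.1 y (by rw [hX]; simp at hy ⊢; tauto) hye with h1 | h1
    · exact absurd h1.2 he.2
    · refine ⟨h1.2, ?_⟩
      rw [hX, List.getLast?_append_of_ne_nil _ (by rintro rfl; simp at hy)] at h1
      simpa using h1.1
  rw [avoid_union, avoid_pathEdges_end hnd] at hDW
  rw [avoid_union, avoid_pathEdges_end hnd']
  have ha : ∀ x ∈ rc ++ Q, x ≠ a ∧ x ≠ b := by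
    rintro x hx; constructor
    · rintro rfl; simp at hnd hx; grind
    · rintro rfl; simp [List.nodup_append] at hnd hx; grind
  have ha' : ∀ x ∈ rc' ++ Q', x ≠ a ∧ x ≠ b := by
    rintro x hx; constructor
    · rintro rfl; simp at hnd' hx; grind
    · rintro rfl; simp [List.nodup_append] at hnd' hx; grind
  -- Once `a` is claimed, the path hangs on `b` only; the arm at `a` is empty.
  refine Repl.both (U := (U.erase s).erase a) (C := MBDom.avoid C a) (Repl.refl a [] []) hr hDW
    (by simp) (by simp) ?_ ?_ ?_ ?_ (hb hndX rfl hatt) (hb hndX' rfl hatt') ?_ ?_ ?_ ?_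
  · intro y hy
    have h1 := ha y (by simp at hy ⊢; tauto)
    have h3 := hU y (by simp at hy ⊢; tauto)
    simp; tauto
  · intro y hy
    have h1 := ha' y (by simp at hy ⊢; tauto)
    have h3 := hU' y (by simp at hy ⊢; tauto)
    simp; tauto
  · intro e _ y hy; simp at hy
  · intro e _ y hy; simp at hy
  · intro e _ x _ hx
    simp only [Finset.mem_erase, Finset.mem_union, List.mem_toFinset, List.mem_append,
      List.mem_reverse] at hx hs ⊢
    grind
  · simp [triples]
  · intro x hx
    have h5 : s' ∉ Q' ∧ (s' ∈ U → s' = s) := by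
      rcases hs' with hs' | ⟨hs1, hs2⟩
      · refine ⟨fun h7 => (List.nodup_append.1 hndX').2.2 s' hs' s' h7 rfl,
          fun h7 => absurd h7 (hU' s' (by simp [hs']))⟩
      · exact ⟨fun h7 => hU' s' (by simp [h7]) hs1, fun _ => hs2⟩
    have h6 : a ∉ Q' := fun h7 => (ha' a (by simp [h7])).1 rfl
    simp only [Finset.mem_erase, Finset.mem_union, List.mem_toFinset, List.mem_append,
      List.mem_reverse] at hx ⊢
    grind
  · simp [triples]

end

end Paths


/-! ### Forced replies on a long path -/

section Paths

variable {V : Type*} [DecidableEq V]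
variable {U : Finset V} {C : Set (Finset V)} {a b : V} {A M M' B : List V}

/-- After any other reply Staller takes `q` and threatens both triples, of which one can then be
saved only at `p` and the other only at `r`. -/
theorem DW.reply_near {W : Finset V} {H : Set (Finset V)} {p s q r d : V}
    (h : DW ((W.erase s).erase d) (avoid H d)) (h1 : {p, s, q} ∈ H) (h2 : {s, q, r} ∈ H)
    (hq : q ∈ W) (hqs : q ≠ s) (hpq : p ≠ q) (hps : p ≠ s) (hpr : p ≠ r) (hds : d ≠ s) :
    d = p ∨ d = q ∨ d = r := by
  by_contra hcon
  push Not at hcon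
  refine h.no_double_threat (e₁ := {p, s, q}) (e₂ := {s, q, r}) ⟨h1, ?_⟩ ⟨h2, ?_⟩ (x := q) ?_ p ?_ ?_
    r ?_
  · simp; tauto
  · simp; tauto
  · simp only [Finset.mem_erase]
    exact ⟨fun h => hcon.2.1 h.symm, hqs, hq⟩
  · simp
  · left
    simp; tauto
  · simp

theorem LongPaths.avoid_eq (h : LongPaths U C a A M M' B b) {x : V} (hx : x ∈ A ++ M ++ M' ++ B)
    (h1 : A.head? ≠ some x) (h2 : B.getLast? ≠ some x) : avoid C x = C := by
  ext e
  refine ⟨fun he => he.1, fun he => ⟨he, fun hxe => ?_⟩⟩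
  have := h.attached e he x hx hxe
  tauto

theorem mem_pathEdges {X P Q : List V} {x y z : V} (h : a :: X ++ [b] = P ++ x :: y :: z :: Q) :
    {x, y, z} ∈ pathEdges a X b := mem_triples_iff.2 ⟨P, Q, x, y, z, h, rfl⟩

theorem LongPaths.exists_edge (h : LongPaths U C a A M M' B b) :
    ∃ e, e ∈ C ∪ pathEdges a (A ++ M ++ B) b := by
  have := h.le_left
  rcases A with _ | ⟨x, _ | ⟨y, A⟩⟩
  · simp at this
  · simp at this
  · exact ⟨{a, x, y}, Or.inr (mem_pathEdges (P := []) (Q := A ++ M ++ B ++ [b]) (by simp))⟩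

/-- Staller moves on the path, away from its ends. -/
theorem LongPaths.staller_inner (h : LongPaths U C a A M M' B b) {x s p p' q q' r : V}
    {P P' Q Q' : List V}
    (hX : A ++ M ++ B = P ++ p :: x :: q :: r :: Q)
    (hX' : A ++ M' ++ B = P' ++ p' :: s :: q' :: Q')
    (hlt : Repl a P [] P' []) (hll : Repl a (P ++ [p]) [x] (P' ++ [p']) [s])
    (hrt : Repl b (r :: Q).reverse [] Q'.reverse [])
    (hrl : Repl b (q :: r :: Q).reverse [x] (q' :: Q').reverse [s])
    (hp : avoid C p = avoid C p') (hq : avoid C q = avoid C q')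
    (hcross : ∀ y ∈ P, y ∉ s :: q' :: Q') (hcross' : ∀ y ∈ P ++ [p, x], y ∉ Q')
    (hDW : DW (U ∪ (A ++ M ++ B).toFinset) (C ∪ pathEdges a (A ++ M ++ B) b)) :
    ∃ d ∈ (U ∪ (A ++ M' ++ B).toFinset).erase s,
      DW (((U ∪ (A ++ M' ++ B).toFinset).erase s).erase d)
        (avoid (C ∪ pathEdges a (A ++ M' ++ B) b) d) := by
  obtain ⟨e, he⟩ := h.exists_edge
  obtain ⟨d, hd, hd'⟩ := hDW.reply he (s := x) (by rw [hX]; simp)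
  have hnd := h.nodup_left
  have hnd' := h.nodup_right
  rw [hX] at hnd
  rw [hX'] at hnd'
  obtain ⟨P₁, p₂, hP⟩ : ∃ P₁ p₂, a :: P = P₁ ++ [p₂] := by
    rcases List.eq_nil_or_concat (a :: P) with h | ⟨P₀, p, h⟩
    · simp at h
    · exact ⟨P₀, p, by simpa using h⟩
  have hX2 : a :: (A ++ M ++ B) ++ [b] = P₁ ++ p₂ :: p :: x :: (q :: r :: Q ++ [b]) := by
    rw [hX, List.cons_append, List.append_assoc, ← List.cons_append, hP]; simp
  have m1 : ({p₂, p, x} : Finset V) ∈ pathEdges a (A ++ M ++ B) b := mem_pathEdges hX2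
  have m2 : ({p, x, q} : Finset V) ∈ pathEdges a (A ++ M ++ B) b :=
    mem_pathEdges (P := P₁ ++ [p₂]) (Q := r :: Q ++ [b]) (by rw [hX2]; simp)
  have m3 : ({x, q, r} : Finset V) ∈ pathEdges a (A ++ M ++ B) b :=
    mem_pathEdges (P := P₁ ++ [p₂, p]) (Q := Q ++ [b]) (by rw [hX2]; simp)
  have hnd2 : [p₂, p, x, q, r].Nodup := by
    have : (a :: (A ++ M ++ B) ++ [b]).Nodup := by rw [hX]; exact hnd
    rw [hX2] at this
    exact this.sublist (List.sublist_append_of_sublist_right (by simp))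
  simp only [List.nodup_cons, List.mem_cons, List.not_mem_nil, or_false, not_or, not_false_eq_true,
    List.nodup_nil, and_true] at hnd2
  obtain ⟨⟨n1, n2, n3, n4⟩, ⟨n5, n6, n7⟩, ⟨n8, n9⟩, n10⟩ := hnd2
  -- The double threat to the right of `x` leaves `p`, `q`, `r`, the one to the left leaves `q`,
  -- `p`, `p₂`. Only the two neighbours of `x` survive both.
  have hc1 : d = p ∨ d = q ∨ d = r := hd'.reply_near (Or.inr m2) (Or.inr m3) (by rw [hX]; simp)
    (Ne.symm n8) n6 n5 n7 (Finset.ne_of_mem_erase hd)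
  have hc2 : d = q ∨ d = p ∨ d = p₂ := by
    refine hd'.reply_near (p := q) (s := x) (q := p) (r := p₂) (Or.inr ?_) (Or.inr ?_)
      (by rw [hX]; simp) n5 (Ne.symm n6) (Ne.symm n8) (Ne.symm n3) (Finset.ne_of_mem_erase hd)
    · convert m2 using 1
      ext; simp; tauto
    · convert m1 using 1
      ext; simp; tauto
  have hcase : d = p ∨ d = q := by
    rcases hc1 with h | h | h
    · exact Or.inl h
    · exact Or.inr h
    · rcases hc2 with h' | h' | h'
      · exact Or.inr h'
      · exact Or.inl h'
      · exact absurd (h'.symm.trans h) n4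
  have hps : p' ≠ s ∧ q' ≠ s := by
    have : [p', s, q'].Nodup := by
      refine hnd'.sublist ?_
      rw [List.cons_append, List.append_assoc]
      exact List.Sublist.cons _ (List.sublist_append_of_sublist_right (by simp))
    simp at this
    exact ⟨this.1.1, Ne.symm this.2⟩
  -- If she takes `p`, the left arm gets a dominated end, and Staller's vertex ends the right arm;
  -- the other case is the mirror image.
  rcases hcase with rfl | rfl
  · refine ⟨p', by rw [hX']; simp [hps.1], ?_⟩
    exact h.reply (s := x) (s' := s) (P := P) (lc := []) (ex := []) (rc := [x]) (Q := q :: r :: Q)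
      (P' := P') (lc' := []) (rc' := [s]) (Q' := q' :: Q') (by simp [hX]) (by simp [hX']) hlt hrl hp
      (by simp) (by simp) (by simp) (by simpa using hcross) hd'
  · refine ⟨q', by rw [hX']; simp [hps.2], ?_⟩
    exact h.reply (s := x) (s' := s) (P := P ++ [p]) (lc := [x]) (ex := []) (rc := []) (Q := r :: Q)
      (P' := P' ++ [p']) (lc' := [s]) (rc' := []) (Q' := Q') (by simp [hX]) (by simp [hX']) hll hrt
      hq (by simp) (by simp) (by simp) (by simpa using hcross') hd'

/-- Staller takes the first vertex of the path. -/
theorem LongPaths.staller_head (h : LongPaths U C a A M M' B b) {s q r : V} {A' : List V}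
    (hA : A = s :: q :: r :: A')
    (hDW : DW (U ∪ (A ++ M ++ B).toFinset) (C ∪ pathEdges a (A ++ M ++ B) b)) :
    ∃ d ∈ (U ∪ (A ++ M' ++ B).toFinset).erase s,
      DW (((U ∪ (A ++ M' ++ B).toFinset).erase s).erase d)
        (avoid (C ∪ pathEdges a (A ++ M' ++ B) b) d) := by
  obtain ⟨e, he⟩ := h.exists_edge
  obtain ⟨d, hd, hd'⟩ := hDW.reply he (s := s) (by rw [hA]; simp)
  have hnd := h.nodup
  have hlen := h.le_left
  have hlenB := h.le_right
  have hpar := h.parity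
  have hX2 : a :: (A ++ M ++ B) ++ [b] = a :: s :: q :: (r :: A' ++ M ++ B ++ [b]) := by
    rw [hA]; simp
  have m2 : ({a, s, q} : Finset V) ∈ pathEdges a (A ++ M ++ B) b := mem_pathEdges (P := []) hX2
  have m3 : ({s, q, r} : Finset V) ∈ pathEdges a (A ++ M ++ B) b :=
    mem_pathEdges (P := [a]) (Q := A' ++ M ++ B ++ [b]) (by rw [hX2]; simp)
  have hnd3 := hnd
  rw [hA] at hnd3
  -- The path has no triple centred at `a`, so there is no double threat on the left, and `r` cannot
  -- be excluded.
  have hc : d = a ∨ d = q ∨ d = r := hd'.reply_near (Or.inr m2) (Or.inr m3) (by rw [hA]; simp)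
    (by simp [List.nodup_append] at hnd3; grind) (by simp [List.nodup_append] at hnd3; grind)
    (by simp [List.nodup_append] at hnd3; grind) (by simp [List.nodup_append] at hnd3; grind)
    (Finset.ne_of_mem_erase hd)
  have ndr : ∀ {L : List V}, L.Sublist (a :: (A ++ M ++ M' ++ B) ++ [b]) → L.reverse.Nodup :=
    fun hL => List.nodup_reverse.2 (hnd.sublist hL)
  have hqC : ∀ e ∈ C, q ∉ e := by
    intro e he hqe
    rcases h.attached e he q (by simp [hA]) hqe with h1 | h1
    · simp [hA] at h1
      simp [h1.1] at hnd3
    · have := List.mem_of_getLast? h1.1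
      simp [this] at hnd3
  rcases hc with rfl | rfl | rfl
  · refine ⟨d, ?_, ?_⟩
    · simp only [Finset.mem_erase, Finset.mem_union, List.mem_toFinset] at hd ⊢
      refine ⟨hd.1, hd.2.imp id fun h1 => ?_⟩
      simp only [List.append_assoc, List.cons_append, List.nodup_cons, List.mem_append] at hnd h1
      tauto
    · refine h.reply_end (s := s) (s' := s) (rc := [s]) (rc' := [s]) (Q := q :: r :: A' ++ M ++ B)
        (Q' := q :: r :: A' ++ M' ++ B) (by simp [hA]) (by simp [hA]) ?_ (by simp) (by simp) hd'
      have := Repl.leaf (a := b) (c := s) (c' := s) (Y := B.reverse)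
        (W := (q :: r :: A' ++ M).reverse) (W' := (q :: r :: A' ++ M').reverse)
        (by simp; omega) (by simp; omega) (by
          have := ndr (L := s :: (q :: r :: A' ++ M ++ B) ++ [b]) (by
            simp only [hA, List.append_assoc, List.cons_append]
            repeat (first | (solve | simp) | refine List.Sublist.cons _ ?_))
          simpa using this) (by
          have := ndr (L := s :: (q :: r :: A' ++ M' ++ B) ++ [b]) (by
            simp only [hA, List.append_assoc, List.cons_append]
            repeat (first | (solve | simp) | refine List.Sublist.cons _ ?_))
          simpa using this)
      simpa using this
  · refine ⟨d, ?_, ?_⟩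
    · simp [hA, Finset.ne_of_mem_erase hd]
    · refine h.reply (s := s) (s' := s) (P := []) (lc := [s]) (ex := []) (rc := [])
        (Q := r :: A' ++ M ++ B) (P' := []) (lc' := [s]) (rc' := []) (Q' := r :: A' ++ M' ++ B)
        (by simp [hA]) (by simp [hA]) (Repl.refl _ _ _) ?_ rfl
        (by simp) (by simp) (by simp) (by simp [List.nodup_append] at hnd3 ⊢; grind) hd'
      have := Repl.tail (a := b) (Y := B.reverse)
        (W := (r :: A' ++ M).reverse) (W' := (r :: A' ++ M').reverse)
        (by simp; omega) (by
          have := ndr (L := (r :: A' ++ M ++ B) ++ [b]) (by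
            simp only [hA, List.append_assoc, List.cons_append]
            repeat (first | (solve | simp) | refine List.Sublist.cons _ ?_))
          simpa using this) (by
          have := ndr (L := (r :: A' ++ M' ++ B) ++ [b]) (by
            simp only [hA, List.append_assoc, List.cons_append]
            repeat (first | (solve | simp) | refine List.Sublist.cons _ ?_))
          simpa using this)
      simpa using this
  -- The old reply was the third vertex; on the new path she takes `q` instead. This also hits `{a,
  -- s, q}`, and the right arm keeps a dominated end, so that its additional vertex is harmless.
  · refine ⟨q, ?_, ?_⟩
    · simp [hA]
      simp [List.nodup_append] at hnd3
      grind
    · refine h.reply (s := s) (s' := s) (d := d) (P := []) (lc := [s]) (ex := [q]) (rc := [])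
        (Q := A' ++ M ++ B) (P' := []) (lc' := [s]) (rc' := []) (Q' := d :: A' ++ M' ++ B)
        (by simp [hA]) (by simp [hA]) (Repl.refl _ _ _) ?_ ?_
        (by simpa using hqC) (by simp) (by simp) (by simp [List.nodup_append] at hnd3 ⊢; grind) hd'
      · have := Repl.tail (a := b) (Y := B.reverse)
          (W := (A' ++ M).reverse) (W' := (d :: A' ++ M').reverse)
          (by simp; omega) (by
            have := ndr (L := (A' ++ M ++ B) ++ [b]) (by
            simp only [hA, List.append_assoc, List.cons_append]
            repeat (first | (solve | simp) | refine List.Sublist.cons _ ?_))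
            simpa using this) (by
            have := ndr (L := (d :: A' ++ M' ++ B) ++ [b]) (by
            simp only [hA, List.append_assoc, List.cons_append]
            repeat (first | (solve | simp) | refine List.Sublist.cons _ ?_))
            simpa using this)
        simpa using this
      · rw [h.avoid_eq (x := d) (by simp [hA]) ?_ ?_]
        · ext e
          exact ⟨fun he => ⟨he, hqC e he⟩, fun he => he.1⟩
        · simp [hA]
          rintro rfl
          simp at hnd3
        · intro h1
          have := List.mem_of_getLast? h1
          simp [this] at hnd3

end Paths


/-! ### Carrying a strategy from one long path to another -/

section Paths

variable {V : Type*} [DecidableEq V]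
variable {U : Finset V} {C : Set (Finset V)} {a b : V} {A M M' B : List V}

/-- Inner vertices of the path lie in no outer edge. Dominator's claims of such vertices therefore
have the same effect on `C` and may be interchanged. -/
theorem LongPaths.avoid_inner (h : LongPaths U C a A M M' B b) {x y z : V} {B' A' : List V}
    (hB : B = y :: B') (hA : A = z :: A') (hx : x ∈ A' ++ M ++ M' ++ [y]) : avoid C x = C := by
  have hnd := h.nodup
  have hlen := h.le_right
  have hnd2 : (z :: (A' ++ M ++ M' ++ [y]) ++ B').Nodup := by
    refine hnd.sublist ?_
    rw [hA, hB]
    simp only [List.append_assoc, List.cons_append, List.nil_append]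
    refine List.Sublist.cons _ (List.Sublist.cons_cons _ ?_)
    simp
  refine h.avoid_eq (by rw [hA, hB]; simp at hx ⊢; tauto) ?_ ?_
  · rw [hA]
    simp only [List.head?_cons, ne_eq, Option.some.injEq]
    rintro rfl
    rw [List.cons_append, List.nodup_cons] at hnd2
    exact hnd2.1 (List.mem_append_left _ hx)
  · intro h1
    have h2 : B' ≠ [] := by rintro rfl; simp [hB] at hlen
    rw [hB, List.getLast?_cons_of_ne_nil h2] at h1
    exact (List.nodup_append.1 hnd2).2.2 x (List.mem_cons_of_mem _ hx) x
      (List.mem_of_getLast? h1) rfl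

theorem exists_cons_of_append_singleton (L : List V) (x : V) : ∃ q N, L ++ [x] = q :: N := by
  cases L <;> simp

/-- Staller moves in the first part of the path. -/
theorem LongPaths.staller_left (h : LongPaths U C a A M M' B b) {s : V} (hs : s ∈ A)
    (hDW : DW (U ∪ (A ++ M ++ B).toFinset) (C ∪ pathEdges a (A ++ M ++ B) b)) :
    ∃ d ∈ (U ∪ (A ++ M' ++ B).toFinset).erase s,
      DW (((U ∪ (A ++ M' ++ B).toFinset).erase s).erase d)
        (avoid (C ∪ pathEdges a (A ++ M' ++ B) b) d) := by
  have hnd := h.nodup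
  have hlen := h.le_left
  have hlenB := h.le_right
  have hpar := h.parity
  obtain ⟨A₁, A₂, hA⟩ := List.append_of_mem hs
  rcases List.eq_nil_or_concat A₁ with rfl | ⟨P, p, rfl⟩
  · rcases A₂ with _ | ⟨q, _ | ⟨r, A'⟩⟩
    · simp [hA] at hlen
    · simp [hA] at hlen
    · exact h.staller_head (by simpa using hA) hDW
  obtain ⟨y, B', hB⟩ : ∃ y B', B = y :: B' := by
    rcases B with _ | ⟨y, B'⟩
    · simp at hlenB
    · exact ⟨y, B', rfl⟩
  obtain ⟨z, A', hA'⟩ : ∃ z A', A = z :: A' := by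
    rcases A with _ | ⟨y, B'⟩
    · simp at hlen
    · exact ⟨y, B', rfl⟩
  obtain ⟨q, N, hN⟩ := exists_cons_of_append_singleton (A₂ ++ M) y
  obtain ⟨q', N', hN'⟩ := exists_cons_of_append_singleton (A₂ ++ M') y
  have hl := congrArg List.length hN
  have hl' := congrArg List.length hN'
  have hlB := congrArg List.length hB
  simp at hl hl' hlB
  obtain ⟨r, Q, hQ⟩ : ∃ r Q, N ++ B' = r :: Q := by
    rcases h3 : N ++ B' with _ | ⟨r, Q⟩
    · have := (List.append_eq_nil_iff.1 h3).2
      simp [this] at hlB; omega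
    · exact ⟨r, Q, rfl⟩
  have hAe : A = P ++ p :: s :: A₂ := by simpa using hA
  have hXr : A ++ M ++ B = P ++ p :: s :: ((A₂ ++ M ++ [y]) ++ B') := by simp [hAe, hB]
  have hXr' : A ++ M' ++ B = P ++ p :: s :: ((A₂ ++ M' ++ [y]) ++ B') := by simp [hAe, hB]
  have hX : A ++ M ++ B = P ++ p :: s :: q :: r :: Q := by
    rw [hXr, hN, ← hQ]; simp
  have hX' : A ++ M' ++ B = P ++ p :: s :: q' :: (N' ++ B') := by rw [hXr', hN', List.cons_append]
  have hndX := h.nodup_left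
  have hndX' := h.nodup_right
  have s1 : (s :: (q :: N ++ B') ++ [b]).Nodup := by
    rw [hXr, hN] at hndX
    refine hndX.sublist ?_
    simp only [List.append_assoc, List.cons_append]
    exact List.Sublist.cons _ (List.sublist_append_of_sublist_right (List.Sublist.cons _ (by simp)))
  have s2 : (s :: (q' :: N' ++ B') ++ [b]).Nodup := by
    rw [hXr', hN'] at hndX'
    refine hndX'.sublist ?_
    simp only [List.append_assoc, List.cons_append]
    exact List.Sublist.cons _ (List.sublist_append_of_sublist_right (List.Sublist.cons _ (by simp)))
  have s1' := List.nodup_reverse.2 s1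
  have s2' := List.nodup_reverse.2 s2
  -- Staller's vertex has the same place on both paths: the left arms agree, and the right arms
  -- differ only by `M` against `M'`.
  refine h.staller_inner hX hX' (Repl.refl _ _ _) (Repl.refl _ _ _) ?_ ?_ rfl ?_ ?_ ?_ hDW
  · rw [← hQ]
    have := Repl.tail (a := b) (Y := B'.reverse) (W := N.reverse) (W' := N'.reverse)
      (by simp; omega) (s1'.sublist (by simp)) (s2'.sublist (by simp))
    simpa using this
  · rw [← hQ]
    have := Repl.leaf (a := b) (c := s) (c' := s) (Y := B'.reverse) (W := (q :: N).reverse)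
      (W' := (q' :: N').reverse) (by simp; omega) (by simp; omega) (s1'.sublist (by simp))
      (s2'.sublist (by simp))
    simpa using this
  · rcases A₂ with _ | ⟨x, A₂⟩
    · have hq : q ∈ M ++ [y] := by simp at hN; rw [hN]; simp
      have hq' : q' ∈ M' ++ [y] := by simp at hN'; rw [hN']; simp
      rw [h.avoid_inner hB hA' (by simp at hq ⊢; tauto), h.avoid_inner hB hA' (by simp at hq' ⊢; tauto)]
    · simp at hN hN'
      rw [← hN.1, ← hN'.1]
  · rw [hX'] at hndX'
    simp only [List.append_assoc, List.cons_append, List.nodup_cons] at hndX'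
    have := (List.nodup_append.1 hndX'.2).2.2
    intro y hy hy'
    exact this y hy y (by simp at hy' ⊢; tauto) rfl
  · rw [hX'] at hndX'
    have : (a :: ((P ++ [p, s]) ++ q' :: ((N' ++ B') ++ [b]))).Nodup := by simpa using hndX'
    have := (List.nodup_append.1 (List.nodup_cons.1 this).2).2.2
    intro y hy hy'
    exact this y hy y (by simp at hy' ⊢; tauto) rfl

set_option maxHeartbeats 1000000 in
/-- Staller moves in the middle of the path. -/
theorem LongPaths.staller_middle (h : LongPaths U C a A M M' B b) {s : V} (hs : s ∈ M')
    (hDW : DW (U ∪ (A ++ M ++ B).toFinset) (C ∪ pathEdges a (A ++ M ++ B) b)) :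
    ∃ d ∈ (U ∪ (A ++ M' ++ B).toFinset).erase s,
      DW (((U ∪ (A ++ M' ++ B).toFinset).erase s).erase d)
        (avoid (C ∪ pathEdges a (A ++ M' ++ B) b) d) := by
  have hnd := h.nodup
  have hlen := h.le_left
  have hlenB := h.le_right
  have hpar := h.parity
  obtain ⟨M₁, M₂, hM⟩ := List.append_of_mem hs
  -- The move `s` in `M'` is treated as a move at `x` near the end of `A`. `R` has length `0` or
  -- `1`, chosen so that the left arms before `x` and before `s` have the same parity; the right
  -- arms then agree in parity as well. As `A` has six vertices, at least three precede `p`.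
  obtain ⟨z, P, p, x, R, hA, hR, hP⟩ : ∃ z P p x R, A = z :: P ++ p :: x :: R ∧
      (R.length + M₁.length) % 2 = 1 ∧ 2 ≤ P.length := by
    have h1 : ∀ n, n ≤ A.length → A.take n ++ A.drop n = A := fun n _ => List.take_append_drop n A
    have hget : ∀ n (hn : n + 1 < A.length), 3 ≤ n → ∃ z P p x, A = z :: P ++ p :: x :: A.drop (n + 2) ∧
        2 ≤ P.length := by
      intro n hn hn3
      rcases hA : A with _ | ⟨z, A'⟩
      · simp [hA] at hlen
      · have hn' : n < A'.length := by simp [hA] at hn; omega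
        refine ⟨z, A'.take (n - 1), A'[n - 1], A'[n], ?_, by simp; omega⟩
        have : A'.drop (n - 1) = A'[n - 1] :: A'[n] :: A'.drop (n + 1) := by
          rw [List.drop_eq_getElem_cons (by omega)]
          congr 1
          have : n - 1 + 1 = n := by omega
          rw [this, List.drop_eq_getElem_cons hn']
        simp only [List.drop_succ_cons, List.cons_append]
        rw [← this, List.take_append_drop]
    rcases Nat.mod_two_eq_zero_or_one M₁.length with h0 | h0
    · obtain ⟨z, P, p, x, hA, hP⟩ := hget (A.length - 3) (by omega) (by omega)
      exact ⟨z, P, p, x, _, hA, by simp; omega, hP⟩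
    · obtain ⟨z, P, p, x, hA, hP⟩ := hget (A.length - 2) (by omega) (by omega)
      exact ⟨z, P, p, x, _, hA, by simp; omega, hP⟩
  obtain ⟨y, B', hB⟩ : ∃ y B', B = y :: B' := by
    rcases B with _ | ⟨y, B'⟩
    · simp at hlenB
    · exact ⟨y, B', rfl⟩
  obtain ⟨q, N, hN⟩ := exists_cons_of_append_singleton (R ++ M) y
  obtain ⟨q', N', hN'⟩ := exists_cons_of_append_singleton M₂ y
  obtain ⟨L, p', hL⟩ : ∃ L p', x :: (R ++ M₁) = L ++ [p'] := by
    rcases List.eq_nil_or_concat (x :: (R ++ M₁)) with h | ⟨L, p', h⟩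
    · simp at h
    · exact ⟨L, p', by simpa using h⟩
  have hl := congrArg List.length hN
  have hl' := congrArg List.length hN'
  have hlB := congrArg List.length hB
  have hlL := congrArg List.length hL
  have hlM := congrArg List.length hM
  simp at hl hl' hlB hlL hlM
  obtain ⟨r, Q, hQ⟩ : ∃ r Q, N ++ B' = r :: Q := by
    rcases h3 : N ++ B' with _ | ⟨r, Q⟩
    · have := (List.append_eq_nil_iff.1 h3).2
      simp [this] at hlB; omega
    · exact ⟨r, Q, rfl⟩
  have hXr : A ++ M ++ B = (z :: P) ++ p :: x :: ((R ++ M ++ [y]) ++ B') := by simp [hA, hB]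
  have hXr' : A ++ M' ++ B = (z :: P ++ p :: (x :: (R ++ M₁))) ++ s :: ((M₂ ++ [y]) ++ B') := by
    simp [hA, hB, hM]
  have hX : A ++ M ++ B = (z :: P) ++ p :: x :: q :: r :: Q := by
    rw [hXr, hN, ← hQ]; simp
  have hX' : A ++ M' ++ B = (z :: P ++ p :: L) ++ p' :: s :: q' :: (N' ++ B') := by
    rw [hXr', hN', hL]; simp
  have hndX := h.nodup_left
  have hndX' := h.nodup_right
  have s1 : (x :: (q :: N ++ B') ++ [b]).Nodup := by
    rw [hXr, hN] at hndX
    refine hndX.sublist ?_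
    simp only [List.append_assoc, List.cons_append]
    exact List.Sublist.cons _ (List.Sublist.cons _
      (List.sublist_append_of_sublist_right (List.Sublist.cons _ (by simp))))
  have s2 : (s :: (q' :: N' ++ B') ++ [b]).Nodup := by
    rw [hXr', hN'] at hndX'
    refine hndX'.sublist ?_
    simp only [List.append_assoc, List.cons_append]
    refine List.Sublist.cons _ (List.Sublist.cons _ (List.sublist_append_of_sublist_right
      (List.Sublist.cons _ (List.Sublist.cons _ (List.sublist_append_of_sublist_right
        (List.sublist_append_of_sublist_right ?_))))))
    simp
  have s3 : (a :: (z :: P ++ p :: [x])).Nodup := by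
    rw [hXr] at hndX
    refine hndX.sublist ?_
    simp
  have s4 : (a :: (z :: P ++ p :: (L ++ [p']) ++ [s])).Nodup := by
    rw [hXr', hL] at hndX'
    refine hndX'.sublist ?_
    simp
  have s1' := List.nodup_reverse.2 s1
  have s2' := List.nodup_reverse.2 s2
  have hin : ∀ w, w ∈ P ++ p :: x :: (R ++ M ++ M' ++ [y]) → avoid C w = C := fun w hw =>
    h.avoid_inner hB (by simpa using hA) (by simp at hw ⊢; tauto)
  have hp' : p' ∈ x :: (R ++ M₁) := by rw [hL]; simp
  have hq : q ∈ R ++ M ++ [y] := by rw [hN]; simp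
  have hq' : q' ∈ M₂ ++ [y] := by rw [hN']; simp
  refine h.staller_inner hX hX' ?_ ?_ ?_ ?_ ?_ ?_ ?_ ?_ hDW
  · have := Repl.tail (a := a) (Y := z :: P) (W := []) (W' := p :: L) (by simp; omega)
      (s3.sublist (by simp)) (s4.sublist (by simp))
    simpa using this
  · have := Repl.leaf (a := a) (c := x) (c' := s) (Y := z :: P ++ [p]) (W := []) (W' := L ++ [p'])
      (by simp) (by simp; omega) (s3.sublist (by simp)) (s4.sublist (by simp))
    simpa using this
  · rw [← hQ]
    have := Repl.tail (a := b) (Y := B'.reverse) (W := N.reverse) (W' := N'.reverse)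
      (by simp; omega) (s1'.sublist (by simp)) (s2'.sublist (by simp))
    simpa using this
  · rw [← hQ]
    have := Repl.leaf (a := b) (c := x) (c' := s) (Y := B'.reverse) (W := (q :: N).reverse)
      (W' := (q' :: N').reverse) (by simp; omega) (by simp; omega) (s1'.sublist (by simp))
      (s2'.sublist (by simp))
    simpa using this
  · rw [hin p (by simp), hin p' (by simp [hM] at hp' ⊢; tauto)]
  · rw [hin q (by simp at hq ⊢; tauto), hin q' (by simp [hM] at hq' ⊢; tauto)]
  · rw [hX'] at hndX'
    have : (a :: ((z :: P) ++ (p :: L ++ p' :: s :: q' :: (N' ++ B') ++ [b]))).Nodup := by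
      simpa using hndX'
    have := (List.nodup_append.1 (List.nodup_cons.1 this).2).2.2
    intro y hy hy'
    exact this y hy y (by simp at hy' ⊢; tauto) rfl
  · have e : (a :: (A ++ M' ++ B) ++ [b]) = a :: (((z :: P) ++ [p, x]) ++
        (R ++ M₁ ++ s :: q' :: (N' ++ B') ++ [b])) := by rw [hXr', hN']; simp
    rw [e] at hndX'
    have := (List.nodup_append.1 (List.nodup_cons.1 hndX').2).2.2
    intro y hy hy'
    exact this y hy y (by simp at hy' ⊢; tauto) rfl

/-- Staller moves on the path. -/
theorem LongPaths.staller_path (h : LongPaths U C a A M M' B b) {s : V} (hs : s ∈ A ++ M' ++ B)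
    (hDW : DW (U ∪ (A ++ M ++ B).toFinset) (C ∪ pathEdges a (A ++ M ++ B) b)) :
    ∃ d ∈ (U ∪ (A ++ M' ++ B).toFinset).erase s,
      DW (((U ∪ (A ++ M' ++ B).toFinset).erase s).erase d)
        (avoid (C ∪ pathEdges a (A ++ M' ++ B) b) d) := by
  simp only [List.mem_append] at hs
  rcases hs with (hs | hs) | hs
  · exact h.staller_left hs hDW
  · exact h.staller_middle hs hDW
  · have e : ∀ M : List V, B.reverse ++ M.reverse ++ A.reverse = (A ++ M ++ B).reverse := by simp
    have := h.reverse.staller_left (s := s) (by simpa using hs)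
    simp only [e, pathEdges_reverse, List.toFinset_reverse] at this
    exact this hDW

/-- Dominator answers on the path to a move off the path. -/
theorem LongPaths.dominator_path (h : LongPaths U C a A M M' B b) {s d : V} (hs : s ∈ U)
    (hd : d ∈ A ++ M ++ B)
    (hDW : DW (((U ∪ (A ++ M ++ B).toFinset).erase s).erase d)
      (avoid (C ∪ pathEdges a (A ++ M ++ B) b) d)) :
    ∃ d ∈ (U ∪ (A ++ M' ++ B).toFinset).erase s,
      DW (((U ∪ (A ++ M' ++ B).toFinset).erase s).erase d)
        (avoid (C ∪ pathEdges a (A ++ M' ++ B) b) d) := by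
  have key : ∀ {a b : V} {A M M' B : List V}, LongPaths U C a A M M' B b → (d ∈ A ∨ d ∈ M) →
      DW (((U ∪ (A ++ M ++ B).toFinset).erase s).erase d)
        (avoid (C ∪ pathEdges a (A ++ M ++ B) b) d) →
      ∃ d ∈ (U ∪ (A ++ M' ++ B).toFinset).erase s,
        DW (((U ∪ (A ++ M' ++ B).toFinset).erase s).erase d)
          (avoid (C ∪ pathEdges a (A ++ M' ++ B) b) d) := by
    clear h hd hDW
    intro a b A M M' B h hd hDW
    have hnd := h.nodup
    have hlen := h.le_left
    have hlenB := h.le_right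
    have hds : ∀ d' ∈ A, d' ∈ (U ∪ (A ++ M' ++ B).toFinset).erase s := by
      intro d' hd'
      simp only [Finset.mem_erase, Finset.mem_union, List.mem_toFinset, List.mem_append]
      refine ⟨?_, by tauto⟩
      rintro rfl
      exact h.disj d' (by simp [hd']) hs
    have hr : ∀ {N N' : List V}, (N ++ B ++ [b]).Nodup → (N' ++ B ++ [b]).Nodup →
        Repl b (N ++ B).reverse [] (N' ++ B).reverse [] := by
      intro N N' hN hN'
      have := Repl.tail (a := b) (Y := B.reverse) (W := N.reverse) (W' := N'.reverse)
        (by simp; omega) (by simpa using List.nodup_reverse.2 hN)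
        (by simpa using List.nodup_reverse.2 hN')
      simpa using this
    rcases hd with hd | hd
    · refine ⟨d, hds d hd, ?_⟩
      obtain ⟨A₁, A₂, hA⟩ := List.append_of_mem hd
      refine h.reply (s := s) (s' := s) (d := d) (d' := d) (P := A₁) (lc := []) (ex := []) (rc := [])
        (Q := (A₂ ++ M) ++ B) (P' := A₁) (lc' := []) (rc' := []) (Q' := (A₂ ++ M') ++ B)
        (by simp [hA]) (by simp [hA]) (Repl.refl _ _ _) ?_ rfl (by simp) (by simp) (by simp [hs]) ?_
        hDW
      · refine hr (hnd.sublist ?_) (hnd.sublist ?_)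
        all_goals
          rw [hA]
          simp only [List.append_assoc, List.cons_append]
          exact List.Sublist.cons _ (List.sublist_append_of_sublist_right
            (List.Sublist.cons _ (by simp)))
      · have hndX := h.nodup_right
        rw [hA] at hndX
        have : (a :: (A₁ ++ (d :: A₂ ++ M' ++ B ++ [b]))).Nodup := by simpa using hndX
        have := (List.nodup_append.1 (List.nodup_cons.1 this).2).2.2
        intro y hy hy'
        exact this y (by simpa using hy) y (by simp at hy' ⊢; tauto) rfl
    -- A reply in `M` has no counterpart in `M'`, but any place will do: both arms get dominated
    -- ends and keep three or more common vertices. The last vertex of `A` is taken.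
    · obtain ⟨A₀, d', hA⟩ : ∃ A₀ d', A = A₀ ++ [d'] := by
        rcases List.eq_nil_or_concat A with rfl | ⟨L, p', h⟩
        · simp at hlen
        · exact ⟨L, p', by simpa using h⟩
      obtain ⟨M₁, M₂, hM⟩ := List.append_of_mem hd
      refine ⟨d', hds d' (by simp [hA]), ?_⟩
      obtain ⟨y, B', hB⟩ : ∃ y B', B = y :: B' := by
        rcases B with _ | ⟨y, B'⟩
        · simp at hlenB
        · exact ⟨y, B', rfl⟩
      obtain ⟨z, A', hA'⟩ : ∃ z A', A₀ = z :: A' := by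
        rcases A₀ with _ | ⟨y, B'⟩
        · simp [hA] at hlen
        · exact ⟨y, B', rfl⟩
      have hAA : A = z :: (A' ++ [d']) := by rw [hA, hA']; simp
      refine h.reply (s := s) (s' := s) (d := d) (d' := d') (P := A₀ ++ d' :: M₁) (lc := []) (ex := [])
        (rc := []) (Q := M₂ ++ B) (P' := A₀) (lc' := []) (rc' := []) (Q' := M' ++ B)
        (by simp [hA, hM]) (by simp [hA]) ?_ ?_ ?_ (by simp) (by simp) (by simp [hs]) ?_ hDW
      · have := Repl.tail (a := a) (Y := A₀) (W := d' :: M₁) (W' := []) (by simp [hA] at hlen; omega)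
          (hnd.sublist (by simp [hA, hM])) (hnd.sublist (by simp [hA]))
        simpa using this
      · refine hr (hnd.sublist ?_) (hnd.sublist ?_)
        · rw [hM]
          simp only [List.append_assoc, List.cons_append]
          exact List.Sublist.cons _ (List.sublist_append_of_sublist_right
            (List.sublist_append_of_sublist_right (List.Sublist.cons _ (by simp))))
        · simp only [List.append_assoc, List.cons_append]
          exact List.Sublist.cons _ (List.sublist_append_of_sublist_right
            (List.sublist_append_of_sublist_right (by simp)))
      · rw [h.avoid_inner hB hAA (by simp [hM]), h.avoid_inner hB hAA (by simp)]
      · have : (a :: ((A ++ M) ++ (M' ++ B ++ [b]))).Nodup := by simpa using hnd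
        have := (List.nodup_append.1 (List.nodup_cons.1 this).2).2.2
        intro y hy hy'
        exact this y (by simp [hA, hM] at hy ⊢; tauto) y (by simp at hy' ⊢; tauto) rfl
  simp only [List.mem_append] at hd
  rcases hd with hd | hd
  · exact key h hd hDW
  · have e : ∀ M : List V, B.reverse ++ M.reverse ++ A.reverse = (A ++ M ++ B).reverse := by simp
    have := key h.reverse (Or.inl (by simpa using hd))
    simp only [e, pathEdges_reverse, List.toFinset_reverse] at this
    exact this hDW

/-- Of a long path, only the parity of its length matters. -/
theorem LongPaths.transfer {a b : V} {A M M' B : List V} : ∀ (n : ℕ) {U : Finset V}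
    {C : Set (Finset V)}, U.card = n → LongPaths U C a A M M' B b →
    DW (U ∪ (A ++ M ++ B).toFinset) (C ∪ pathEdges a (A ++ M ++ B) b) →
    DW (U ∪ (A ++ M' ++ B).toFinset) (C ∪ pathEdges a (A ++ M' ++ B) b) := by
  intro n
  -- The induction is used only if both players move off the path and Dominator takes neither `a`
  -- nor `b`. In all other cases a single round cuts the path.
  induction n using Nat.strong_induction_on with
  | _ n ih =>
  intro U C hn h hDW
  have hnd := h.nodup
  have hlen := h.le_left
  have hlenB := h.le_right
  obtain ⟨e, he⟩ := h.exists_edge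
  have hne : (U ∪ (A ++ M' ++ B).toFinset).Nonempty := by
    rcases A with _ | ⟨x, A⟩
    · simp at hlen
    · exact ⟨x, by simp⟩
  refine DW.of_replies hne fun s hs => ?_
  simp only [Finset.mem_union, List.mem_toFinset] at hs
  rcases hs with hs | hs
  swap
  · exact h.staller_path hs hDW
  obtain ⟨d, hd, hd'⟩ := hDW.reply he (s := s) (by simp [hs])
  simp only [Finset.mem_erase, Finset.mem_union, List.mem_toFinset] at hd
  rcases hd.2 with hdU | hdX
  swap
  · exact h.dominator_path hs hdX hd'
  have key : ∀ {a b : V} {A M M' B : List V}, LongPaths U C a A M M' B b → d = a →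
      DW (((U ∪ (A ++ M ++ B).toFinset).erase s).erase d)
        (avoid (C ∪ pathEdges a (A ++ M ++ B) b) d) →
      DW (((U ∪ (A ++ M' ++ B).toFinset).erase s).erase d)
          (avoid (C ∪ pathEdges a (A ++ M' ++ B) b) d) := by
    rintro a b A M M' B h rfl hd'
    have hnd := h.nodup
    have hlenB := h.le_right
    refine h.reply_end (s := s) (s' := s) (rc := []) (rc' := []) (Q := (A ++ M) ++ B)
      (Q' := (A ++ M') ++ B) (by simp) (by simp) ?_ (by simp) (by simp [hs]) hd'
    have := Repl.tail (a := b) (Y := B.reverse) (W := (A ++ M).reverse) (W' := (A ++ M').reverse)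
      (by simp; omega)
      (by
        have := List.nodup_reverse.2 h.nodup_left
        refine this.sublist ?_
        simp)
      (by
        have := List.nodup_reverse.2 h.nodup_right
        refine this.sublist ?_
        simp)
    simpa using this
  refine ⟨d, by simp [hd.1, hdU], ?_⟩
  by_cases hda : d = a
  · exact key h hda hd'
  by_cases hdb : d = b
  · have e : ∀ M : List V, B.reverse ++ M.reverse ++ A.reverse = (A ++ M ++ B).reverse := by simp
    have := key h.reverse hdb
    simp only [e, pathEdges_reverse, List.toFinset_reverse] at this
    exact this hd'
  have hdn : ∀ x ∈ A ++ M ++ M' ++ B, x ≠ s ∧ x ≠ d := fun x hx =>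
    ⟨fun h' => h.disj x hx (h' ▸ hs), fun h' => h.disj x hx (h' ▸ hdU)⟩
  have hU : ∀ L : List V, (∀ x ∈ L, x ∈ A ++ M ++ M' ++ B) → ((U ∪ L.toFinset).erase s).erase d =
      (U.erase s).erase d ∪ L.toFinset := by
    intro L hL
    ext x
    simp only [Finset.mem_erase, Finset.mem_union, List.mem_toFinset]
    constructor
    · tauto
    · rintro (h1 | h1)
      · tauto
      · have := hdn x (hL x h1)
        tauto
  have hC : ∀ N : List V, (∀ x ∈ N, x ∈ A ++ M ++ M' ++ B) →
      avoid (C ∪ pathEdges a N b) d = avoid C d ∪ pathEdges a N b := by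
    intro N hN
    rw [avoid_union]
    unfold pathEdges
    rw [avoid_triples_of_notMem]
    simp only [List.cons_append, List.mem_cons, List.mem_append, List.not_mem_nil, or_false, not_or]
    exact ⟨hda, fun h' => (hdn d (hN d h')).2 rfl, hdb⟩
  rw [hU _ (fun x hx => by simp at hx ⊢; tauto), hC _ (fun x hx => by simp at hx ⊢; tauto)] at hd' ⊢
  refine ih _ ?_ rfl ⟨hnd, hlen, hlenB, h.parity, fun x hx hxU => h.disj x hx ?_,
    fun e he => h.attached e he.1⟩ hd'
  · rw [← hn, Finset.card_erase_of_mem (by simp [hd.1, hdU])]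
    have := Finset.card_erase_lt_of_mem hs
    omega
  · simp only [Finset.mem_erase] at hxU
    exact hxU.2.2

end Paths


/-! ### The domination game as a hitting game -/

section Win

variable {V W : Type*} [DecidableEq V] [DecidableEq W]

open Classical in
/-- The closed neighbourhood of `x` among the vertices `A`. -/
noncomputable def cnbr (G : SimpleGraph V) (A : Finset V) (x : V) : Finset V :=
  {y ∈ A | y = x ∨ G.Adj x y}

theorem mem_cnbr {G : SimpleGraph V} {A : Finset V} {x y : V} :
    y ∈ cnbr G A x ↔ y ∈ A ∧ (y = x ∨ G.Adj x y) := by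
  simp [cnbr]

/-- The closed neighbourhoods of `G[A]` that do not contain `v`. -/
def openNbhds (G : SimpleGraph V) (A : Finset V) (v : V) : Set (Finset V) :=
  {e | ∃ x ∈ A, e = cnbr G A x ∧ v ∉ e}

/-- Dominator wins on `G[A]` if she has claimed `v` and Staller is to move. -/
def Win (G : SimpleGraph V) (A : Finset V) (v : V) : Prop := DW (A.erase v) (openNbhds G A v)

/-- Claimed vertices play no role any more, so `f` has to be injective, and to respect the edges,
only on the free ones. -/
theorem DW.image {U : Finset V} {H : Set (Finset V)} (h : DW U H) (f : V → W) :
    Set.InjOn f U → ∀ {H' : Set (Finset W)}, (∀ e' ∈ H', ∃ e ∈ H, ∀ x ∈ e, x ∈ U → f x ∈ e') →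
      DW (U.image f) H' := by
  induction h with
  | done U H h =>
    intro _ H' hH
    exact DW.done _ _ fun e he => by obtain ⟨e0, h0, _⟩ := hH e he; exact h e0 h0
  | move U H hU r h1 h2 ih =>
    intro hf H' hH
    refine DW.of_replies (hU.image f) fun s' hs' => ?_
    obtain ⟨s, hs, rfl⟩ := Finset.mem_image.1 hs'
    have hr := Finset.mem_erase.1 (h1 s hs)
    have e1 : ((U.erase s).erase (r s)).image f = ((U.image f).erase (f s)).erase (f (r s)) := by
      ext y
      simp only [Finset.mem_image, Finset.mem_erase]
      constructor
      · rintro ⟨x, ⟨hx1, hx2, hx3⟩, rfl⟩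
        exact ⟨fun h => hx1 (hf hx3 hr.2 h), fun h => hx2 (hf hx3 hs h), x, hx3, rfl⟩
      · rintro ⟨hx1, hx2, x, hx3, rfl⟩
        exact ⟨x, ⟨fun h => hx1 (h ▸ rfl), fun h => hx2 (h ▸ rfl), hx3⟩, rfl⟩
    refine ⟨f (r s), Finset.mem_erase.2 ⟨fun h => hr.1 (hf hr.2 hs h),
      Finset.mem_image_of_mem f hr.2⟩, e1 ▸ ih s hs (hf.mono ?_) ?_⟩
    · intro x hx
      simp only [Finset.coe_erase, Set.mem_sdiff] at hx
      exact hx.1.1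
    · rintro e' ⟨he', hd⟩
      obtain ⟨e, he, hee⟩ := hH e' he'
      refine ⟨e, ⟨he, fun h => hd (hee _ h hr.2)⟩, fun x hx hxU => hee x hx ?_⟩
      simp only [Finset.mem_erase] at hxU
      exact hxU.2.2

/-- Additional edges of `G'` only enlarge the closed neighbourhoods, which helps Dominator. One
direction of adjacency is therefore enough. -/
theorem Win.image {G : SimpleGraph V} {G' : SimpleGraph W} {A : Finset V} {v : V} {f : V → W}
    (h : Win G A v) (hv : v ∈ A) (hf : Set.InjOn f A)
    (hG : ∀ x ∈ A, ∀ y ∈ A, G.Adj x y → G'.Adj (f x) (f y)) : Win G' (A.image f) (f v) := by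
  have e1 : (A.erase v).image f = (A.image f).erase (f v) := by
    ext y
    simp only [Finset.mem_image, Finset.mem_erase]
    constructor
    · rintro ⟨x, ⟨hx1, hx2⟩, rfl⟩
      exact ⟨fun h => hx1 (hf hx2 hv h), x, hx2, rfl⟩
    · rintro ⟨hx1, x, hx3, rfl⟩
      exact ⟨x, ⟨fun h => hx1 (h ▸ rfl), hx3⟩, rfl⟩
  unfold Win at h ⊢
  rw [← e1]
  refine h.image f (hf.mono (by simp)) ?_
  rintro e' ⟨x', hx', rfl, hve⟩
  obtain ⟨x, hx, rfl⟩ := Finset.mem_image.1 hx'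
  have key : ∀ y ∈ cnbr G A x, f y ∈ cnbr G' (A.image f) (f x) := by
    intro y hy
    rw [mem_cnbr] at hy ⊢
    exact ⟨Finset.mem_image_of_mem f hy.1, hy.2.imp (fun h => congrArg f h) fun h => hG x hx y hy.1 h⟩
  exact ⟨cnbr G A x, ⟨x, hx, rfl, fun h => hve (key v h)⟩, fun y hy _ => key y hy⟩

theorem Win.iff_of_iso {G : SimpleGraph V} {G' : SimpleGraph W} {A : Finset V} {v : V} {f : V → W}
    (hv : v ∈ A) (hf : Set.InjOn f A)
    (hG : ∀ x ∈ A, ∀ y ∈ A, G.Adj x y ↔ G'.Adj (f x) (f y)) :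
    Win G A v ↔ Win G' (A.image f) (f v) := by
  refine ⟨fun h => h.image hv hf fun x hx y hy => (hG x hx y hy).1, fun h => ?_⟩
  have : Nonempty V := ⟨v⟩
  have hg : ∀ x ∈ A, Function.invFunOn f A (f x) = x := fun x hx =>
    hf.leftInvOn_invFunOn hx
  have h1 := h.image (G' := G) (f := Function.invFunOn f A) (Finset.mem_image_of_mem f hv) ?_ ?_
  · rw [hg v hv] at h1
    have : (A.image f).image (Function.invFunOn f A) = A := by
      rw [Finset.image_image]
      conv_rhs => rw [← Finset.image_id (s := A)]
      exact Finset.image_congr fun x hx => hg x hx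
    rwa [this] at h1
  · intro x hx y hy hxy
    obtain ⟨x, hx', rfl⟩ := Finset.mem_image.1 (Finset.mem_coe.1 hx)
    obtain ⟨y, hy', rfl⟩ := Finset.mem_image.1 (Finset.mem_coe.1 hy)
    rw [hg x hx', hg y hy'] at hxy
    rw [hxy]
  · intro x hx y hy hxy
    obtain ⟨x, hx', rfl⟩ := Finset.mem_image.1 hx
    obtain ⟨y, hy', rfl⟩ := Finset.mem_image.1 hy
    rw [hg x hx', hg y hy']
    exact (hG x hx' y hy').2 hxy

/-! ### The game of the statement -/

/-- `DW` joins a move of Staller and the answer to it in one round. Dominator may win at any moment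
in the game of the statement, but Staller's moves leave her set unchanged, so it suffices to test
for a win before Staller's turns. -/
theorem dominatorWins_iff_aux [Fintype V] (G : SimpleGraph V) : ∀ (n : ℕ) (D S : Finset V),
    (Finset.univ \ (D ∪ S)).card = n →
    (DominatorWins G Player.staller D S ↔
      DW (Finset.univ \ (D ∪ S)) {e | ∃ x, e = cnbr G Finset.univ x ∧ ∀ y ∈ e, y ∉ D}) := by
  have hdom : ∀ D : Finset V, IsDominating G D ↔
      ∀ e, e ∉ {e | ∃ x, e = cnbr G Finset.univ x ∧ ∀ y ∈ e, y ∉ D} := by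
    intro D
    constructor
    · rintro h e ⟨x, rfl, he⟩
      rcases h x with hx | ⟨u, hu, hux⟩
      · exact he x (by simp [mem_cnbr]) hx
      · exact he u (by simp [mem_cnbr, hux.symm]) hu
    · intro h x
      by_contra hcon
      push Not at hcon
      refine h _ ⟨x, rfl, fun y hy hyD => ?_⟩
      rw [mem_cnbr] at hy
      rcases hy.2 with rfl | hxy
      · exact hcon.1 hyD
      · exact hcon.2 y hyD hxy.symm
  have hav : ∀ (D : Finset V) (d : V),
      avoid {e | ∃ x, e = cnbr G Finset.univ x ∧ ∀ y ∈ e, y ∉ D} d =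
        {e | ∃ x, e = cnbr G Finset.univ x ∧ ∀ y ∈ e, y ∉ insert d D} := by
    intro D d
    ext e
    constructor
    · rintro ⟨⟨x, rfl, h⟩, hd⟩
      refine ⟨x, rfl, fun y hy hyD => ?_⟩
      rcases Finset.mem_insert.1 hyD with rfl | hyD
      · exact hd hy
      · exact h y hy hyD
    · rintro ⟨x, rfl, h⟩
      exact ⟨⟨x, rfl, fun y hy hyD => h y hy (Finset.mem_insert_of_mem hyD)⟩,
        fun hd => h d hd (Finset.mem_insert_self _ _)⟩
  have hU : ∀ (D S : Finset V) (d s : V), ((Finset.univ \ (D ∪ S)).erase s).erase d =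
      Finset.univ \ (insert d D ∪ insert s S) := by
    intro D S d s
    ext x
    simp only [Finset.mem_erase, Finset.mem_sdiff, Finset.mem_univ, Finset.mem_union,
      Finset.mem_insert, true_and]
    tauto
  intro n
  induction n using Nat.strong_induction_on with
  | _ n ih =>
  intro D S hn
  have hlt : ∀ s d, s ∉ D → s ∉ S → d ∉ D → d ∉ insert s S →
      (Finset.univ \ (insert d D ∪ insert s S)).card < n := by
    intro s d hsD hsS hdD hdS
    rw [← hn, ← hU]
    rw [Finset.mem_insert, not_or] at hdS
    refine Finset.card_lt_card ⟨(Finset.erase_subset _ _).trans (Finset.erase_subset _ _), fun h => ?_⟩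
    have := h (show s ∈ Finset.univ \ (D ∪ S) by simp [hsD, hsS])
    simp at this
  constructor
  · intro h
    cases h with
    | dominating _ _ _ h => exact DW.done _ _ ((hdom D).1 h)
    | staller_move _ _ hne h =>
      obtain ⟨s₀, hs₀⟩ := hne
      by_cases hD : IsDominating G D
      · exact DW.done _ _ ((hdom D).1 hD)
      refine DW.of_replies ⟨s₀, by simp [hs₀]⟩ fun s hs => ?_
      simp only [Finset.mem_sdiff, Finset.mem_univ, true_and, Finset.mem_union, not_or] at hs
      cases h s hs.1 hs.2 with
      | dominating _ _ _ h => exact absurd h hD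
      | dominator_move _ _ d hdD hdS h' =>
        refine ⟨d, ?_, ?_⟩
        · rw [Finset.mem_insert, not_or] at hdS
          simp [hdD, hdS]
        · rw [hU, hav]
          exact (ih _ (hlt s d hs.1 hs.2 hdD hdS) _ _ rfl).1 h'
  · intro h
    cases h with
    | done _ _ h => exact DominatorWins.dominating _ _ _ ((hdom D).2 h)
    | move _ _ hne r h1 h2 =>
      obtain ⟨s₀, hs₀⟩ := hne
      refine DominatorWins.staller_move D S ⟨s₀, by simpa using hs₀⟩ fun s hsD hsS => ?_
      have hs : s ∈ Finset.univ \ (D ∪ S) := by simp [hsD, hsS]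
      have h3 := h1 s hs
      have h4 := h2 s hs
      simp only [Finset.mem_erase, Finset.mem_sdiff, Finset.mem_univ, true_and, Finset.mem_union,
        not_or] at h3
      have h5 : r s ∉ insert s S := by
        rw [Finset.mem_insert, not_or]; tauto
      refine DominatorWins.dominator_move _ _ (r s) h3.2.1 h5 ?_
      rw [hU, hav] at h4
      exact (ih _ (hlt s _ hsD hsS h3.2.1 h5) _ _ rfl).2 h4

theorem dominatorWins_singleton_iff [Fintype V] (G : SimpleGraph V) (v : V) :
    DominatorWins G Player.staller {v} ∅ ↔ Win G Finset.univ v := by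
  rw [dominatorWins_iff_aux G _ _ _ rfl]
  unfold Win openNbhds
  have e1 : Finset.univ \ ({v} ∪ ∅ : Finset V) = Finset.univ.erase v := by
    ext x; simp
  have e2 : {e | ∃ x, e = cnbr G Finset.univ x ∧ ∀ y ∈ e, y ∉ ({v} : Finset V)} =
      {e | ∃ x ∈ (Finset.univ : Finset V), e = cnbr G Finset.univ x ∧ v ∉ e} := by
    ext e
    constructor
    · rintro ⟨x, rfl, h⟩
      exact ⟨x, Finset.mem_univ _, rfl, fun hv => h v hv (by simp)⟩
    · rintro ⟨x, -, rfl, h⟩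
      exact ⟨x, rfl, fun y hy hyv => h (by rw [Finset.mem_singleton] at hyv; exact hyv ▸ hy)⟩
  rw [e1, e2]

theorem dominatorWins_staller_iff [Fintype V] (G : SimpleGraph V) :
    DominatorWins G Player.staller ∅ ∅ ↔
      DW Finset.univ {e | ∃ x, e = cnbr G Finset.univ x} := by
  rw [dominatorWins_iff_aux G _ _ _ rfl]
  simp

/-- Without any move Dominator has won only on the empty graph. -/
theorem dominatorWins_dominator_iff [Fintype V] (G : SimpleGraph V) :
    DominatorWins G Player.dominator ∅ ∅ ↔
      IsEmpty V ∨ ∃ v, DominatorWins G Player.staller {v} ∅ := by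
  constructor
  · intro h
    cases h with
    | dominating _ _ _ h =>
      left
      refine ⟨fun x => ?_⟩
      have := h x
      simp at this
    | dominator_move _ _ v hD hS h => exact Or.inr ⟨v, by simpa using h⟩
  · rintro (h | ⟨v, h⟩)
    · exact DominatorWins.dominating _ _ _ fun x => h.elim x
    · exact DominatorWins.dominator_move _ _ v (by simp) (by simp) (by simpa using h)

/-! ### Reduction rules -/

theorem cnbr_sdiff {G : SimpleGraph V} {A R : Finset V} {x : V} :
    cnbr G (A \ R) x = cnbr G A x \ R := by
  ext y; simp only [mem_cnbr, Finset.mem_sdiff]; tauto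

/-- A leaf and its neighbour may be deleted. -/
theorem Win.leaf {G : SimpleGraph V} {A : Finset V} {u w v : V} (hu : u ∈ A) (hw : w ∈ A)
    (huw : u ≠ w) (huv : u ≠ v) (hwv : w ≠ v) (hN : cnbr G A u = {u, w}) :
    Win G A v ↔ Win G (A \ {u, w}) v := by
  have hu' : ∀ x ∈ A, u ∈ cnbr G A x → x = u ∨ x = w := by
    intro x hx hux
    rw [mem_cnbr] at hux
    have : x ∈ cnbr G A u := by
      rw [mem_cnbr]
      exact ⟨hx, hux.2.imp Eq.symm fun h => h.symm⟩
    simpa [hN] using this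
  have hwu : w ∈ cnbr G A u := by simp [hN]
  have huw' : u ∈ cnbr G A w := by
    rw [mem_cnbr] at hwu ⊢
    exact ⟨hu, Or.inr ((hwu.2.resolve_left huw.symm).symm)⟩
  constructor
  · intro h
    -- Staller takes `w`, and the neighbourhood `{u, w}` of the leaf forces `u`. This reply hits
    -- only the neighbourhoods of `u` and `w`, which are absent from the smaller graph.
    have h1 := h.force (e := cnbr G A u) (s := w) (d := u) ⟨u, hu, rfl, by
      rw [hN]; simp; tauto⟩ (by simp [hwv, hw]) (by
      intro x hx _
      simp [hN] at hx; tauto)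
    refine h1.mono ?_
    rintro e ⟨x, hx, rfl, hv⟩
    simp only [Finset.mem_sdiff, Finset.mem_insert, Finset.mem_singleton, not_or] at hx
    rw [cnbr_sdiff] at hv ⊢
    refine ⟨cnbr G A x, ⟨⟨x, hx.1, rfl, fun h => hv ?_⟩, fun h => ?_⟩, fun y hy => ?_⟩
    · simp [h, huv.symm, hwv.symm]
    · have := hu' x hx.1 h
      tauto
    · simp at hy ⊢
      tauto
  · intro h
    refine h.pair (a := u) (b := w) huw (by simp) (by simp) (by simp [hu, huv]) (by simp [hw, hwv]) ?_
    rintro e ⟨x, hx, rfl, hv⟩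
    by_cases hxu : x = u
    · right; rw [hxu, hN]; simp
    by_cases hxw : x = w
    · right; rw [hxw]; exact ⟨huw', by simp [mem_cnbr, hw]⟩
    · left
      refine ⟨cnbr G (A \ {u, w}) x, ⟨x, by simp [hx, hxu, hxw], rfl, ?_⟩, fun y hy => ?_⟩
      · rw [cnbr_sdiff]; simp; tauto
      · rw [cnbr_sdiff] at hy
        simp at hy ⊢
        tauto

/-- A leaf at Dominator's vertex may be deleted. -/
theorem Win.leaf_claimed {G : SimpleGraph V} {A : Finset V} {u v : V} (hu : u ∈ A) (hv : v ∈ A)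
    (huv : u ≠ v) (hN : cnbr G A u = {u, v}) : Win G A v ↔ Win G (A \ {u}) v := by
  have hu' : ∀ x ∈ A, u ∈ cnbr G A x → x = u ∨ x = v := by
    intro x hx hux
    rw [mem_cnbr] at hux
    have : x ∈ cnbr G A u := by
      rw [mem_cnbr]
      exact ⟨hx, hux.2.imp Eq.symm fun h => h.symm⟩
    simpa [hN] using this
  have hvv : v ∈ cnbr G A v := by simp [mem_cnbr, hv]
  constructor
  · intro h
    refine h.mono ?_
    rintro e ⟨x, hx, rfl, hv⟩
    simp only [Finset.mem_sdiff, Finset.mem_singleton] at hx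
    rw [cnbr_sdiff] at hv ⊢
    have hv' : v ∉ cnbr G A x := fun h => hv (by simp [h, huv.symm])
    refine ⟨cnbr G A x, ⟨x, hx.1, rfl, hv'⟩, fun y hy => ?_⟩
    have : y ≠ u := by
      rintro rfl
      rcases hu' x hx.1 (Finset.mem_inter.1 hy).1 with h | h
      · exact hx.2 h
      · exact hv' (h ▸ hvv)
    simp at hy ⊢
    tauto
  · intro h
    refine h.mono ?_
    rintro e ⟨x, hx, rfl, hv⟩
    have hxu : x ≠ u := by
      rintro rfl
      rw [hN] at hv
      simp at hv
    refine ⟨cnbr G (A \ {u}) x, ⟨x, by simp [hx, hxu], rfl, ?_⟩, fun y hy => ?_⟩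
    · rw [cnbr_sdiff]; simp [hv]
    · rw [cnbr_sdiff] at hy
      simp at hy ⊢
      tauto

/-- An isolated vertex is a threat that cannot be met. -/
theorem not_win_of_isolated {G : SimpleGraph V} {A : Finset V} {u v : V} (hu : u ∈ A)
    (huv : u ≠ v) (hN : cnbr G A u = {u}) : ¬ Win G A v := by
  intro h
  obtain ⟨y, hy, -, hyu⟩ := h.exists_ne (e := cnbr G A u) ⟨u, hu, rfl, by simp [hN, huv.symm]⟩ u
  rw [hN, Finset.mem_singleton] at hy
  exact hyu hy

/-- The inner vertices of the list `L` have their neighbours in `L` as their only neighbours. -/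
def IsThread (G : SimpleGraph V) (A : Finset V) (L : List V) : Prop :=
  ∀ P x y z Q, L = P ++ x :: y :: z :: Q → cnbr G A y = {x, y, z}

theorem IsThread.mem_pathEdges_iff {G : SimpleGraph V} {A : Finset V} {X : List V} {a b : V}
    (h : IsThread G A (a :: X ++ [b])) {e : Finset V} :
    e ∈ pathEdges a X b ↔ ∃ x ∈ X, e = cnbr G A x := by
  unfold pathEdges
  rw [mem_triples_iff]
  constructor
  · rintro ⟨P, Q, x, y, z, h1, rfl⟩
    refine ⟨y, ?_, (h P x y z Q h1).symm⟩
    rcases P with _ | ⟨p, P⟩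
    · simp only [List.cons_append, List.nil_append, List.cons.injEq] at h1
      rcases X with _ | ⟨x', X⟩
      · simp at h1
      · simp at h1; simp [h1.2.1]
    · simp only [List.cons_append, List.cons.injEq] at h1
      have h2 : X ++ [b] = (P ++ [x, y]) ++ (z :: Q) := by simp [h1.2]
      rcases List.eq_nil_or_concat Q with rfl | ⟨Q, q, rfl⟩
      · have := (List.append_inj' h2 rfl).1
        simp [this]
      · have h3 : X ++ [b] = (P ++ [x, y] ++ (z :: Q)) ++ [q] := by simp [h1.2]
        have := (List.append_inj' h3 rfl).1
        simp [this]
  · rintro ⟨y, hy, rfl⟩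
    obtain ⟨X₁, X₂, rfl⟩ := List.append_of_mem hy
    obtain ⟨P, x, hP⟩ : ∃ P x, a :: X₁ = P ++ [x] := by
      rcases List.eq_nil_or_concat (a :: X₁) with h | ⟨P₀, p, h⟩
      · simp at h
      · exact ⟨P₀, p, by simpa using h⟩
    obtain ⟨z, Q, hQ⟩ := exists_cons_of_append_singleton X₂ b
    have : a :: (X₁ ++ y :: X₂) ++ [b] = P ++ x :: y :: z :: Q := by
      have : a :: (X₁ ++ y :: X₂) ++ [b] = (a :: X₁) ++ y :: (X₂ ++ [b]) := by simp
      rw [this, hP, hQ]; simp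
    exact ⟨P, Q, x, y, z, this, h _ _ _ _ _ this⟩

/-- The edges that belong to vertices outside of the list `X`. -/
theorem Win.iff_thread {G : SimpleGraph V} {A : Finset V} {X : List V} {a b v : V}
    (h : IsThread G A (a :: X ++ [b])) (hA : ∀ x ∈ a :: X ++ [b], x ∈ A ∧ x ≠ v) :
    Win G A v ↔ DW ((A \ X.toFinset).erase v ∪ X.toFinset)
      ({e | ∃ x ∈ A, x ∉ X ∧ e = cnbr G A x ∧ v ∉ e} ∪ pathEdges a X b) := by
  unfold Win
  have e1 : (A \ X.toFinset).erase v ∪ X.toFinset = A.erase v := by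
    ext x
    have := hA x
    simp only [Finset.mem_union, Finset.mem_erase, Finset.mem_sdiff, List.mem_toFinset]
    constructor
    · rintro (h | h)
      · tauto
      · have := this (by simp [h]); tauto
    · tauto
  have e2 : {e | ∃ x ∈ A, x ∉ X ∧ e = cnbr G A x ∧ v ∉ e} ∪ pathEdges a X b = openNbhds G A v := by
    ext e
    rw [Set.mem_union, h.mem_pathEdges_iff]
    constructor
    · rintro (⟨x, hx, -, rfl, hv⟩ | ⟨x, hx, rfl⟩)
      · exact ⟨x, hx, rfl, hv⟩
      · refine ⟨x, (hA x (by simp [hx])).1, rfl, fun hv => ?_⟩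
        have := (h.mem_pathEdges_iff (e := cnbr G A x)).2 ⟨x, hx, rfl⟩
        exact (hA v (subset_of_mem_triples this v hv)).2 rfl
    · rintro ⟨x, hx, rfl, hv⟩
      by_cases hxX : x ∈ X
      · exact Or.inr ⟨x, hxX, rfl⟩
      · exact Or.inl ⟨x, hx, hxX, rfl, hv⟩
  rw [e1, e2]

end Win


/-! ### Shortening a thread by two vertices -/

section Contract

variable {V : Type*} [DecidableEq V]

theorem cnbr_eq_of_adj_iff {G G' : SimpleGraph V} {A A' : Finset V} {x : V} (hA : A' ⊆ A)
    (h : ∀ y ∈ A', G'.Adj x y ↔ G.Adj x y) (hN : cnbr G A x ⊆ A') :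
    cnbr G' A' x = cnbr G A x := by
  ext y
  constructor
  · intro hy
    rw [mem_cnbr] at hy ⊢
    exact ⟨hA hy.1, hy.2.imp_right (h y hy.1).1⟩
  · intro hy
    have hy' := hN hy
    rw [mem_cnbr] at hy ⊢
    exact ⟨hy', hy.2.imp_right (h y hy').2⟩

/-- Two inner vertices of a thread are replaced by an edge. -/
structure Contraction (G G' : SimpleGraph V) (W : Finset V) (v a : V) (A : List V) (p u w q : V)
    (B : List V) (b : V) : Prop where
  nodup : (a :: A ++ [p, u, w, q] ++ (B ++ [b])).Nodup
  thread : IsThread G W (a :: A ++ [p, u, w, q] ++ (B ++ [b]))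
  mem : ∀ x ∈ a :: A ++ [p, u, w, q] ++ (B ++ [b]), x ∈ W ∧ x ≠ v
  adj : ∀ x ∈ W \ {u, w}, ∀ y ∈ W \ {u, w},
    G'.Adj x y ↔ G.Adj x y ∨ (x = p ∧ y = q) ∨ (x = q ∧ y = p)

variable {G G' : SimpleGraph V} {W : Finset V} {v a p u w q b : V} {A B : List V}

/-- In its closed neighbourhood `p` exchanges `u` for `q`. The corresponding fact for `q` follows by
reversal. -/
theorem Contraction.cnbr_left (h : Contraction G G' W v a A p u w q B b) {x : V}
    (hN : cnbr G W p = {x, p, u}) (hxu : x ≠ u) (hxw : x ≠ w) :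
    cnbr G' (W \ {u, w}) p = {x, p, q} := by
  have hnd := h.nodup
  simp only [List.nodup_append, List.nodup_cons, List.mem_cons, List.not_mem_nil, List.mem_append] at hnd
  have hp := h.mem p (by simp)
  have hq := h.mem q (by simp)
  have hpuw : p ≠ u ∧ p ≠ w ∧ p ≠ q ∧ u ≠ q ∧ w ≠ q := by grind
  clear hnd
  have hN' : ∀ y, y ∈ cnbr G W p ↔ y = x ∨ y = p ∨ y = u := by simp [hN]
  ext y
  have h1 := hN' y
  have hpm : p ∈ W \ {u, w} := by simp [hp, hpuw]
  have h3 := h.adj p hpm y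
  have h4 := hN' x
  rw [mem_cnbr] at h1 h4 ⊢
  simp only [Finset.mem_sdiff, Finset.mem_insert, Finset.mem_singleton] at h3 ⊢
  constructor
  · rintro ⟨hy, hyp⟩
    rcases hyp with hyp | hyp
    · simp [hyp]
    · rcases (h3 hy).1 hyp with h5 | h5 | h5
      · rcases h1.1 ⟨hy.1, Or.inr h5⟩ with h6 | h6 | h6
        · exact Or.inl h6
        · exact Or.inr (Or.inl h6)
        · exact absurd (Or.inl h6) hy.2
      · exact Or.inr (Or.inr h5.2)
      · exact absurd h5.1 hpuw.2.2.1
  · rintro (rfl | rfl | rfl)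
    · have h5 := h4.2 (Or.inl rfl)
      have h6 : y ∈ W ∧ ¬ (y = u ∨ y = w) := ⟨h5.1, not_or.2 ⟨hxu, hxw⟩⟩
      exact ⟨h6, h5.2.imp_right fun h7 => (h3 h6).2 (Or.inl h7)⟩
    · exact ⟨⟨hp.1, not_or.2 ⟨hpuw.1, hpuw.2.1⟩⟩, Or.inl rfl⟩
    · have h6 : y ∈ W ∧ ¬ (y = u ∨ y = w) := ⟨hq.1, by
        rintro (h7 | h7)
        · exact hpuw.2.2.2.1 h7.symm
        · exact hpuw.2.2.2.2 h7.symm⟩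
      exact ⟨h6, Or.inr ((h3 h6).2 (Or.inr (Or.inl ⟨trivial, rfl⟩)))⟩

theorem IsThread.reverse {L : List V} (h : IsThread G W L) : IsThread G W L.reverse := by
  intro P x y z Q hL
  have := h Q.reverse z y x P.reverse (by
    rw [← List.reverse_reverse L, hL]; simp)
  rw [this]
  ext t; simp; tauto

theorem Contraction.reverse (h : Contraction G G' W v a A p u w q B b) :
    Contraction G G' W v b B.reverse q w u p A.reverse a := by
  have e : b :: B.reverse ++ [q, w, u, p] ++ (A.reverse ++ [a]) =
      (a :: A ++ [p, u, w, q] ++ (B ++ [b])).reverse := by simp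
  have e2 : ({w, u} : Finset V) = {u, w} := Finset.pair_comm _ _
  refine ⟨e ▸ List.nodup_reverse.2 h.nodup, e ▸ h.thread.reverse,
    fun x hx => h.mem x (by rw [e] at hx; exact List.mem_reverse.1 hx), ?_⟩
  rw [e2]
  intro x hx y hy
  rw [h.adj x hx y hy]
  tauto

theorem Contraction.cnbr_of_ne (h : Contraction G G' W v a A p u w q B b) {x : V}
    (hx : x ∈ W) (hxp : x ≠ p) (hxq : x ≠ q) (hu : u ∉ cnbr G W x) (hw : w ∉ cnbr G W x) :
    cnbr G' (W \ {u, w}) x = cnbr G W x := by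
  have hxu : x ≠ u := by rintro rfl; exact hu (by simp [mem_cnbr, hx])
  have hxw : x ≠ w := by rintro rfl; exact hw (by simp [mem_cnbr, hx])
  refine cnbr_eq_of_adj_iff Finset.sdiff_subset (fun y hy => ?_) fun y hy => ?_
  · rw [h.adj x (by simp [hx, hxu, hxw]) y hy]; tauto
  · simp only [Finset.mem_sdiff, Finset.mem_insert, Finset.mem_singleton, not_or]
    exact ⟨(mem_cnbr.1 hy).1, fun h => hu (h ▸ hy), fun h => hw (h ▸ hy)⟩

/-- Triples centred away from the new edge are inherited; those centred at `p` and `q` come from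
`Contraction.cnbr_left` and its mirror image. -/
theorem Contraction.isThread (h : Contraction G G' W v a A p u w q B b) :
    IsThread G' (W \ {u, w}) (a :: A ++ [p, q] ++ (B ++ [b])) := by
  have key : ∀ P x y z Q, a :: A ++ [p, u, w, q] ++ (B ++ [b]) = P ++ x :: y :: z :: Q →
      x ≠ u → x ≠ w → y ≠ p → y ≠ q → y ≠ u → y ≠ w → z ≠ u → z ≠ w →
      cnbr G' (W \ {u, w}) y = {x, y, z} := by
    intro P x y z Q hL h1 h2 h3 h4 h5 h6 h7 h8
    have hN := h.thread P x y z Q hL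
    rw [← hN]
    refine h.cnbr_of_ne (h.mem y (by rw [hL]; simp)).1 h3 h4 ?_ ?_ <;> rw [hN] <;> simp <;> tauto
  have hnd := h.nodup
  simp only [List.nodup_append, List.nodup_cons, List.mem_cons, List.not_mem_nil, List.mem_append] at hnd
  intro P x y z Q hL
  rw [List.append_assoc] at hL
  rcases List.append_eq_append_iff.1 hL with ⟨t, h1, h2⟩ | ⟨t, h1, h2⟩
  · -- the triple starts after `a :: A`
    rcases t with _ | ⟨t0, _ | ⟨t1, t⟩⟩
    · obtain ⟨P', x', hP⟩ : ∃ P' x', a :: A = P' ++ [x'] := by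
        rcases List.eq_nil_or_concat (a :: A) with h | ⟨P₀, p, h⟩
        · simp at h
        · exact ⟨P₀, p, by simpa using h⟩
      simp only [List.cons_append, List.nil_append, List.cons.injEq] at h2
      obtain ⟨rfl, rfl, h2⟩ := h2
      have hN := h.thread (a :: A ++ [p, u]) w q z Q (by simp [h2])
      have hz : z = b ∨ z ∈ B := by
        have : z ∈ B ++ [b] := by rw [h2]; simp
        simpa [or_comm] using this
      have := h.reverse.cnbr_left (x := z) (by rw [hN]; ext; simp; tauto) (by grind) (by grind)
      rw [Finset.pair_comm, this]; ext; simp; tauto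
    · simp only [List.cons_append, List.nil_append, List.cons.injEq] at h2
      obtain ⟨rfl, rfl, h2⟩ := h2
      have : y ∈ B ++ [b] := by rw [h2]; simp
      have : z ∈ B ++ [b] := by rw [h2]; simp
      refine key (a :: A ++ [p, u, w]) q y z Q (by simp [h2]) ?_ ?_ ?_ ?_ ?_ ?_ ?_ ?_ <;> grind
    · simp only [List.cons_append, List.nil_append, List.cons.injEq] at h2
      obtain ⟨rfl, rfl, h2⟩ := h2
      have : x ∈ B ++ [b] := by rw [h2]; simp
      have : y ∈ B ++ [b] := by rw [h2]; simp
      have : z ∈ B ++ [b] := by rw [h2]; simp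
      refine key (a :: A ++ [p, u, w, q] ++ t) x y z Q (by simp [h2]) ?_ ?_ ?_ ?_ ?_ ?_ ?_ ?_ <;> grind
  · rcases t with _ | ⟨t0, _ | ⟨t1, _ | ⟨t2, t⟩⟩⟩
    · obtain ⟨P', x', hP⟩ : ∃ P' x', a :: A = P' ++ [x'] := by
        rcases List.eq_nil_or_concat (a :: A) with h | ⟨P₀, p, h⟩
        · simp at h
        · exact ⟨P₀, p, by simpa using h⟩
      simp only [List.cons_append, List.nil_append, List.cons.injEq] at h2
      obtain ⟨rfl, rfl, h2⟩ := h2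
      have hN := h.thread (a :: A ++ [x, u]) w y z Q (by simp [h2])
      have hz : z = b ∨ z ∈ B := by
        have : z ∈ B ++ [b] := by rw [← h2]; simp
        simpa [or_comm] using this
      have := h.reverse.cnbr_left (x := z) (by rw [hN]; ext; simp; tauto) (by grind) (by grind)
      rw [Finset.pair_comm, this]; ext; simp; tauto
    · simp only [List.cons_append, List.nil_append, List.cons.injEq] at h2
      obtain ⟨rfl, rfl, rfl, h2⟩ := h2
      have hN := h.thread P x y u (w :: z :: (B ++ [b])) (by rw [h1]; simp)
      have hx : x = a ∨ x ∈ A := by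
        have : x ∈ a :: A := by rw [h1]; simp
        simpa using this
      exact h.cnbr_left hN (by grind) (by grind)
    · simp only [List.cons_append, List.nil_append, List.cons.injEq] at h2
      obtain ⟨rfl, rfl, rfl, h2⟩ := h2
      have : x ∈ a :: A := by rw [h1]; simp
      have : y ∈ a :: A := by rw [h1]; simp
      refine key P x y z ([u, w, q] ++ (B ++ [b])) (by rw [h1]; simp) ?_ ?_ ?_ ?_ ?_ ?_ ?_ ?_ <;> grind
    · simp only [List.cons_append, List.nil_append, List.cons.injEq] at h2
      obtain ⟨rfl, rfl, rfl, h2⟩ := h2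
      have : x ∈ a :: A := by rw [h1]; simp
      have : y ∈ a :: A := by rw [h1]; simp
      have : z ∈ a :: A := by rw [h1]; simp
      refine key P x y z (t ++ [p, u, w, q] ++ (B ++ [b])) (by rw [h1]; simp) ?_ ?_ ?_ ?_ ?_ ?_ ?_ ?_ <;> grind

-- `A ++ [p]` and `q :: B` are the common parts of two long paths, with the six vertices each that
-- `LongPaths` requires. Their middle parts `[u, w]` and `[]` have the same parity.
set_option maxHeartbeats 400000 in
theorem Contraction.win_iff (h : Contraction G G' W v a A p u w q B b) (hA : 5 ≤ A.length)
    (hB : 5 ≤ B.length) : Win G W v ↔ Win G' (W \ {u, w}) v := by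
  have hnd := h.nodup
  simp only [List.nodup_append, List.nodup_cons, List.mem_cons, List.not_mem_nil, List.mem_append] at hnd
  have e1 : a :: ((A ++ [p]) ++ [u, w] ++ (q :: B)) ++ [b] =
    a :: A ++ [p, u, w, q] ++ (B ++ [b]) := by simp
  have e2 : a :: ((A ++ [p]) ++ [] ++ (q :: B)) ++ [b] =
    a :: A ++ [p, q] ++ (B ++ [b]) := by simp
  have hNu : cnbr G W u = {p, u, w} := h.thread (a :: A) p u w (q :: (B ++ [b])) (by simp)
  have hNw : cnbr G W w = {u, w, q} := h.thread (a :: A ++ [p]) u w q (B ++ [b]) (by simp)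
  have hsymm : ∀ {x y}, x ∈ W → y ∈ cnbr G W x → x ∈ cnbr G W y := by
    intro x y hx hy
    rw [mem_cnbr] at hy ⊢
    exact ⟨hx, hy.2.imp Eq.symm SimpleGraph.Adj.symm⟩
  rw [Win.iff_thread (X := (A ++ [p]) ++ [u, w] ++ (q :: B)) (e1 ▸ h.thread) (e1 ▸ h.mem),
    Win.iff_thread (X := (A ++ [p]) ++ [] ++ (q :: B)) (e2 ▸ h.isThread) (by
      rw [e2]
      intro x hx
      have h1 := h.mem x (by simp at hx ⊢; tauto)
      refine ⟨Finset.mem_sdiff.2 ⟨h1.1, ?_⟩, h1.2⟩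
      simp at hx ⊢
      grind)]
  have eU : ((W \ {u, w}) \ (A ++ [p] ++ [] ++ q :: B).toFinset).erase v =
      (W \ (A ++ [p] ++ [u, w] ++ q :: B).toFinset).erase v := by
    ext x; simp; tauto
  -- A vertex off the path is adjacent to neither `u` nor `w` and does not notice the contraction.
  have eC : {e | ∃ x ∈ W \ {u, w}, x ∉ A ++ [p] ++ [] ++ q :: B ∧ e = cnbr G' (W \ {u, w}) x ∧ v ∉ e} =
      {e | ∃ x ∈ W, x ∉ A ++ [p] ++ [u, w] ++ q :: B ∧ e = cnbr G W x ∧ v ∉ e} := by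
    ext e
    have key : ∀ x ∈ W, x ∉ A ++ [p] ++ [u, w] ++ q :: B →
        cnbr G' (W \ {u, w}) x = cnbr G W x := by
      intro x hx hxX
      simp only [List.mem_append, List.mem_cons, List.not_mem_nil, not_or] at hxX
      refine h.cnbr_of_ne hx (by tauto) (by tauto) (fun hu => ?_) fun hw => ?_
      · have := hsymm hx hu
        rw [hNu] at this; simp at this; tauto
      · have := hsymm hx hw
        rw [hNw] at this; simp at this; tauto
    constructor
    · rintro ⟨x, hx, hxX, rfl, hv⟩
      simp only [Finset.mem_sdiff, Finset.mem_insert, Finset.mem_singleton, not_or] at hx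
      have hxX' : x ∉ A ++ [p] ++ [u, w] ++ q :: B := by simp at hxX ⊢; tauto
      rw [key x hx.1 hxX'] at hv ⊢
      exact ⟨x, hx.1, hxX', rfl, hv⟩
    · rintro ⟨x, hx, hxX, rfl, hv⟩
      rw [← key x hx hxX] at hv ⊢
      simp only [List.mem_append, List.mem_cons, List.not_mem_nil, not_or] at hxX
      exact ⟨x, by simp; tauto, by simp; tauto, rfl, hv⟩
  rw [eU, eC]
  -- Stated for both orders of the middle parts, so that it gives the two directions of the
  -- equivalence.
  have hsame : ∀ M M' : List V, M ++ M' = [u, w] → M.length % 2 = M'.length % 2 →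
      LongPaths ((W \ (A ++ [p] ++ [u, w] ++ q :: B).toFinset).erase v)
        {e | ∃ x ∈ W, x ∉ A ++ [p] ++ [u, w] ++ q :: B ∧ e = cnbr G W x ∧ v ∉ e} a (A ++ [p]) M M'
        (q :: B) b := by
    intro M M' hM hpar
    have e3 : A ++ [p] ++ M ++ M' ++ q :: B = A ++ [p] ++ [u, w] ++ q :: B := by
      rw [← hM]; simp
    refine ⟨?_, by simp; omega, by simp; omega, hpar, ?_, ?_⟩
    · rw [e3, e1]; exact h.nodup
    · intro x hx
      rw [e3] at hx
      simp only [Finset.mem_erase, Finset.mem_sdiff, List.mem_toFinset, not_and, not_not]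
      exact fun _ _ => hx
    · rintro e ⟨x, hx, hxX, rfl, hv⟩ y hy hyx
      rw [e3] at hy
      have hxy := hsymm hx hyx
      -- `y` is an inner vertex, so that `x` is one of its two neighbours
      obtain ⟨X₁, X₂, hX⟩ := List.append_of_mem hy
      obtain ⟨P, x₁, hP⟩ : ∃ P x, a :: X₁ = P ++ [x] := by
        rcases List.eq_nil_or_concat (a :: X₁) with h | ⟨P₀, p, h⟩
        · simp at h
        · exact ⟨P₀, p, by simpa using h⟩
      obtain ⟨z, Q, hQ⟩ := exists_cons_of_append_singleton X₂ b
      have e4 : a :: A ++ [p, u, w, q] ++ (B ++ [b]) = P ++ x₁ :: y :: z :: Q := by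
        rw [← e1, hX]
        have : a :: (X₁ ++ y :: X₂) ++ [b] = (a :: X₁) ++ y :: (X₂ ++ [b]) := by simp
        rw [this, hP, hQ]; simp
      rw [h.thread _ _ _ _ _ e4] at hxy
      simp only [Finset.mem_insert, Finset.mem_singleton] at hxy
      have hself : x ∈ cnbr G W x := by simp [mem_cnbr, hx]
      rcases hxy with rfl | rfl | rfl
      · rcases X₁ with _ | ⟨x₂, X₁⟩
        · left
          obtain ⟨-, rfl⟩ : P = [] ∧ a = x := by
            rcases P with _ | ⟨_, _⟩ <;> simp_all
          refine ⟨?_, hself⟩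
          rcases A with _ | ⟨a', A⟩
          · simp at hA
          · simp at hX ⊢; exact hX.1
        · exfalso
          apply hxX
          have : x ∈ x₂ :: X₁ := by
            rcases P with _ | ⟨_, P⟩
            · simp at hP
            · simp at hP; simp [hP.2]
          rw [hX]; exact List.mem_append_left _ this
      · exact absurd hy hxX
      · rcases List.eq_nil_or_concat X₂ with rfl | ⟨X₂, x₂, rfl⟩
        · right
          simp at hQ
          obtain ⟨rfl, -⟩ := hQ
          refine ⟨?_, hself⟩
          rcases List.eq_nil_or_concat B with rfl | ⟨B, b', rfl⟩
          · simp at hB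
          · have h5 : (A ++ [p] ++ [u, w] ++ q :: B) ++ [b'] = X₁ ++ [y] := by
              simpa using hX
            have := (List.append_inj' h5 rfl).2
            simp at this ⊢
            simp [List.getLast?_cons, this]
        · exfalso
          apply hxX
          have : x ∈ X₂.concat x₂ := by
            rcases X₂ with _ | ⟨x₃, X₂⟩
            · simp at hQ ⊢; exact hQ.1.symm
            · simp at hQ ⊢; simp [hQ.1]
          rw [hX]; exact List.mem_append_right _ (List.mem_cons_of_mem _ this)
  exact ⟨(hsame [u, w] [] rfl (by simp)).transfer _ rfl, (hsame [] [u, w] rfl (by simp)).transfer _ rfl⟩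

end Contract


/-! ### Feedback edge sets -/

section FeedbackEdges

variable {V W : Type*} [DecidableEq V] [DecidableEq W]

/-- The edges of `G` between vertices of `A`. -/
def res (G : SimpleGraph V) (A : Finset V) : SimpleGraph V where
  Adj x y := x ∈ A ∧ y ∈ A ∧ G.Adj x y
  symm := ⟨fun _ _ h => ⟨h.2.1, h.1, h.2.2.symm⟩⟩
  loopless := ⟨fun _ h => h.2.2.ne rfl⟩

/-- Deleting `k` edges turns `G[A]` into a forest. -/
def FeedbackLE (G : SimpleGraph V) (A : Finset V) (k : ℕ) : Prop :=
  ∃ F : Finset (Sym2 V), F.card ≤ k ∧ ((res G A).deleteEdges (F : Set (Sym2 V))).IsAcyclic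

/-- The edges that `g` sends into `F` are deleted. Acyclicity is carried back in terms of bridges: a
walk that bypasses an edge would be mapped to a walk that bypasses its image. -/
theorem FeedbackLE.map {G : SimpleGraph V} {G' : SimpleGraph W} {A : Finset V} {A' : Finset W}
    {k : ℕ} (h : FeedbackLE G A k) (g : W → V) (hg : Set.InjOn g A') (hA : ∀ x ∈ A', g x ∈ A)
    (hG : ∀ x ∈ A', ∀ y ∈ A', G'.Adj x y → G.Adj (g x) (g y)) : FeedbackLE G' A' k := by
  classical
  obtain ⟨F, hF, hac⟩ := h
  have hinj : ∀ a ∈ A', ∀ b ∈ A', ∀ x ∈ A', ∀ y ∈ A', s(g a, g b) = s(g x, g y) →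
      s(a, b) = s(x, y) := by
    intro a ha b hb x hx y hy h
    rw [Sym2.eq_iff] at h ⊢
    exact h.imp (fun h => ⟨hg ha hx h.1, hg hb hy h.2⟩) fun h => ⟨hg ha hy h.1, hg hb hx h.2⟩
  refine ⟨A'.sym2.filter fun e => Sym2.map g e ∈ F, (Finset.card_le_card_of_injOn (Sym2.map g)
    (fun e he => (Finset.mem_filter.1 he).2) ?_).trans hF, ?_⟩
  · intro e he e' he' hee
    have h1 := (Finset.mem_filter.1 (Finset.mem_coe.1 he)).1
    have h2 := (Finset.mem_filter.1 (Finset.mem_coe.1 he')).1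
    induction e with | _ a b
    induction e' with | _ x y
    rw [Finset.mk_mem_sym2_iff] at h1 h2
    exact hinj a h1.1 b h1.2 x h2.1 y h2.2 hee
  · rw [SimpleGraph.isAcyclic_iff_forall_adj_isBridge] at hac ⊢
    have hom : ∀ {a b}, ((res G' A').deleteEdges
        ((A'.sym2.filter fun e => Sym2.map g e ∈ F : Finset _) : Set (Sym2 W))).Adj a b →
        ((res G A).deleteEdges (F : Set (Sym2 V))).Adj (g a) (g b) := by
      intro a b hab
      rw [SimpleGraph.deleteEdges_adj] at hab ⊢
      obtain ⟨⟨ha, hb, hab⟩, hnot⟩ := hab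
      refine ⟨⟨hA a ha, hA b hb, hG a ha b hb hab⟩, fun h => hnot ?_⟩
      rw [Finset.mem_coe, Finset.mem_filter, Finset.mk_mem_sym2_iff]
      exact ⟨⟨ha, hb⟩, h⟩
    intro x y hxy
    have h1 := hac (hom hxy)
    rw [SimpleGraph.deleteEdges_adj] at hxy
    rw [SimpleGraph.isBridge_iff] at h1 ⊢
    intro hr
    refine h1 (hr.map ⟨g, ?_⟩)
    intro a b hab
    rw [SimpleGraph.deleteEdges_adj] at hab ⊢
    refine ⟨hom hab.1, fun h => hab.2 ?_⟩
    rw [SimpleGraph.deleteEdges_adj] at hab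
    exact hinj a hab.1.1.1 b hab.1.1.2.1 x hxy.1.1 y hxy.1.2.1 h

theorem FeedbackLE.mono {G : SimpleGraph V} {A A' : Finset V} {k : ℕ} (h : FeedbackLE G A k)
    (hA : A' ⊆ A) : FeedbackLE G A' k :=
  h.map id (Set.injOn_id _) hA fun _ _ _ _ h => h

/-- `FeedbackLE` does not ask that `F` consist of edges of the graph. Intersecting with the edge set
repairs this without increasing the size. -/
theorem feedbackEdgeNumber_le_iff [Fintype V] {G : SimpleGraph V} {k : ℕ} :
    feedbackEdgeNumber G ≤ k ↔ FeedbackLE G Finset.univ k := by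
  classical
  have hres : res G Finset.univ = G := by
    ext x y
    simp [res]
  unfold feedbackEdgeNumber FeedbackLE
  rw [hres]
  constructor
  · intro h
    have hne : {k | ∃ F : Finset (Sym2 V), (F : Set (Sym2 V)) ⊆ G.edgeSet ∧
        (G.deleteEdges (F : Set (Sym2 V))).IsAcyclic ∧ F.card = k}.Nonempty := by
      refine ⟨_, G.edgeFinset, by simp, ?_, rfl⟩
      have : G.deleteEdges (G.edgeFinset : Set (Sym2 V)) = ⊥ := by
        ext x y; simp
      rw [this]
      exact SimpleGraph.isAcyclic_bot
    obtain ⟨F, -, h2, h3⟩ := Nat.sInf_mem hne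
    exact ⟨F, h3 ▸ h, h2⟩
  · rintro ⟨F, hF, hac⟩
    refine le_trans (Nat.sInf_le (m := (F ∩ G.edgeFinset).card) ?_)
      ((Finset.card_le_card Finset.inter_subset_left).trans hF)
    refine ⟨F ∩ G.edgeFinset, by simp, hac.anti ?_, rfl⟩
    intro x y
    simp only [SimpleGraph.deleteEdges_adj, Finset.coe_inter, SimpleGraph.coe_edgeFinset,
      Set.mem_inter_iff, SimpleGraph.mem_edgeSet, not_and]
    tauto

/-- If the feedback set has an edge at `u` or `w`, that edge is replaced by the new edge between `p`
and `q`. If not, the path through `u` and `w` is the only path from `p` to `q` in the forest.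
Deleting `u` and `w` then separates `p` from `q`, and the new edge closes no cycle. -/
theorem Contraction.feedbackLE {G G' : SimpleGraph V} {A₀ : Finset V} {v a p u w q b : V}
    {A B : List V} {k : ℕ} (h : Contraction G G' A₀ v a A p u w q B b) (hk : FeedbackLE G A₀ k) :
    FeedbackLE G' (A₀ \ {u, w}) k := by
  classical
  obtain ⟨F, hF, hac⟩ := hk
  have hnd := h.nodup
  simp only [List.nodup_append, List.nodup_cons, List.mem_cons, List.not_mem_nil, List.mem_append]
    at hnd
  have hne : p ≠ u ∧ p ≠ w ∧ p ≠ q ∧ u ≠ w ∧ u ≠ q ∧ w ≠ q := by grind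
  clear hnd
  have hNu : cnbr G A₀ u = {p, u, w} := h.thread (a :: A) p u w (q :: (B ++ [b])) (by simp)
  have hNw : cnbr G A₀ w = {u, w, q} := h.thread (a :: A ++ [p]) u w q (B ++ [b]) (by simp)
  have hpu : (res G A₀).Adj p u := by
    have : p ∈ cnbr G A₀ u := by simp [hNu]
    have := mem_cnbr.1 this
    exact ⟨(h.mem p (by simp)).1, (h.mem u (by simp)).1, (this.2.resolve_left hne.1).symm⟩
  have huw : (res G A₀).Adj u w := by
    have : w ∈ cnbr G A₀ u := by simp [hNu]
    have := mem_cnbr.1 this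
    exact ⟨(h.mem u (by simp)).1, (h.mem w (by simp)).1, this.2.resolve_left hne.2.2.2.1.symm⟩
  have hwq : (res G A₀).Adj w q := by
    have : q ∈ cnbr G A₀ w := by simp [hNw]
    have := mem_cnbr.1 this
    exact ⟨(h.mem w (by simp)).1, (h.mem q (by simp)).1, this.2.resolve_left hne.2.2.2.2.2.symm⟩
  have hp' : p ∈ A₀ \ {u, w} := by simp [(h.mem p (by simp)).1, hne]
  by_cases hcase : ∃ e ∈ F, u ∈ e ∨ w ∈ e
  · obtain ⟨e, he, hue⟩ := hcase
    refine ⟨insert s(p, q) (F.erase e), ?_, hac.anti ?_⟩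
    · have := Finset.card_insert_le s(p, q) (F.erase e)
      rw [Finset.card_erase_of_mem he] at this
      have := Finset.card_pos.2 ⟨e, he⟩
      omega
    · intro x y
      simp only [SimpleGraph.deleteEdges_adj, Finset.coe_insert, Finset.coe_erase,
        Set.mem_insert_iff, Set.mem_sdiff, Finset.mem_coe, Set.mem_singleton_iff, not_or, not_and,
        not_not]
      rintro ⟨⟨hx, hy, hxy⟩, h1, h2⟩
      have hx' := Finset.mem_sdiff.1 hx
      have hy' := Finset.mem_sdiff.1 hy
      refine ⟨⟨hx'.1, hy'.1, ?_⟩, fun h3 => ?_⟩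
      · rcases (h.adj x hx y hy).1 hxy with h4 | h4 | h4
        · exact h4
        · exact absurd (by rw [h4.1, h4.2]) h1
        · exact absurd (by rw [h4.1, h4.2, Sym2.eq_swap]) h1
      · have := h2 h3
        subst this
        simp only [Sym2.mem_iff, Finset.mem_insert, Finset.mem_singleton] at hue hx' hy'
        rcases hue with (rfl | rfl) | (rfl | rfl) <;> simp at hx' hy'
  · push Not at hcase
    refine ⟨F, hF, ?_⟩
    have hle : (res G (A₀ \ {u, w})).deleteEdges (F : Set (Sym2 V)) ≤
        (res G A₀).deleteEdges (F : Set (Sym2 V)) := by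
      intro x y
      simp only [SimpleGraph.deleteEdges_adj]
      rintro ⟨⟨hx, hy, hxy⟩, h1⟩
      exact ⟨⟨(Finset.mem_sdiff.1 hx).1, (Finset.mem_sdiff.1 hy).1, hxy⟩, h1⟩
    have hnr : ¬ ((res G (A₀ \ {u, w})).deleteEdges (F : Set (Sym2 V))).Reachable p q := by
      intro hr
      obtain ⟨P, hP⟩ := hr.exists_isPath
      have hsup : ∀ {x y : V} (P : ((res G (A₀ \ {u, w})).deleteEdges
          (F : Set (Sym2 V))).Walk x y), x ∈ A₀ \ {u, w} → ∀ z ∈ P.support, z ∈ A₀ \ {u, w} := by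
        intro x y P
        induction P with
        | nil => intro hx z hz; simp at hz; exact hz ▸ hx
        | cons hadj P ih =>
          intro hx z hz
          rw [SimpleGraph.Walk.support_cons, List.mem_cons] at hz
          rcases hz with rfl | hz
          · exact hx
          · exact ih ((SimpleGraph.deleteEdges_adj.1 hadj).1.2.1) z hz
      have a1 : ((res G A₀).deleteEdges (F : Set (Sym2 V))).Adj p u :=
        SimpleGraph.deleteEdges_adj.2 ⟨hpu, fun h => (hcase _ h).1 (by simp)⟩
      have a2 : ((res G A₀).deleteEdges (F : Set (Sym2 V))).Adj u w :=
        SimpleGraph.deleteEdges_adj.2 ⟨huw, fun h => (hcase _ h).1 (by simp)⟩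
      have a3 : ((res G A₀).deleteEdges (F : Set (Sym2 V))).Adj w q :=
        SimpleGraph.deleteEdges_adj.2 ⟨hwq, fun h => (hcase _ h).2 (by simp)⟩
      let Q := SimpleGraph.Walk.cons a1 (SimpleGraph.Walk.cons a2
        (SimpleGraph.Walk.cons a3 SimpleGraph.Walk.nil))
      have hQ : Q.IsPath := by
        simp [Q, SimpleGraph.Walk.cons_isPath_iff]
        tauto
      have hu : u ∈ (P.mapLe hle).support := by
        have h1 := (hac.subsingleton_path p q).elim ⟨P.mapLe hle, hP.mapLe hle⟩ ⟨Q, hQ⟩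
        have h2 : P.mapLe hle = Q := congrArg Subtype.val h1
        rw [h2]
        simp [Q]
      have hu' : u ∈ P.support := by simpa using hu
      have := hsup P hp' u hu'
      simp at this
    refine ((hac.anti hle).sup_edge_of_not_reachable hnr).anti ?_
    intro x y
    simp only [SimpleGraph.deleteEdges_adj, SimpleGraph.sup_adj, SimpleGraph.edge_adj]
    rintro ⟨⟨hx, hy, hxy⟩, h1⟩
    rcases (h.adj x hx y hy).1 hxy with h2 | h2 | h2
    · exact Or.inl ⟨⟨hx, hy, h2⟩, h1⟩
    · exact Or.inr ⟨by tauto, by rw [h2.1, h2.2]; exact hne.2.2.1⟩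
    · exact Or.inr ⟨by tauto, by rw [h2.1, h2.2]; exact hne.2.2.1.symm⟩

open Classical in
/-- The neighbours of `x` in `G[A]`. -/
noncomputable def nbrs (G : SimpleGraph V) (A : Finset V) (x : V) : Finset V :=
  {y ∈ A | G.Adj x y}

theorem mem_nbrs {G : SimpleGraph V} {A : Finset V} {x y : V} :
    y ∈ nbrs G A x ↔ y ∈ A ∧ G.Adj x y := by
  simp [nbrs]

/-- A forest on a nonempty set `C` of vertices has fewer than `|C|` edges. -/
theorem sum_degree_le_of_isAcyclic {H : SimpleGraph V} (hH : H.IsAcyclic) {C : Finset V}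
    (hC : C.Nonempty) : ∑ x ∈ C, (nbrs H C x).card + 2 ≤ 2 * C.card := by
  classical
  have h1 : (H.induce (C : Set V)).IsAcyclic := hH.induce _
  have : Nonempty (C : Set V) := hC.to_subtype
  -- The forest induced on `C` is extended to a spanning tree of the complete graph on `C`, whose
  -- number of edges is known exactly.
  obtain ⟨T, hT, -, hT2⟩ := (SimpleGraph.connected_top (V := (C : Set V))).exists_isTree_le_of_le_of_isAcyclic
    le_top h1
  have h2 := hT2.card_edgeFinset
  have h3 := T.sum_degrees_eq_twice_card_edges
  have h4 : Fintype.card (C : Set V) = C.card := by simp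
  have h5 : ∑ x ∈ C, (nbrs H C x).card ≤ ∑ x : (C : Set V), T.degree x := by
    rw [← Finset.sum_coe_sort C]
    refine Finset.sum_le_sum fun x _ => ?_
    rw [← SimpleGraph.card_neighborFinset_eq_degree]
    refine (Finset.card_le_card (t := (T.neighborFinset x).image Subtype.val) ?_).trans
      Finset.card_image_le
    intro y hy
    obtain ⟨hy, hxy⟩ := mem_nbrs.1 hy
    refine Finset.mem_image.2 ⟨⟨y, hy⟩, ?_, rfl⟩
    rw [SimpleGraph.mem_neighborFinset]
    exact hT hxy
  omega

end FeedbackEdges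


/-! ### The size of reduced graphs -/

section Counting

variable {V : Type*} [DecidableEq V]

theorem cnbr_eq_insert {G : SimpleGraph V} {A : Finset V} {x : V} (hx : x ∈ A) :
    cnbr G A x = insert x (nbrs G A x) := by
  ext y
  rw [Finset.mem_insert, mem_cnbr, mem_nbrs]
  constructor
  · tauto
  · rintro (rfl | h)
    · exact ⟨hx, Or.inl rfl⟩
    · tauto

theorem card_cnbr {G : SimpleGraph V} {A : Finset V} {x : V} (hx : x ∈ A) :
    (cnbr G A x).card = (nbrs G A x).card + 1 := by
  rw [cnbr_eq_insert hx, Finset.card_insert_of_notMem]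
  simp [mem_nbrs]

-- The forest contributes at most `2 * A.card` to the degree sum, and every edge of `F` at most two
-- more, one at each end.
open Classical in
theorem sum_card_nbrs_le {G : SimpleGraph V} {A : Finset V} {F : Finset (Sym2 V)} {k : ℕ}
    (hF : F.card ≤ k) (hac : ((res G A).deleteEdges (F : Set (Sym2 V))).IsAcyclic) :
    ∑ x ∈ A, (nbrs G A x).card ≤ 2 * A.card + 2 * k := by
  rcases A.eq_empty_or_nonempty with rfl | hA
  · simp
  have h1 := sum_degree_le_of_isAcyclic hac hA
  have h2 : ∀ x ∈ A, (nbrs G A x).card ≤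
      (nbrs ((res G A).deleteEdges (F : Set (Sym2 V))) A x).card +
      {y ∈ A | s(x, y) ∈ F}.card := by
    intro x hx
    refine le_trans (Finset.card_le_card ?_) (Finset.card_union_le _ _)
    intro y hy
    rw [mem_nbrs] at hy
    simp only [Finset.mem_union, Finset.mem_filter, mem_nbrs, SimpleGraph.deleteEdges_adj, Finset.mem_coe]
    by_cases h : s(x, y) ∈ F
    · exact Or.inr ⟨hy.1, h⟩
    · exact Or.inl ⟨hy.1, ⟨hx, hy.1, hy.2⟩, h⟩
  have h3 := Finset.sum_le_sum h2
  rw [Finset.sum_add_distrib] at h3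
  have h4 : ∑ x ∈ A, {y ∈ A | s(x, y) ∈ F}.card ≤ 2 * F.card := by
    rw [← Finset.card_sigma]
    have hmaps : ∀ p ∈ A.sigma fun x => {y ∈ A | s(x, y) ∈ F}, s(p.1, p.2) ∈ F :=
      fun p hp => (Finset.mem_filter.1 (Finset.mem_sigma.1 hp).2).2
    refine Finset.card_le_mul_card_image_of_maps_to hmaps 2 ?_
    intro e _
    induction e with | _ a b
    refine (Finset.card_le_card (t := {⟨a, b⟩, ⟨b, a⟩}) ?_).trans Finset.card_le_two
    rintro ⟨x, y⟩ hp
    have := (Finset.mem_filter.1 hp).2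
    rw [Sym2.eq_iff] at this
    rcases this with ⟨rfl, rfl⟩ | ⟨rfl, rfl⟩ <;> simp
  omega

open Classical in
/-- The vertices at distance at most `t` from `X`. -/
noncomputable def ball (G : SimpleGraph V) (A X : Finset V) : ℕ → Finset V
  | 0 => X
  | t + 1 => ball G A X t ∪ {y ∈ A | ∃ x ∈ ball G A X t, G.Adj x y}

variable {G : SimpleGraph V} {A X : Finset V}

theorem mem_ball_succ {t : ℕ} {y : V} :
    y ∈ ball G A X (t + 1) ↔ y ∈ ball G A X t ∨ y ∈ A ∧ ∃ x ∈ ball G A X t, G.Adj x y := by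
  simp [ball]

theorem ball_mono {s t : ℕ} (h : s ≤ t) : ball G A X s ⊆ ball G A X t := by
  induction t, h using Nat.le_induction with
  | base => exact subset_rfl
  | succ t _ ih => exact fun y hy => mem_ball_succ.2 (Or.inl (ih hy))

theorem ball_subset (hX : X ⊆ A) : ∀ t, ball G A X t ⊆ A
  | 0 => hX
  | t + 1 => fun _ hy => (mem_ball_succ.1 hy).elim (fun h => ball_subset hX t h) fun h => h.1

/-- The vertices at distance `t + 1` from `X`. -/
noncomputable def layer (G : SimpleGraph V) (A X : Finset V) (t : ℕ) : Finset V :=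
  ball G A X (t + 1) \ ball G A X t

theorem mem_layer {t : ℕ} {y : V} :
    y ∈ layer G A X t ↔ y ∈ ball G A X (t + 1) ∧ y ∉ ball G A X t := by
  simp [layer]

theorem exists_of_mem_layer {t : ℕ} {y : V} (hy : y ∈ layer G A X t) :
    ∃ x ∈ ball G A X t, G.Adj x y := by
  rw [mem_layer, mem_ball_succ] at hy
  tauto

theorem exists_of_mem_layer_succ {t : ℕ} {y : V} (hy : y ∈ layer G A X (t + 1)) (hyA : y ∈ A) :
    ∃ x ∈ layer G A X t, G.Adj x y := by
  obtain ⟨x, hx, hxy⟩ := exists_of_mem_layer hy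
  refine ⟨x, mem_layer.2 ⟨hx, fun h => ?_⟩, hxy⟩
  exact (mem_layer.1 hy).2 (mem_ball_succ.2 (Or.inr ⟨hyA, x, h, hxy⟩))

/-- Every vertex of the next layer has a neighbour in the present one, and no two share it: a vertex
of degree two off `X` uses one of its two neighbours to reach the ball inside. -/
theorem card_layer_succ_le (hX : X ⊆ A) (hdeg : ∀ x ∈ A, x ∉ X → (nbrs G A x).card = 2) (t : ℕ) :
    (layer G A X (t + 1)).card ≤ (layer G A X t).card := by
  have hA : ∀ {t : ℕ} {y : V}, y ∈ layer G A X t → y ∈ A := fun h => ball_subset hX _ (mem_layer.1 h).1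
  have : ∀ y, ∃ x, y ∈ layer G A X (t + 1) → x ∈ layer G A X t ∧ G.Adj x y := by
    intro y
    by_cases hy : y ∈ layer G A X (t + 1)
    · obtain ⟨x, hx⟩ := exists_of_mem_layer_succ hy (hA hy)
      exact ⟨x, fun _ => hx⟩
    · exact ⟨y, fun h => absurd h hy⟩
  choose f hf using this
  refine Finset.card_le_card_of_injOn f (fun y hy => (hf y hy).1) ?_
  intro y hy y' hy' hyy
  obtain ⟨hx, hxy⟩ := hf y hy
  obtain ⟨-, hxy'⟩ := hf y' hy'
  rw [← hyy] at hxy'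
  obtain ⟨z, hz, hzx⟩ := exists_of_mem_layer hx
  by_contra hne
  have hxX : f y ∉ X := fun h => (mem_layer.1 hx).2 (ball_mono (Nat.zero_le t) h)
  have h2 := hdeg _ (hA hx) hxX
  have hzb : z ∈ ball G A X (t + 1) := ball_mono (Nat.le_succ t) hz
  have h3 : ({z, y, y'} : Finset V) ⊆ nbrs G A (f y) := by
    intro w hw
    simp only [Finset.mem_insert, Finset.mem_singleton] at hw
    rw [mem_nbrs]
    rcases hw with rfl | rfl | rfl
    · exact ⟨ball_subset hX _ hz, hzx.symm⟩
    · exact ⟨hA hy, hxy⟩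
    · exact ⟨hA hy', hxy'⟩
  have h4 := Finset.card_le_card h3
  have h5 : ({z, y, y'} : Finset V).card = 3 := by
    refine Finset.card_eq_three.2 ⟨z, y, y', ?_, ?_, hne, rfl⟩
    · rintro rfl; exact (mem_layer.1 hy).2 hzb
    · rintro rfl; exact (mem_layer.1 hy').2 hzb
  omega

/-- The first layer is at most as large as the degree sum over `X`, and the later layers do not
grow. -/
theorem card_ball_le (hX : X ⊆ A) (hdeg : ∀ x ∈ A, x ∉ X → (nbrs G A x).card = 2) (t : ℕ) :
    (ball G A X t).card ≤ X.card + t * ∑ x ∈ X, (nbrs G A x).card := by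
  have h0 : (layer G A X 0).card ≤ ∑ x ∈ X, (nbrs G A x).card := by
    refine (Finset.card_le_card (t := X.biUnion (nbrs G A)) ?_).trans Finset.card_biUnion_le
    intro y hy
    obtain ⟨x, hx, hxy⟩ := exists_of_mem_layer hy
    exact Finset.mem_biUnion.2 ⟨x, hx, mem_nbrs.2 ⟨ball_subset hX _ (mem_layer.1 hy).1, hxy⟩⟩
  have h1 : ∀ t, (layer G A X t).card ≤ ∑ x ∈ X, (nbrs G A x).card := by
    intro t
    induction t with
    | zero => exact h0
    | succ t ih => exact (card_layer_succ_le hX hdeg t).trans ih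
  induction t with
  | zero => simp [ball]
  | succ t ih =>
    have h2 : (ball G A X (t + 1)).card = (ball G A X t).card + (layer G A X t).card := by
      have := Finset.card_sdiff_add_card_eq_card
        (ball_mono (G := G) (A := A) (X := X) (Nat.le_succ t))
      rw [Nat.add_comm (ball G A X t).card]
      exact this.symm
    have := h1 t
    rw [h2]
    linarith

theorem exists_chain_of_mem_layer (hX : X ⊆ A) : ∀ (t : ℕ) (y : V), y ∈ layer G A X t →
    ∃ f : ℕ → V, f t = y ∧ (∀ i ≤ t, f i ∈ layer G A X i) ∧ ∀ i < t, G.Adj (f i) (f (i + 1))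
  | 0, y, hy => ⟨fun _ => y, rfl, fun i hi => by rwa [Nat.le_zero.1 hi], fun i hi => by omega⟩
  | t + 1, y, hy => by
    obtain ⟨x, hx, hxy⟩ := exists_of_mem_layer_succ hy (ball_subset hX _ (mem_layer.1 hy).1)
    obtain ⟨f, h1, h2, h3⟩ := exists_chain_of_mem_layer hX t x hx
    refine ⟨fun i => if i = t + 1 then y else f i, by simp, fun i hi => ?_, fun i hi => ?_⟩
    · by_cases h : i = t + 1
      · simpa [h] using hy
      · simpa [h] using h2 i (by omega)
    · by_cases h : i = t
      · subst h
        simpa [h1] using hxy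
      · have h4 : i ≠ t + 1 := by omega
        simpa [h, h4] using h3 i (by omega)

/-- A vertex far away from `X` yields a long thread. -/
theorem exists_thread_of_mem_layer (hX : X ⊆ A)
    (hdeg : ∀ x ∈ A, x ∉ X → (nbrs G A x).card = 2) {t : ℕ} {y : V} (hy : y ∈ layer G A X t) :
    ∃ l : List V, l.length = t + 1 ∧ l.Nodup ∧ (∀ x ∈ l, x ∈ A ∧ x ∉ X) ∧ IsThread G A l := by
  obtain ⟨f, -, h2, h3⟩ := exists_chain_of_mem_layer hX t y hy
  have hA : ∀ {t : ℕ} {y : V}, y ∈ layer G A X t → y ∈ A := fun h => ball_subset hX _ (mem_layer.1 h).1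
  have hXn : ∀ {t : ℕ} {y : V}, y ∈ layer G A X t → y ∉ X :=
    fun h h' => (mem_layer.1 h).2 (ball_mono (Nat.zero_le _) h')
  have hlt : ∀ i j, i < j → j ≤ t → f i ≠ f j := by
    intro i j hij hj h
    have h4 := (mem_layer.1 (h2 i (by omega))).1
    rw [h] at h4
    exact (mem_layer.1 (h2 j hj)).2 (ball_mono hij h4)
  refine ⟨(List.range (t + 1)).map f, by simp, ?_, ?_, ?_⟩
  · refine (List.nodup_map_iff_inj_on List.nodup_range).2 fun i hi j hj hij => ?_
    rw [List.mem_range] at hi hj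
    rcases lt_trichotomy i j with h | h | h
    · exact absurd hij (hlt i j h (by omega))
    · exact h
    · exact absurd hij.symm (hlt j i h (by omega))
  · intro x hx
    obtain ⟨i, hi, rfl⟩ := List.mem_map.1 hx
    rw [List.mem_range] at hi
    exact ⟨hA (h2 i (by omega)), hXn (h2 i (by omega))⟩
  · intro P x y z Q hL
    have hlen : P.length + 3 ≤ t + 1 := by
      have := congrArg List.length hL
      simp at this
      omega
    have hget : ∀ i : ℕ, ((List.range (t + 1)).map f)[i]? = (P ++ x :: y :: z :: Q)[i]? := fun i => by
      rw [hL]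
    have g0 := hget P.length
    have g1 := hget (P.length + 1)
    have g2 := hget (P.length + 2)
    rw [List.getElem?_append_right (by omega), List.getElem?_map,
      List.getElem?_range (by omega)] at g0
    rw [List.getElem?_append_right (by omega), List.getElem?_map,
      List.getElem?_range (by omega)] at g1
    rw [List.getElem?_append_right (by omega), List.getElem?_map,
      List.getElem?_range (by omega)] at g2
    simp at g0 g1 g2
    have k0 := h2 P.length (by omega)
    have k1 := h2 (P.length + 1) (by omega)
    have k2 := h2 (P.length + 2) (by omega)
    have a0 := h3 P.length (by omega)
    have a1 := h3 (P.length + 1) (by omega)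
    have n0 := hlt P.length (P.length + 1) (by omega) (by omega)
    have n1 := hlt P.length (P.length + 2) (by omega) (by omega)
    have n2 := hlt (P.length + 1) (P.length + 2) (by omega) (by omega)
    have e2 : P.length + 1 + 1 = P.length + 2 := rfl
    rw [e2] at a1
    rw [g0] at k0 a0 n0 n1
    rw [g1] at k1 a0 a1 n0 n2
    rw [g2] at k2 a1 n1 n2
    symm
    -- Predecessor and successor in the chain are two distinct neighbours of a vertex of degree two,
    -- hence all of them.
    refine Finset.eq_of_subset_of_card_le ?_ ?_
    · intro w hw
      simp only [Finset.mem_insert, Finset.mem_singleton] at hw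
      rw [mem_cnbr]
      rcases hw with rfl | rfl | rfl
      · exact ⟨hA k0, Or.inr a0.symm⟩
      · exact ⟨hA k1, Or.inl rfl⟩
      · exact ⟨hA k2, Or.inr a1⟩
    · rw [card_cnbr (hA k1), hdeg _ (hA k1) (hXn k1),
        Finset.card_eq_three.2 ⟨x, y, z, n0, n1, n2, rfl⟩]

open Classical in
/-- If Dominator's vertex is the only one of degree less than `2` and there are no long threads,
then the size of the graph is linear in the feedback edge number. -/
theorem card_le_of_reduced {v : V} {k : ℕ} (hv : v ∈ A)
    (hdeg : ∀ x ∈ A, x ≠ v → 2 ≤ (nbrs G A x).card)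
    (hthread : ∀ l : List V, l.length = 16 → l.Nodup → (∀ x ∈ l, x ∈ A ∧ x ≠ v) →
      ¬ IsThread G A l) (hk : FeedbackLE G A k) :
    A.card ≤ 154 * k + 123 ∧ ∑ x ∈ A, (nbrs G A x).card ≤ 310 * k + 246 := by
  obtain ⟨F, hF, hac⟩ := hk
  have hsum := sum_card_nbrs_le hF hac
  set B := {x ∈ A | 3 ≤ (nbrs G A x).card} with hB
  set Z := {x ∈ A | ∃ e ∈ F, x ∈ e} with hZ
  set X := insert v (B ∪ Z) with hXdef
  have hXA : X ⊆ A := by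
    intro x hx
    simp only [hXdef, hB, hZ, Finset.mem_insert, Finset.mem_union, Finset.mem_filter] at hx
    rcases hx with rfl | hx | hx
    · exact hv
    · exact hx.1
    · exact hx.1
  have hdeg2 : ∀ x ∈ A, x ∉ X → (nbrs G A x).card = 2 := by
    intro x hx hxX
    simp only [hXdef, hB, Finset.mem_insert, Finset.mem_union, Finset.mem_filter, not_or,
      not_and] at hxX
    have h1 := hdeg x hx hxX.1
    have h2 := hxX.2.1 hx
    omega
  have hnoF : ∀ x ∈ A, x ∉ X → ∀ e ∈ F, x ∉ e := by
    intro x hx hxX e he hxe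
    exact hxX (Finset.mem_insert_of_mem (Finset.mem_union_right _
      (Finset.mem_filter.2 ⟨hx, e, he, hxe⟩)))
  -- The summand `2` beyond `2 * k` pays for `v`, the only vertex whose degree may fall below two,
  -- where the subtraction is truncated.
  have hex : ∑ x ∈ A, ((nbrs G A x).card - 2) ≤ 2 * k + 2 := by
    have h1 : ∑ x ∈ A, (((nbrs G A x).card - 2) + 2) ≤
        ∑ x ∈ A, ((nbrs G A x).card + if x = v then 2 else 0) := by
      refine Finset.sum_le_sum fun x hx => ?_
      split_ifs with h
      · omega
      · have := hdeg x hx h; omega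
    rw [Finset.sum_add_distrib, Finset.sum_add_distrib, Finset.sum_ite_eq' A v, if_pos hv] at h1
    simp only [Finset.sum_const, smul_eq_mul] at h1
    omega
  have hBcard : B.card ≤ 2 * k + 2 := by
    refine le_trans ?_ hex
    rw [Finset.card_eq_sum_ones]
    refine (Finset.sum_le_sum (g := fun x => (nbrs G A x).card - 2) fun x hx => ?_).trans
      (Finset.sum_le_sum_of_subset (Finset.filter_subset _ _))
    have := (Finset.mem_filter.1 hx).2
    show 1 ≤ (nbrs G A x).card - 2
    omega
  have hZcard : Z.card ≤ 2 * k := by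
    have h1 : Z ⊆ F.biUnion fun e => e.toFinset := by
      intro x hx
      obtain ⟨-, e, he, hxe⟩ := Finset.mem_filter.1 hx
      exact Finset.mem_biUnion.2 ⟨e, he, by simpa using hxe⟩
    have h2 := (Finset.card_le_card h1).trans (Finset.card_biUnion_le_card_mul F _ 2 fun e _ => by
      induction e with | _ a b
      rw [Sym2.toFinset_mk_eq]
      exact Finset.card_le_two)
    omega
  have hXcard : X.card ≤ 4 * k + 3 := by
    have h1 := Finset.card_insert_le v (B ∪ Z)
    have h2 := Finset.card_union_le B Z
    rw [← hXdef] at h1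
    omega
  -- Excess plus two per vertex: `(2 * k + 2) + 2 * (4 * k + 3)`.
  have hXsum : ∑ x ∈ X, (nbrs G A x).card ≤ 10 * k + 8 := by
    have h1 : ∑ x ∈ X, (nbrs G A x).card ≤ ∑ x ∈ X, (((nbrs G A x).card - 2) + 2) :=
      Finset.sum_le_sum fun x _ => by omega
    have h2 : ∑ x ∈ X, ((nbrs G A x).card - 2) ≤ ∑ x ∈ A, ((nbrs G A x).card - 2) :=
      Finset.sum_le_sum_of_subset hXA
    rw [Finset.sum_add_distrib] at h1
    simp only [Finset.sum_const, smul_eq_mul] at h1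
    omega
  -- A chain from layer `0` to layer `15` is a thread with `16` vertices off `X`, hence different
  -- from `v`.
  have hlayer : layer G A X 15 = ∅ := by
    by_contra h
    obtain ⟨y, hy⟩ := Finset.nonempty_iff_ne_empty.2 h
    obtain ⟨l, h1, h2, h3, h4⟩ := exists_thread_of_mem_layer hXA hdeg2 hy
    refine hthread l h1 h2 (fun x hx => ⟨(h3 x hx).1, fun h => (h3 x hx).2 ?_⟩) h4
    rw [h]; exact Finset.mem_insert_self _ _
  -- A vertex outside of the ball has degree two, no feedback edge, and no neighbour in the ball,
  -- since the next layer is empty. These vertices would induce a forest with all degrees at least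
  -- two.
  have hall : A ⊆ ball G A X 15 := by
    by_contra hcon
    have hne : (A \ ball G A X 15).Nonempty := by
      rw [Finset.nonempty_iff_ne_empty]
      intro h
      exact hcon (Finset.sdiff_eq_empty_iff_subset.1 h)
    have h1 := sum_degree_le_of_isAcyclic hac hne
    have h2 : ∑ _x ∈ A \ ball G A X 15, 2 ≤ ∑ x ∈ A \ ball G A X 15,
        (nbrs ((res G A).deleteEdges (F : Set (Sym2 V))) (A \ ball G A X 15) x).card := by
      refine Finset.sum_le_sum fun x hx => ?_
      obtain ⟨hxA, hxb⟩ := Finset.mem_sdiff.1 hx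
      have hxX : x ∉ X := fun h => hxb (ball_mono (Nat.zero_le _) h)
      rw [← hdeg2 x hxA hxX]
      refine Finset.card_le_card fun y hy => ?_
      rw [mem_nbrs] at hy
      rw [mem_nbrs, Finset.mem_sdiff, SimpleGraph.deleteEdges_adj]
      refine ⟨⟨hy.1, fun hyb => ?_⟩, ⟨hxA, hy.1, hy.2⟩, fun h => hnoF x hxA hxX _ h (by simp)⟩
      have h3 : x ∈ layer G A X 15 :=
        mem_layer.2 ⟨mem_ball_succ.2 (Or.inr ⟨hxA, y, hyb, hy.2.symm⟩), hxb⟩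
      rw [hlayer] at h3
      simp at h3
    simp only [Finset.sum_const, smul_eq_mul] at h2
    omega
  -- `(4 * k + 3) + 15 * (10 * k + 8)`. The degree sum is then at most `2 * (154 * k + 123) + 2 *
  -- k`.
  have hcard : A.card ≤ 154 * k + 123 := by
    have h1 := Finset.card_le_card hall
    have h2 := card_ball_le hXA hdeg2 15
    omega
  exact ⟨hcard, by omega⟩

end Counting


/-! ### Polynomial-time functions -/

theorem Data.one_le_size : ∀ x : Data, 1 ≤ x.size
  | .nil => le_rfl
  | .cons _ _ => by simp [Data.size]

theorem Data.size_hd_le : ∀ x : Data, x.hd.size ≤ x.size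
  | .nil => le_rfl
  | .cons _ _ => by simp [Data.size, Data.hd]; omega

theorem Data.size_tl_le : ∀ x : Data, x.tl.size ≤ x.size
  | .nil => le_rfl
  | .cons _ _ => by simp [Data.size, Data.tl]; omega

/-- Producing a value is charged its size, so a time bound is also a size bound for the output.
Composition of polynomial-time functions rests on this. -/
theorem Runs.size_le {c : Code} {x y : Data} {t : ℕ} (h : Runs c x y t) : y.size ≤ t := by
  induction h with
  | nil x => exact x.one_le_size
  | id x => exact le_rfl
  | hd x => exact x.size_hd_le
  | tl x => exact x.size_tl_le
  | cons _ _ h1 h2 => simp only [Data.size]; have := Data.one_le_size; omega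
  | _ => omega

/-- The program `c` turns `x` into `y` at cost at most `b`. -/
def RunsLE (c : Code) (x y : Data) (b : ℕ) : Prop := ∃ t ≤ b, Runs c x y t

namespace RunsLE

variable {b f g c : Code} {x y z u v : Data} {s t r : ℕ}

theorem mono (h : RunsLE c x y s) (hst : s ≤ t) : RunsLE c x y t := by
  obtain ⟨k, hk, h⟩ := h
  exact ⟨k, hk.trans hst, h⟩

theorem size_le (h : RunsLE c x y s) : y.size ≤ s := by
  obtain ⟨k, hk, h⟩ := h
  exact h.size_le.trans hk

theorem nil : RunsLE .nil x .nil x.size := ⟨_, le_rfl, .nil x⟩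

theorem id : RunsLE .id x x x.size := ⟨_, le_rfl, .id x⟩

theorem hd : RunsLE .hd x x.hd x.size := ⟨_, le_rfl, .hd x⟩

theorem tl : RunsLE .tl x x.tl x.size := ⟨_, le_rfl, .tl x⟩

theorem cons (hf : RunsLE f x y s) (hg : RunsLE g x z t) :
    RunsLE (.cons f g) x (.cons y z) (x.size + s + t + 1) := by
  obtain ⟨k, hk, hf⟩ := hf
  obtain ⟨l, hl, hg⟩ := hg
  exact ⟨_, by omega, .cons hf hg⟩

theorem comp (hg : RunsLE g x y s) (hf : RunsLE f y z t) : RunsLE (.comp f g) x z (s + t + 1) := by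
  obtain ⟨k, hk, hf⟩ := hf
  obtain ⟨l, hl, hg⟩ := hg
  exact ⟨_, by omega, .comp hg hf⟩

theorem ite_true (hb : RunsLE b x (.cons u v) s) (hf : RunsLE f x y t) :
    RunsLE (.ite b f g) x y (x.size + s + t + 1) := by
  obtain ⟨k, hk, hf⟩ := hf
  obtain ⟨l, hl, hb⟩ := hb
  exact ⟨_, by omega, .ite_true hb hf⟩

theorem ite_false (hb : RunsLE b x .nil s) (hg : RunsLE g x y t) :
    RunsLE (.ite b f g) x y (x.size + s + t + 1) := by
  obtain ⟨k, hk, hf⟩ := hg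
  obtain ⟨l, hl, hb⟩ := hb
  exact ⟨_, by omega, .ite_false hb hf⟩

theorem loop_exit (hb : RunsLE b x .nil s) : RunsLE (.loop b f) x x (x.size + s + 1) := by
  obtain ⟨l, hl, hb⟩ := hb
  refine ⟨_, ?_, Runs.loop_stop hb⟩
  omega

theorem loop_step (hb : RunsLE b x (.cons u v) s) (hf : RunsLE f x y t)
    (hr : RunsLE (.loop b f) y z r) : RunsLE (.loop b f) x z (x.size + s + t + r + 1) := by
  obtain ⟨k, hk, hf⟩ := hf
  obtain ⟨l, hl, hb⟩ := hb
  obtain ⟨m, hm, hr⟩ := hr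
  exact ⟨_, by omega, .loop_step hb hf hr⟩

end RunsLE

/-- Types whose elements are encoded as data. -/
class DEnc (α : Type) where
  enc : α → Data

open DEnc (enc)

instance : DEnc Unit := ⟨fun _ => Data.nil⟩

instance : DEnc Bool := ⟨Data.ofBool⟩

instance : DEnc ℕ := ⟨Data.ofNat⟩

instance {α : Type} [DEnc α] : DEnc (List α) := ⟨fun l => Data.ofList (l.map enc)⟩

instance {α β : Type} [DEnc α] [DEnc β] : DEnc (α × β) :=
  ⟨fun p => Data.cons (enc p.1) (enc p.2)⟩

/-- The size of the encoding. -/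
def sz {α : Type} [DEnc α] (a : α) : ℕ := (enc a).size

section Sizes

variable {α β : Type} [DEnc α] [DEnc β]

theorem one_le_sz (a : α) : 1 ≤ sz a := Data.one_le_size _

theorem enc_nil : enc ([] : List α) = Data.nil := rfl

theorem enc_cons (a : α) (l : List α) : enc (a :: l) = Data.cons (enc a) (enc l) := rfl

@[simp] theorem sz_pair (a : α) (b : β) : sz (a, b) = sz a + sz b + 1 := rfl

@[simp] theorem sz_nil : sz ([] : List α) = 1 := rfl

@[simp] theorem sz_cons (a : α) (l : List α) : sz (a :: l) = sz a + sz l + 1 := rfl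

theorem sz_nat (n : ℕ) : sz n = 2 * n + 1 := by
  induction n with
  | zero => rfl
  | succ n ih =>
    have : sz (n + 1) = 1 + sz n + 1 := rfl
    omega

theorem sz_append (l m : List α) : sz (l ++ m) + 1 = sz l + sz m := by
  induction l with
  | nil => simp; omega
  | cons a l ih => simp; omega

theorem sz_list_eq (l : List α) : sz l = (l.map fun a => sz a + 1).sum + 1 := by
  induction l with
  | nil => simp
  | cons a l ih => rw [sz_cons, List.map_cons, List.sum_cons]; omega

theorem sz_list_le {l : List α} {b n : ℕ} (hl : l.length ≤ n) (hb : ∀ a ∈ l, sz a ≤ b) :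
    sz l ≤ n * (b + 1) + 1 := by
  rw [sz_list_eq]
  have := List.sum_le_card_nsmul (l.map fun a => sz a + 1) (b + 1) (by
    intro m hm
    obtain ⟨a, ha, rfl⟩ := List.mem_map.1 hm
    have := hb a ha
    omega)
  simp only [List.length_map, smul_eq_mul] at this
  have := Nat.mul_le_mul_right (b + 1) hl
  omega

theorem length_le_sz (l : List α) : l.length ≤ sz l := by
  induction l with
  | nil => simp
  | cons a l ih => simp; omega

theorem sz_le_of_mem {a : α} {l : List α} (h : a ∈ l) : sz a ≤ sz l := by
  induction l with
  | nil => simp at h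
  | cons b l ih =>
    rcases List.mem_cons.1 h with rfl | h
    · simp; omega
    · have := ih h; simp; omega

theorem sz_le_of_sublist {l m : List α} (h : l.Sublist m) : sz l ≤ sz m := by
  induction h with
  | slnil => exact le_rfl
  | cons a _ ih => simp; omega
  | cons_cons a _ ih => simp; omega

theorem sz_reverse (l : List α) : sz l.reverse = sz l := by
  rw [sz_list_eq, sz_list_eq, List.map_reverse, List.sum_reverse]

end Sizes

/-- `s` is bounded by a polynomial in the size of the argument. -/
def PB {α : Type} [DEnc α] (s : α → ℕ) : Prop := ∃ d, ∀ x, s x ≤ (sz x + 2) ^ d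

/-- `f` is computable in polynomial time. -/
def PT {α β : Type} [DEnc α] [DEnc β] (f : α → β) : Prop :=
  ∃ c, ∃ b : α → ℕ, PB b ∧ ∀ x, RunsLE c (enc x) (enc (f x)) (b x)

section PB

variable {α β : Type} [DEnc α] [DEnc β] {s t : α → ℕ}

theorem PB.mono (h : PB t) (hst : ∀ x, s x ≤ t x) : PB s := by
  obtain ⟨d, hd⟩ := h
  exact ⟨d, fun x => (hst x).trans (hd x)⟩

theorem PB.size : PB (fun x : α => sz x) := ⟨1, fun x => by simp⟩

theorem PB.mul (hs : PB s) (ht : PB t) : PB fun x => s x * t x := by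
  obtain ⟨d, hd⟩ := hs
  obtain ⟨e, he⟩ := ht
  exact ⟨d + e, fun x => by rw [pow_add]; exact Nat.mul_le_mul (hd x) (he x)⟩

theorem PB.pow (hs : PB s) (k : ℕ) : PB fun x => s x ^ k := by
  obtain ⟨d, hd⟩ := hs
  exact ⟨d * k, fun x => by rw [pow_mul]; exact Nat.pow_le_pow_left (hd x) k⟩

/-- The base `sz x + 2` is at least two, so a constant fits into the exponent. -/
theorem PB.const (k : ℕ) : PB fun _ : α => k :=
  ⟨k, fun x => (Nat.lt_two_pow_self (n := k)).le.trans (Nat.pow_le_pow_left (by omega) k)⟩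

theorem PB.add (hs : PB s) (ht : PB t) : PB fun x => s x + t x := by
  obtain ⟨d, hd⟩ := hs
  obtain ⟨e, he⟩ := ht
  refine ⟨d + e + 1, fun x => ?_⟩
  have h1 : (MBDom.sz x + 2) ^ d ≤ (MBDom.sz x + 2) ^ (d + e) :=
    Nat.pow_le_pow_right (by omega) (by omega)
  have h2 : (MBDom.sz x + 2) ^ e ≤ (MBDom.sz x + 2) ^ (d + e) :=
    Nat.pow_le_pow_right (by omega) (by omega)
  have h3 : (MBDom.sz x + 2) ^ (d + e) * 2 ≤ (MBDom.sz x + 2) ^ (d + e + 1) := by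
    rw [pow_succ]
    exact Nat.mul_le_mul_left _ (by omega)
  have := hd x
  have := he x
  show s x + t x ≤ _
  omega

theorem PT.pb {f : α → β} (hf : PT f) : PB fun x => MBDom.sz (f x) := by
  obtain ⟨c, b, hb, h⟩ := hf
  exact hb.mono fun x => (h x).size_le

theorem PB.comp {s : β → ℕ} (hs : PB s) {g : α → β} (hg : PB fun x => MBDom.sz (g x)) :
    PB fun x => s (g x) := by
  obtain ⟨d, hd⟩ := hs
  exact ((hg.add (.const 2)).pow d).mono fun x => hd (g x)

end PB

section PT

variable {α β γ δ σ : Type} [DEnc α] [DEnc β] [DEnc γ] [DEnc δ] [DEnc σ]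

theorem PT.of_eq {f g : α → β} (hf : PT f) (h : ∀ x, f x = g x) : PT g := funext h ▸ hf

/-- A function that does not change the encoding. -/
theorem PT.cast {f : α → β} (h : ∀ x, enc (f x) = enc x) : PT f :=
  ⟨.id, fun x => sz x, .size, fun x => by rw [h]; exact .id⟩

theorem PT.fst : PT (Prod.fst : α × β → α) := ⟨.hd, fun x => sz x, .size, fun _ => .hd⟩

theorem PT.snd : PT (Prod.snd : α × β → β) := ⟨.tl, fun x => sz x, .size, fun _ => .tl⟩

theorem PT.comp {g : β → γ} {f : α → β} (hg : PT g) (hf : PT f) : PT fun x => g (f x) := by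
  have hfb := hf.pb
  obtain ⟨c, b, hb, h⟩ := hf
  obtain ⟨c', b', hb', h'⟩ := hg
  exact ⟨.comp c' c, fun x => b x + b' (f x) + 1, (hb.add (hb'.comp hfb)).add (.const 1),
    fun x => (h x).comp (h' (f x))⟩

theorem PT.pair {f : α → β} {g : α → γ} (hf : PT f) (hg : PT g) : PT fun x => (f x, g x) := by
  obtain ⟨c, b, hb, h⟩ := hf
  obtain ⟨c', b', hb', h'⟩ := hg
  exact ⟨.cons c c', fun x => sz x + b x + b' x + 1, ((PB.size.add hb).add hb').add (.const 1),
    fun x => (h x).cons (h' x)⟩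

theorem PT.cons {f : α → β} {g : α → List β} (hf : PT f) (hg : PT g) : PT fun x => f x :: g x :=
  PT.comp (f := fun x => (f x, g x)) (g := fun p : β × List β => p.1 :: p.2)
    (.cast fun _ => rfl) (hf.pair hg)

theorem PT.tail {f : α → List β} (hf : PT f) : PT fun x => (f x).tail :=
  PT.comp (g := List.tail) ⟨.tl, fun x => sz x, .size, fun l => by
    cases l <;> exact RunsLE.tl⟩ hf

theorem Data.exists_runsLE (y : Data) : ∃ c k, ∀ x, RunsLE c x y (k * x.size) := by
  induction y with
  | nil => exact ⟨.nil, 1, fun x => RunsLE.nil.mono (by simp)⟩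
  | cons a b iha ihb =>
    obtain ⟨c, k, h⟩ := iha
    obtain ⟨c', k', h'⟩ := ihb
    refine ⟨.cons c c', 1 + k + k' + 1, fun x => ((h x).cons (h' x)).mono ?_⟩
    have := x.one_le_size
    simp only [add_mul, one_mul]
    omega

theorem PT.const (b : β) : PT fun _ : α => b := by
  obtain ⟨c, k, h⟩ := (enc b).exists_runsLE
  exact ⟨c, _, (PB.const k).mul .size, fun x => h _⟩

theorem PT.ite {b : α → Bool} {f g : α → β} (hb : PT b) (hf : PT f) (hg : PT g) :
    PT fun x => if b x then f x else g x := by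
  obtain ⟨c₀, b₀, hb₀, h₀⟩ := hb
  obtain ⟨c₁, b₁, hb₁, h₁⟩ := hf
  obtain ⟨c₂, b₂, hb₂, h₂⟩ := hg
  refine ⟨.ite c₀ c₁ c₂, fun x => sz x + b₀ x + (b₁ x + b₂ x) + 1,
    ((PB.size.add hb₀).add (hb₁.add hb₂)).add (.const 1), fun x => ?_⟩
  have h := h₀ x
  have h1 := h₁ x
  have h2 := h₂ x
  show RunsLE _ _ (enc (if b x then f x else g x)) (sz x + b₀ x + (b₁ x + b₂ x) + 1)
  cases hbx : b x
  · rw [hbx] at h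
    simp only [Bool.false_eq_true, if_false]
    refine (RunsLE.ite_false h h2).mono ?_
    simp only [sz]
    omega
  · rw [hbx] at h
    simp only [if_true]
    refine (RunsLE.ite_true h h1).mono ?_
    simp only [sz]
    omega

theorem PT.isEmpty {f : α → List β} (hf : PT f) : PT fun x => (f x).isEmpty :=
  PT.comp (g := List.isEmpty) ⟨.ite .id .nil (.cons .nil .nil), fun x => 5 * sz x + 2,
    ((PB.const 5).mul .size).add (.const 2), fun l => by
      cases l with
      | nil =>
        exact (RunsLE.ite_false RunsLE.id (RunsLE.cons .nil .nil)).mono (by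
          simp only [sz, enc_nil]; omega)
      | cons a l =>
        exact (RunsLE.ite_true (u := enc a) (v := enc l) RunsLE.id .nil).mono
          (by simp only [sz, enc_cons]; omega)⟩ hf

theorem PT.headD {f : α → List β} {d : α → β} (hf : PT f) (hd : PT d) :
    PT fun x => (f x).headD (d x) := by
  have : PT fun p : List β × β => p.1.headD p.2 := by
    refine ⟨.ite .hd (.comp .hd .hd) .tl, fun x => 5 * sz x + 3,
      ((PB.const 5).mul .size).add (.const 3), fun ⟨l, d⟩ => ?_⟩
    cases l with
    | nil => exact (RunsLE.ite_false RunsLE.hd .tl).mono (by simp only [sz]; omega)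
    | cons a l =>
      have h := (RunsLE.hd (x := enc (a :: l, d))).comp .hd
      have h2 : (enc (a :: l, d)).hd.size ≤ (enc (a :: l, d)).size := Data.size_hd_le _
      exact (RunsLE.ite_true (u := enc a) (v := enc l) RunsLE.hd h).mono (by simp only [sz]; omega)
  exact this.comp (hf.pair hd)

/-- The loop that computes a left fold: the state consists of a context, the rest of the list and
the accumulated value. -/
def foldBody (c : Code) : Code :=
  .cons .hd (.cons (.comp .tl (.comp .hd .tl))
    (.comp c (.cons .hd (.cons (.comp .tl .tl) (.comp .hd (.comp .hd .tl))))))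

theorem RunsLE.foldBody {c : Code} {X a l s s' : Data} {t : ℕ}
    (h : RunsLE c (.cons X (.cons s a)) s' t) :
    RunsLE (foldBody c) (.cons X (.cons (.cons a l) s)) (.cons X (.cons l s'))
      (20 * (Data.cons X (.cons (.cons a l) s)).size + t + 20) := by
  set x := Data.cons X (.cons (.cons a l) s) with hx
  have h1 : RunsLE .hd x X x.size := .hd
  have h2 : RunsLE .tl x (.cons (.cons a l) s) x.size := .tl
  have hs : (Data.cons (.cons a l) s).size ≤ x.size := Data.size_tl_le x
  have hs' : (Data.cons a l).size ≤ x.size := (Data.size_hd_le (.cons (.cons a l) s)).trans hs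
  have h3 : RunsLE (.comp .hd .tl) x (.cons a l) _ := h2.comp .hd
  have h4 : RunsLE (.comp .tl (.comp .hd .tl)) x l _ := h3.comp .tl
  have h5 : RunsLE (.comp .hd (.comp .hd .tl)) x a _ := h3.comp .hd
  have h6 : RunsLE (.comp .tl .tl) x s _ := h2.comp .tl
  refine (h1.cons (h4.cons ((h1.cons (h6.cons h5)).comp h))).mono ?_
  omega

/-- `K` bounds both the cost of one call of `c` and the size of every state of the loop, so that
each round, and the final test, costs at most `30 * K + 30`. -/
theorem RunsLE.loop_foldl {c : Code} {X : Data} {f : σ → β → σ} {K : ℕ} : ∀ (l : List β) (s : σ),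
    (∀ l₁ b l₂, l = l₁ ++ b :: l₂ →
      RunsLE c (.cons X (.cons (enc (l₁.foldl f s)) (enc b))) (enc (f (l₁.foldl f s) b)) K) →
    (∀ l₁ l₂, l = l₁ ++ l₂ → (Data.cons X (.cons (enc l₂) (enc (l₁.foldl f s)))).size ≤ K) →
    RunsLE (.loop (.comp .hd .tl) (MBDom.foldBody c)) (.cons X (.cons (enc l) (enc s)))
      (.cons X (.cons .nil (enc (l.foldl f s)))) ((l.length + 1) * (30 * K + 30))
  | [], s, _, h2 => by
    have h3 := h2 [] [] rfl
    have h4 : RunsLE (.comp .hd .tl) (.cons X (.cons (enc ([] : List β)) (enc s))) .nil _ :=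
      RunsLE.tl.comp .hd
    have h5 := Data.size_tl_le (.cons X (.cons (enc ([] : List β)) (enc s)))
    refine (RunsLE.loop_exit h4).mono ?_
    simp only [List.foldl_nil] at h3
    simp only [List.length_nil]
    omega
  | b :: l, s, h1, h2 => by
    have h3 := h2 [] (b :: l) rfl
    have h4 : RunsLE (.comp .hd .tl) (.cons X (.cons (enc (b :: l)) (enc s)))
        (.cons (enc b) (enc l)) _ := RunsLE.tl.comp .hd
    have h5 := Data.size_tl_le (.cons X (.cons (enc (b :: l)) (enc s)))
    have h6 := RunsLE.foldBody (l := enc l) (h1 [] b l rfl)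
    have h7 := RunsLE.loop_foldl (X := X) (K := K) l (f s b)
      (fun l₁ b' l₂ hl => h1 (b :: l₁) b' l₂ (by rw [hl]; rfl))
      (fun l₁ l₂ hl => h2 (b :: l₁) l₂ (by rw [hl]; rfl))
    refine (RunsLE.loop_step h4 h6 h7).mono ?_
    simp only [List.foldl_nil] at h3
    have h8 : (Data.cons X (.cons (.cons (enc b) (enc l)) (enc s))).size ≤ K := h3
    simp only [List.length_cons, List.foldl_nil]
    rw [Nat.succ_mul (l.length + 1)]
    omega

/-- The program for a left fold. -/
def foldCode (cL ci c : Code) : Code :=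
  .comp (.comp .tl .tl)
    (.comp (.loop (.comp .hd .tl) (foldBody c)) (.cons .id (.cons cL ci)))

theorem RunsLE.foldl {cL ci c : Code} {X : Data} {l : List β} {s : σ} {f : σ → β → σ} {t K : ℕ}
    (hL : RunsLE cL X (enc l) t) (hi : RunsLE ci X (enc s) t)
    (h1 : ∀ l₁ b l₂, l = l₁ ++ b :: l₂ →
      RunsLE c (.cons X (.cons (enc (l₁.foldl f s)) (enc b))) (enc (f (l₁.foldl f s) b)) K)
    (h2 : ∀ l₁ l₂, l = l₁ ++ l₂ → (Data.cons X (.cons (enc l₂) (enc (l₁.foldl f s)))).size ≤ K) :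
    RunsLE (foldCode cL ci c) X (enc (l.foldl f s))
      (3 * t + 3 * X.size + (l.length + 1) * (30 * K + 30) + 3 * K + 20) := by
  have h3 := (RunsLE.id (x := X)).cons (hL.cons hi)
  have h4 := h3.comp (RunsLE.loop_foldl l s h1 h2)
  have h5 := h4.comp (RunsLE.tl.comp .tl)
  refine h5.mono ?_
  have h6 := h2 l [] (by simp)
  have h7 := Data.size_tl_le (Data.cons X (.cons .nil (enc (l.foldl f s))))
  have h8 : (Data.cons X (.cons .nil (enc (l.foldl f s)))).size ≤ K := h6
  omega

/-- The source of the polynomial-time loops below. A polynomial-time body alone does not suffice,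
since the accumulator might grow exponentially; hence the bound `B` for its size after every prefix
of the list. -/
theorem PT.foldl {L : α → List β} {init : α → σ} {f : α → σ → β → σ} {B : α → ℕ} (hL : PT L)
    (hi : PT init) (hf : PT fun p : α × σ × β => f p.1 p.2.1 p.2.2) (hB : PB B)
    (hb : ∀ x l₁, l₁ <+: L x → sz (l₁.foldl (f x) (init x)) ≤ B x) :
    PT fun x => (L x).foldl (f x) (init x) := by
  have hLs := hL.pb
  obtain ⟨c₀, b₀, hb₀, h₀⟩ := hL
  obtain ⟨c₁, b₁, hb₁, h₁⟩ := hi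
  obtain ⟨c, b, ⟨d, hd⟩, h⟩ := hf
  -- A bound for loop states and for arguments of the body. The `4` covers two pair nodes and the
  -- `2` in the base of `PB`.
  let S : α → ℕ := fun x => sz x + B x + sz (L x) + 4
  have hS : PB S := ((PB.size.add hB).add hLs).add (.const 4)
  let K : α → ℕ := fun x => S x ^ d + S x
  have hK : PB K := (hS.pow d).add hS
  refine ⟨foldCode c₀ c₁ c, fun x => 3 * (b₀ x + b₁ x) + 3 * sz x +
    (sz (L x) + 1) * (30 * K x + 30) + 3 * K x + 20, ?_, fun x => ?_⟩
  · exact (((((PB.const 3).mul (hb₀.add hb₁)).add ((PB.const 3).mul .size)).add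
      ((hLs.add (.const 1)).mul (((PB.const 30).mul hK).add (.const 30)))).add
      ((PB.const 3).mul hK)).add (.const 20)
  · refine (RunsLE.foldl (K := K x) ((h₀ x).mono (Nat.le_add_right _ (b₁ x)))
      ((h₁ x).mono (Nat.le_add_left _ (b₀ x))) ?_ ?_).mono ?_
    · intro l₁ a l₂ hl
      refine (h (x, l₁.foldl (f x) (init x), a)).mono ((hd _).trans ?_)
      refine le_trans (Nat.pow_le_pow_left ?_ d) (Nat.le_add_right _ _)
      have h1 := hb x l₁ ⟨a :: l₂, hl.symm⟩
      have h2 : sz a ≤ sz (L x) := sz_le_of_mem (by rw [hl]; simp)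
      simp only [sz_pair, S]
      omega
    · intro l₁ l₂ hl
      have h1 := hb x l₁ ⟨l₂, hl.symm⟩
      have h2 : sz l₂ ≤ sz (L x) := sz_le_of_sublist (by rw [hl]; exact List.sublist_append_right _ _)
      show (enc x).size + ((enc l₂).size + (enc (l₁.foldl (f x) (init x))).size + 1) + 1 ≤ _
      simp only [sz, K, S] at h1 h2 ⊢
      omega
    · have := length_le_sz (L x)
      have := Nat.mul_le_mul_right (30 * K x + 30) (Nat.succ_le_succ this)
      simp only [sz] at this ⊢
      simp only [Nat.succ_eq_add_one] at this
      omega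

end PT


/-! ### Polynomial-time operations on lists and numbers -/

open DEnc (enc)

section PTLists

variable {α β γ δ σ : Type} [DEnc α] [DEnc β] [DEnc γ] [DEnc δ] [DEnc σ]

/-- An element is no larger than its list, so a bound in `x` and `a` becomes a bound in `x` alone.
-/
theorem PB.of_mem {s : α → β → ℕ} (hs : PB fun p : α × β => s p.1 p.2) {L : α → List β} (hL : PT L) :
    ∃ B : α → ℕ, PB B ∧ ∀ x, ∀ a ∈ L x, s x a ≤ B x := by
  obtain ⟨d, hd⟩ := hs
  refine ⟨fun x => (sz x + sz (L x) + 3) ^ d, ((PB.size.add hL.pb).add (.const 3)).pow d,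
    fun x a ha => (hd (x, a)).trans (Nat.pow_le_pow_left ?_ d)⟩
  have := sz_le_of_mem ha
  rw [sz_pair]
  omega

theorem PT.reverse {L : α → List β} (hL : PT L) : PT fun x => (L x).reverse := by
  refine (PT.foldl (init := fun _ => []) (f := fun _ acc a => a :: acc) hL (.const [])
    (.cons (PT.snd.comp .snd) (PT.fst.comp .snd)) hL.pb ?_).of_eq fun x => ?_
  · intro x l₁ h
    rw [List.foldl_flip_cons_eq_append', List.append_nil]
    rw [sz_reverse]
    exact sz_le_of_sublist h.sublist
  · rw [List.foldl_flip_cons_eq_append', List.append_nil]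

theorem PT.map {L : α → List β} {g : α → β → γ} (hL : PT L) (hg : PT fun p : α × β => g p.1 p.2) :
    PT fun x => (L x).map (g x) := by
  obtain ⟨B, hB, hb⟩ := PB.of_mem (s := fun x a => sz (g x a)) hg.pb hL
  have key : ∀ x (l : List β) (m : List γ),
      l.foldl (fun acc a => g x a :: acc) m = (l.map (g x)).reverse ++ m := by
    intro x l
    induction l with
    | nil => simp
    | cons a l ih => intro m; simp [ih]
  refine PT.of_eq (PT.reverse (PT.foldl (init := fun _ => []) (f := fun x acc a => g x a :: acc) hL
    (.const []) (.cons (hg.comp (PT.fst.pair (PT.snd.comp .snd))) (PT.fst.comp .snd))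
    ((hL.pb.mul (hB.add (.const 1))).add (.const 1)) ?_)) fun x => ?_
  · intro x l₁ h
    rw [key, List.append_nil]
    refine sz_list_le ?_ fun c hc => ?_
    · rw [List.length_reverse, List.length_map]
      exact (h.length_le).trans (length_le_sz _)
    · obtain ⟨a, ha, rfl⟩ := List.mem_map.1 (List.mem_reverse.1 hc)
      exact hb x a (h.subset ha)
  · rw [key, List.append_nil, List.reverse_reverse]

theorem PT.filter {L : α → List β} {g : α → β → Bool} (hL : PT L)
    (hg : PT fun p : α × β => g p.1 p.2) : PT fun x => (L x).filter (g x) := by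
  have key : ∀ x (l : List β) (m : List β),
      l.foldl (fun acc a => if g x a then a :: acc else acc) m =
        (l.filter (g x)).reverse ++ m := by
    intro x l
    induction l with
    | nil => simp
    | cons a l ih =>
      intro m
      by_cases h : g x a
      · simp [ih, h]
      · simp [ih, h]
  refine PT.of_eq (PT.reverse (PT.foldl (init := fun _ => [])
    (f := fun x acc a => if g x a then a :: acc else acc) hL
    (.const []) (.ite (hg.comp (PT.fst.pair (PT.snd.comp .snd)))
      (.cons (PT.snd.comp .snd) (PT.fst.comp .snd)) (PT.fst.comp .snd)) hL.pb ?_)) fun x => ?_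
  · intro x l₁ h
    rw [key, List.append_nil]
    rw [sz_reverse]
    exact sz_le_of_sublist (List.filter_sublist.trans h.sublist)
  · rw [key, List.append_nil, List.reverse_reverse]

theorem PT.append {L M : α → List β} (hL : PT L) (hM : PT M) : PT fun x => L x ++ M x := by
  refine (PT.foldl (init := M) (f := fun _ acc a => a :: acc) hL.reverse hM
    (.cons (PT.snd.comp .snd) (PT.fst.comp .snd)) (hL.pb.add hM.pb) ?_).of_eq fun x => ?_
  · intro x l₁ h
    rw [List.foldl_flip_cons_eq_append']
    have h1 := sz_append l₁.reverse (M x)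
    have h2 := sz_le_of_sublist (List.reverse_sublist.2 h.sublist)
    rw [List.reverse_reverse] at h2
    omega
  · rw [List.foldl_flip_cons_eq_append', List.reverse_reverse]

theorem PT.flatten {L : α → List (List β)} (hL : PT L) : PT fun x => (L x).flatten := by
  have key : ∀ (l : List (List β)) (m : List β),
      l.foldl (fun acc a => acc ++ a) m = m ++ l.flatten := by
    intro l
    induction l with
    | nil => simp
    | cons a l ih => intro m; simp [ih]
  have hsz : ∀ l : List (List β), sz l.flatten ≤ sz l := by
    intro l
    induction l with
    | nil => simp
    | cons a l ih =>
      have := sz_append a l.flatten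
      rw [List.flatten_cons, sz_cons]
      omega
  refine (PT.foldl (init := fun _ => []) (f := fun _ acc a => acc ++ a) hL (.const [])
    (.append (PT.fst.comp .snd) (PT.snd.comp .snd)) hL.pb ?_).of_eq fun x => ?_
  · intro x l₁ h
    rw [key, List.nil_append]
    exact (hsz _).trans (sz_le_of_sublist h.sublist)
  · rw [key, List.nil_append]

theorem PT.flatMap {L : α → List β} {g : α → β → List γ} (hL : PT L)
    (hg : PT fun p : α × β => g p.1 p.2) : PT fun x => (L x).flatMap (g x) :=
  (PT.flatten (PT.map hL hg)).of_eq fun _ => List.flatMap_def.symm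

theorem PT.not {f : α → Bool} (hf : PT f) : PT fun x => !f x :=
  (PT.ite hf (.const false) (.const true)).of_eq fun x => by cases f x <;> rfl

theorem PT.and {f g : α → Bool} (hf : PT f) (hg : PT g) : PT fun x => f x && g x :=
  (PT.ite hf hg (.const false)).of_eq fun x => by cases f x <;> rfl

theorem PT.or {f g : α → Bool} (hf : PT f) (hg : PT g) : PT fun x => f x || g x :=
  (PT.ite hf (.const true) hg).of_eq fun x => by cases f x <;> rfl

theorem PT.any {L : α → List β} {g : α → β → Bool} (hL : PT L)
    (hg : PT fun p : α × β => g p.1 p.2) : PT fun x => (L x).any (g x) :=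
  (PT.filter hL hg).isEmpty.not.of_eq fun x => by
    rw [Bool.eq_iff_iff]; simp

theorem PT.all {L : α → List β} {g : α → β → Bool} (hL : PT L)
    (hg : PT fun p : α × β => g p.1 p.2) : PT fun x => (L x).all (g x) :=
  (PT.any (g := fun x a => !g x a) hL hg.not).not.of_eq fun x => by
    rw [Bool.eq_iff_iff]; simp

/-- A unary number is encoded like a list of units. Arithmetic thus becomes list handling: addition
is concatenation, subtraction is `List.drop`. -/
theorem PT.units {f : α → ℕ} (hf : PT f) : PT fun x => List.replicate (f x) () :=
  PT.comp (g := fun n : ℕ => List.replicate n ()) (.cast fun n => by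
    induction n with
    | zero => rfl
    | succ n ih => rw [List.replicate_succ, enc_cons, ih]; rfl) hf

theorem PT.length {f : α → List β} (hf : PT f) : PT fun x => (f x).length :=
  PT.comp (g := fun l : List Unit => l.length) (.cast fun l => by
    induction l with
    | nil => rfl
    | cons a l ih => rw [enc_cons, ← ih]; rfl) (PT.map hf (g := fun _ _ => ()) (.const ()))
    |>.of_eq fun x => by simp

theorem PT.succ {f : α → ℕ} (hf : PT f) : PT fun x => f x + 1 :=
  (PT.length (.cons (.const ()) hf.units)).of_eq fun x => by simp

theorem PT.isZero {f : α → ℕ} (hf : PT f) : PT fun x => f x == 0 :=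
  hf.units.isEmpty.of_eq fun x => by cases f x <;> simp

/-- A fold over `n x` units. As for `PT.foldl`, the sizes of the iterates have to be bounded
separately. -/
theorem PT.iterate {n : α → ℕ} {init : α → σ} {g : α → σ → σ} {B : α → ℕ} (hn : PT n)
    (hi : PT init) (hg : PT fun p : α × σ => g p.1 p.2) (hB : PB B)
    (hb : ∀ x, ∀ i ≤ n x, sz ((g x)^[i] (init x)) ≤ B x) : PT fun x => (g x)^[n x] (init x) := by
  have key : ∀ x (l : List Unit) (s : σ), l.foldl (fun s _ => g x s) s = (g x)^[l.length] s := by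
    intro x l
    induction l with
    | nil => simp
    | cons a l ih => intro s; simp [ih]
  refine (PT.foldl (f := fun x s (_ : Unit) => g x s) hn.units hi
    (hg.comp (PT.fst.pair (PT.fst.comp .snd))) hB ?_).of_eq fun x => ?_
  · intro x l₁ h
    rw [key]
    exact hb x _ (by simpa using h.length_le)
  · rw [key, List.length_replicate]

theorem PT.drop {n : α → ℕ} {L : α → List β} (hn : PT n) (hL : PT L) :
    PT fun x => (L x).drop (n x) := by
  have key : ∀ n (l : List β), List.tail^[n] l = l.drop n := by
    intro n
    induction n with
    | zero => simp
    | succ n ih => intro l; rw [Function.iterate_succ_apply, ih, List.drop_tail]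
  refine (PT.iterate (g := fun _ l => List.tail l) hn hL (PT.tail .snd) hL.pb
    fun x i _ => ?_).of_eq fun x => key _ _
  rw [key]
  exact sz_le_of_sublist (List.drop_sublist _ _)

theorem PT.getD {n : α → ℕ} {L : α → List β} {d : α → β} (hL : PT L) (hn : PT n) (hd : PT d) :
    PT fun x => (L x).getD (n x) (d x) :=
  (PT.headD (PT.drop hn hL) hd).of_eq fun x => by
    simp [List.headD_eq_head?_getD, List.getD_eq_getElem?_getD]

theorem PT.sub {f g : α → ℕ} (hf : PT f) (hg : PT g) : PT fun x => f x - g x :=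
  (PT.length (PT.drop hg hf.units)).of_eq fun x => by simp

theorem PT.add {f g : α → ℕ} (hf : PT f) (hg : PT g) : PT fun x => f x + g x :=
  (PT.length (PT.append hf.units hg.units)).of_eq fun x => by simp

theorem PT.ble {f g : α → ℕ} (hf : PT f) (hg : PT g) : PT fun x => decide (f x ≤ g x) :=
  (hf.sub hg).isZero.of_eq fun x => by rw [Bool.eq_iff_iff]; simp; omega

theorem PT.beq {f g : α → ℕ} (hf : PT f) (hg : PT g) : PT fun x => f x == g x :=
  ((hf.ble hg).and (hg.ble hf)).of_eq fun x => by rw [Bool.eq_iff_iff]; simp; omega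

theorem PT.range {f : α → ℕ} (hf : PT f) : PT fun x => List.range (f x) := by
  have key : ∀ n, (fun l : List ℕ => l.length :: l)^[n] [] = (List.range n).reverse := by
    intro n
    induction n with
    | zero => rfl
    | succ n ih => rw [Function.iterate_succ_apply', ih, List.range_succ]; simp
  refine (PT.reverse (PT.iterate (init := fun _ => []) (g := fun _ l => l.length :: l) hf (.const [])
    (.cons (PT.length .snd) .snd) (((PB.const 2).mul (hf.pb.mul (hf.pb.add (.const 1)))).add
      (.const 1)) fun x i hi => ?_)).of_eq fun x => ?_
  · rw [key]
    have h1 := sz_nat (f x)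
    refine (sz_list_le (b := 2 * f x + 1) (n := f x) (by simpa using hi) fun a ha => ?_).trans ?_
    · have : a < i := by simpa using ha
      rw [sz_nat]
      omega
    · rw [h1]
      nlinarith
  · rw [key, List.reverse_reverse]

theorem PT.contains {L : α → List ℕ} {f : α → ℕ} (hL : PT L) (hf : PT f) :
    PT fun x => (L x).contains (f x) :=
  (PT.any hL (g := fun x a => f x == a) ((hf.comp .fst).beq .snd)).of_eq fun x => by
    rw [Bool.eq_iff_iff]; simp

end PTLists


open DEnc (enc)

/-! ### The kernelization algorithm -/

/-- The adjacency relation of the graph with the edges `E`. -/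
def adjB (E : List (ℕ × ℕ)) (i j : ℕ) : Bool :=
  !(i == j) && E.any fun e => (e.1 == i && e.2 == j) || (e.1 == j && e.2 == i)

/-- The free vertices, the edges, and Dominator's vertex. -/
abbrev GameState := List ℕ × List (ℕ × ℕ) × ℕ

namespace GameState

/-- The list of the neighbours of a vertex. -/
def nbrList (S : GameState) (u : ℕ) : List ℕ := (S.2.2 :: S.1).filter (adjB S.2.1 u)

/-- `x` and `z` are the only neighbours of `y`. -/
def isMid (S : GameState) (x y z : ℕ) : Bool :=
  (nbrList S y).all (fun t => t == x || t == z) && (adjB S.2.1 y x && adjB S.2.1 y z)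

/-- The list has no repetitions, and the inner vertices have only their neighbours in the list as
neighbours. -/
def isThreadB (S : GameState) (c : List ℕ) : Bool :=
  ((List.range c.length).all fun i => (List.range i).all fun j => !(c.getD i 0 == c.getD j 0)) &&
    (List.range (c.length - 2)).all fun i =>
      isMid S (c.getD i 0) (c.getD (i + 1) 0) (c.getD (i + 2) 0)

/-- All lists of length `k` over a list. -/
def listsOver (L : List ℕ) : ℕ → List (List ℕ)
  | 0 => [[]]
  | k + 1 => (listsOver L k).flatMap fun c => L.map fun x => x :: c

/-- Delete two vertices. -/
def delete (S : GameState) (u w : ℕ) : GameState := (S.1.filter fun y => !(y == u || y == w), S.2)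

/-- Contract the seventh and the eighth vertex of a long thread. -/
def contract (S : GameState) (c : List ℕ) : GameState :=
  ((delete S (c.getD 7 0) (c.getD 8 0)).1, (c.getD 6 0, c.getD 9 0) :: S.2.1, S.2.2)

/-- The leaves among the free vertices. -/
def leaves (S : GameState) : List ℕ := S.1.filter fun u => (nbrList S u).length == 1

/-- The threads with 16 free vertices. -/
def threads (S : GameState) : List (List ℕ) := (listsOver S.1 16).filter (isThreadB S)

/-- One reduction step. -/
def step (S : GameState) : GameState :=
  if (leaves S).isEmpty then
    if (threads S).isEmpty then S else contract S ((threads S).headD [])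
  else delete S ((leaves S).headD 0) ((nbrList S ((leaves S).headD 0)).headD 0)

/-- The result of all reduction steps. -/
def reduce (S : GameState) : GameState := step^[S.1.length] S

/-- The adjacency matrix; Dominator's vertex comes first. -/
def matrix (S : GameState) : List (List Bool) :=
  (S.2.2 :: S.1).map fun i => (S.2.2 :: S.1).map fun j => adjB S.2.1 i j

/-- Two isolated vertices, one of them claimed by Dominator. -/
def lost : GameState := ([1], [], 0)

/-- The kernel of a game. -/
def kernel (S : GameState) : GameState :=
  if (reduce S).1.any fun u => (nbrList (reduce S) u).isEmpty then lost else reduce S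

end GameState

open GameState

section KernelPT

variable {α : Type} [DEnc α]

theorem PT.adjB {E : α → List (ℕ × ℕ)} {i j : α → ℕ} (hE : PT E) (hi : PT i) (hj : PT j) :
    PT fun x => adjB (E x) (i x) (j x) := by
  have h1 : PT fun p : α × ℕ × ℕ => p.2.1 := PT.fst.comp .snd
  have h2 : PT fun p : α × ℕ × ℕ => p.2.2 := PT.snd.comp .snd
  exact (hi.beq hj).not.and (PT.any hE
    (g := fun x e => (e.1 == i x && e.2 == j x) || (e.1 == j x && e.2 == i x))
    (((h1.beq (hi.comp .fst)).and (h2.beq (hj.comp .fst))).or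
      ((h1.beq (hj.comp .fst)).and (h2.beq (hi.comp .fst)))))

theorem PT.nbrList {S : α → GameState} {u : α → ℕ} (hS : PT S) (hu : PT u) :
    PT fun x => nbrList (S x) (u x) :=
  PT.filter (g := fun x j => MBDom.adjB (S x).2.1 (u x) j)
    (.cons (PT.snd.comp (PT.snd.comp hS)) (PT.fst.comp hS))
    (.adjB (PT.fst.comp (PT.snd.comp (hS.comp .fst))) (hu.comp .fst) .snd)

theorem PT.isMid {S : α → GameState} {i j k : α → ℕ} (hS : PT S) (hi : PT i) (hj : PT j)
    (hk : PT k) : PT fun x => isMid (S x) (i x) (j x) (k x) := by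
  have hE : PT fun x => (S x).2.1 := PT.fst.comp (PT.snd.comp hS)
  exact (PT.all (.nbrList hS hj) (g := fun x t => t == i x || t == k x)
    ((PT.snd.beq (hi.comp .fst)).or (PT.snd.beq (hk.comp .fst)))).and
    ((PT.adjB hE hj hi).and (.adjB hE hj hk))

theorem PT.isThreadB {S : α → GameState} {c : α → List ℕ} (hS : PT S) (hc : PT c) :
    PT fun x => isThreadB (S x) (c x) := by
  refine PT.and (PT.all (PT.range (.length hc))
    (g := fun x i => (List.range i).all fun j => !((c x).getD i 0 == (c x).getD j 0))
    (PT.all (.range .snd) (g := fun p j => !((c p.1).getD p.2 0 == (c p.1).getD j 0)) ?_))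
    (PT.all (PT.range (.sub (.length hc) (.const 2)))
      (g := fun x i => GameState.isMid (S x) ((c x).getD i 0) ((c x).getD (i + 1) 0)
        ((c x).getD (i + 2) 0)) ?_)
  · have h1 : PT fun p : (α × ℕ) × ℕ => c p.1.1 := hc.comp (PT.fst.comp .fst)
    exact ((h1.getD (PT.snd.comp .fst) (.const 0)).beq (h1.getD .snd (.const 0))).not
  · have h1 : PT fun p : α × ℕ => c p.1 := hc.comp .fst
    exact .isMid (hS.comp .fst) (h1.getD .snd (.const 0)) (h1.getD (.succ .snd) (.const 0))
      (h1.getD (.succ (.succ .snd)) (.const 0))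

/-- The length `k` is fixed and not part of the input, so the number of lists is polynomial. -/
theorem PT.listsOver {L : α → List ℕ} (hL : PT L) (k : ℕ) : PT fun x => listsOver (L x) k := by
  induction k with
  | zero => exact .const [[]]
  | succ k ih =>
    exact PT.flatMap ih (g := fun x c => (L x).map fun y => y :: c)
      (PT.map (hL.comp .fst) (g := fun p y => y :: p.2) (.cons .snd (PT.snd.comp .fst)))

theorem PT.delete {S : α → GameState} {u w : α → ℕ} (hS : PT S) (hu : PT u) (hw : PT w) :
    PT fun x => delete (S x) (u x) (w x) :=
  (PT.filter (PT.fst.comp hS) (g := fun x y => !(y == u x || y == w x))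
    ((PT.snd.beq (hu.comp .fst)).or (PT.snd.beq (hw.comp .fst))).not).pair (PT.snd.comp hS)

theorem PT.contract {S : α → GameState} {c : α → List ℕ} (hS : PT S) (hc : PT c) :
    PT fun x => contract (S x) (c x) := by
  have h : ∀ i : ℕ, PT fun x => (c x).getD i 0 := fun i => hc.getD (.const i) (.const 0)
  exact (PT.fst.comp (PT.delete hS (h 7) (h 8))).pair
    ((PT.cons ((h 6).pair (h 9)) (PT.fst.comp (PT.snd.comp hS))).pair
      (PT.snd.comp (PT.snd.comp hS)))

theorem PT.leaves {S : α → GameState} (hS : PT S) : PT fun x => leaves (S x) :=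
  PT.filter (PT.fst.comp hS) (g := fun x u => (GameState.nbrList (S x) u).length == 1)
    ((PT.length (.nbrList (hS.comp .fst) .snd)).beq (.const 1))

theorem PT.threads {S : α → GameState} (hS : PT S) : PT fun x => threads (S x) :=
  PT.filter (PT.listsOver (PT.fst.comp hS) 16) (g := fun x c => GameState.isThreadB (S x) c)
    (.isThreadB (hS.comp .fst) .snd)

theorem PT.step {S : α → GameState} (hS : PT S) : PT fun x => step (S x) := by
  have h := (PT.leaves hS).headD (.const 0)
  exact .ite (PT.leaves hS).isEmpty
    (.ite (PT.threads hS).isEmpty hS (.contract hS ((PT.threads hS).headD (.const []))))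
    (.delete hS h ((PT.nbrList hS h).headD (.const 0)))

namespace GameState

theorem mem_listsOver {L : List ℕ} {k : ℕ} {c : List ℕ} :
    c ∈ listsOver L k ↔ c.length = k ∧ ∀ x ∈ c, x ∈ L := by
  induction k generalizing c with
  | zero =>
    simp only [listsOver, List.mem_singleton]
    constructor
    · rintro rfl; simp
    · rintro ⟨h, -⟩; exact List.eq_nil_of_length_eq_zero h
  | succ k ih =>
    simp only [listsOver, List.mem_flatMap, List.mem_map]
    constructor
    · rintro ⟨c', h1, x, hx, rfl⟩
      have := ih.1 h1
      simp [this.1, hx]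
      exact this.2
    · rintro ⟨h1, h2⟩
      rcases c with _ | ⟨x, c⟩
      · simp at h1
      · exact ⟨c, ih.2 ⟨by simpa using h1, fun y hy => h2 y (by simp [hy])⟩, x, h2 x (by simp), rfl⟩

theorem headD_threads_mem {S : GameState} (h : ¬ (threads S).isEmpty) :
    (threads S).headD [] ∈ threads S := by
  cases hl : threads S with
  | nil => simp [hl] at h
  | cons a l => simp

theorem step_sublist (S : GameState) : (step S).1.Sublist S.1 := by
  unfold step
  split_ifs
  · exact List.Sublist.refl _
  · exact List.filter_sublist
  · exact List.filter_sublist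

theorem step_claimed (S : GameState) : (step S).2.2 = S.2.2 := by
  unfold step
  split_ifs <;> rfl

/-- Edges at deleted vertices stay in the list, where they are harmless because adjacency is only
considered among the present vertices. The list grows only by contractions, each of which adds one
edge between two listed vertices. -/
theorem sz_step_edges_le (S : GameState) : sz (step S).2.1 ≤ sz S.2.1 + (2 * sz S.1 + 2) := by
  unfold step
  split_ifs with h1 h2
  · omega
  · have h := mem_listsOver.1 (List.mem_filter.1 (headD_threads_mem h2)).1
    have key : ∀ i, i < 16 → sz (((threads S).headD []).getD i 0) ≤ sz S.1 := by
      intro i hi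
      rw [List.getD_eq_getElem _ _ (by omega)]
      exact sz_le_of_mem (h.2 _ (List.getElem_mem _))
    have h6 := key 6 (by omega)
    have h9 := key 9 (by omega)
    simp only [contract, sz_cons, sz_pair]
    omega
  · exact Nat.le_add_right _ _

theorem sz_iterate_step_le (S : GameState) (i : ℕ) :
    (step^[i] S).1.Sublist S.1 ∧ (step^[i] S).2.2 = S.2.2 ∧
      sz (step^[i] S).2.1 ≤ sz S.2.1 + i * (2 * sz S.1 + 2) := by
  induction i with
  | zero => simp
  | succ i ih =>
    rw [Function.iterate_succ_apply']
    obtain ⟨h1, h2, h3⟩ := ih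
    refine ⟨(step_sublist _).trans h1, (step_claimed _).trans h2, ?_⟩
    have h4 := sz_step_edges_le (step^[i] S)
    have h5 := sz_le_of_sublist h1
    rw [Nat.add_mul]
    omega

end GameState

theorem PT.reduce {S : α → GameState} (hS : PT S) : PT fun x => reduce (S x) := by
  have hL : PT fun x => (S x).1 := PT.fst.comp hS
  refine PT.iterate (g := fun _ => GameState.step) (B := fun x => sz (S x) +
    (S x).1.length * (2 * sz (S x).1 + 2)) (PT.length hL) hS (.step .snd) ?_ fun x i hi => ?_
  · exact hS.pb.add ((hL.pb.mono fun x => length_le_sz _).mul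
      (((PB.const 2).mul hL.pb).add (.const 2)))
  · obtain ⟨h1, h2, h3⟩ := sz_iterate_step_le (S x) i
    have h4 := sz_le_of_sublist h1
    have h5 := Nat.mul_le_mul_right (2 * sz (S x).1 + 2) hi
    have h6 : sz (GameState.step^[i] (S x)) = sz (GameState.step^[i] (S x)).1 +
      (sz (GameState.step^[i] (S x)).2.1 + sz (GameState.step^[i] (S x)).2.2 + 1) + 1 := rfl
    have h7 : sz (S x) = sz (S x).1 + (sz (S x).2.1 + sz (S x).2.2 + 1) + 1 := rfl
    rw [h2] at h6
    omega

theorem PT.matrix {S : α → GameState} (hS : PT S) : PT fun x => matrix (S x) := by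
  have hV : PT fun x => (S x).2.2 :: (S x).1 :=
    .cons (PT.snd.comp (PT.snd.comp hS)) (PT.fst.comp hS)
  refine PT.map hV (g := fun x i => ((S x).2.2 :: (S x).1).map fun j => MBDom.adjB (S x).2.1 i j)
    (PT.map (hV.comp .fst) (g := fun p j => MBDom.adjB (S p.1).2.1 p.2 j) ?_)
  exact .adjB (PT.fst.comp (PT.snd.comp (hS.comp (PT.fst.comp .fst)))) (PT.snd.comp .fst) .snd

theorem PT.kernel {S : α → GameState} (hS : PT S) : PT fun x => kernel (S x) := by
  have hR := PT.reduce hS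
  exact .ite (PT.any (PT.fst.comp hR) (g := fun x u => (GameState.nbrList (S x).reduce u).isEmpty)
    (PT.isEmpty (.nbrList (hR.comp .fst) .snd))) (.const _) hR

end KernelPT


/-! ### Correctness of the reduction steps -/

/-- The graph with the given list of edges. -/
def listGraph (E : List (ℕ × ℕ)) : SimpleGraph ℕ where
  Adj i j := adjB E i j = true
  symm := ⟨fun i j h => by
    simp only [adjB, Bool.and_eq_true, Bool.not_eq_true', beq_eq_false_iff_ne, List.any_eq_true,
      Bool.or_eq_true, beq_iff_eq] at h ⊢
    obtain ⟨h1, e, he, h2⟩ := h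
    exact ⟨h1.symm, e, he, h2.symm⟩⟩
  loopless := ⟨fun i h => by simp [adjB] at h⟩

theorem listGraph_adj {E : List (ℕ × ℕ)} {i j : ℕ} :
    (listGraph E).Adj i j ↔ i ≠ j ∧ ((i, j) ∈ E ∨ (j, i) ∈ E) := by
  simp only [listGraph, adjB, Bool.and_eq_true, Bool.not_eq_true', beq_eq_false_iff_ne,
    List.any_eq_true, Bool.or_eq_true, beq_iff_eq, ne_eq, Prod.exists]
  constructor
  · rintro ⟨h1, a, b, he, ⟨rfl, rfl⟩ | ⟨rfl, rfl⟩⟩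
    · exact ⟨h1, Or.inl he⟩
    · exact ⟨h1, Or.inr he⟩
  · rintro ⟨h1, h | h⟩
    · exact ⟨h1, _, _, h, by simp⟩
    · exact ⟨h1, _, _, h, by simp⟩

namespace GameState

/-- The graph of a game. -/
def graph (S : GameState) : SimpleGraph ℕ := listGraph S.2.1

/-- The vertices of a game. -/
def verts (S : GameState) : Finset ℕ := (S.2.2 :: S.1).toFinset

/-- The vertices are listed without repetition. -/
def Valid (S : GameState) : Prop := (S.2.2 :: S.1).Nodup

/-- Dominator wins. -/
def Wins (S : GameState) : Prop := Win S.graph S.verts S.2.2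

/-- The feedback edge number is at most `k`. -/
def Feedback (S : GameState) (k : ℕ) : Prop := FeedbackLE S.graph S.verts k

variable {S : GameState}

theorem mem_verts {x : ℕ} : x ∈ S.verts ↔ x = S.2.2 ∨ x ∈ S.1 := by
  simp [verts]

theorem mem_nbrList {u y : ℕ} : y ∈ nbrList S u ↔ y ∈ S.verts ∧ S.graph.Adj u y := by
  simp only [nbrList, List.mem_filter, verts, List.mem_toFinset]
  rfl

theorem cnbr_eq {u : ℕ} (hu : u ∈ S.verts) :
    cnbr S.graph S.verts u = insert u (nbrList S u).toFinset := by
  rw [cnbr_eq_insert hu]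
  congr 1
  ext y
  rw [mem_nbrs, List.mem_toFinset, mem_nbrList]

theorem card_nbrs (hS : S.Valid) (u : ℕ) :
    (nbrs S.graph S.verts u).card = (nbrList S u).length := by
  rw [← List.toFinset_card_of_nodup (l := nbrList S u) (List.Nodup.filter _ hS)]
  congr 1
  ext y
  rw [mem_nbrs, List.mem_toFinset, mem_nbrList]

theorem isMid_iff {x y z : ℕ} (hx : x ∈ S.verts) (hy : y ∈ S.verts) (hz : z ∈ S.verts)
    (hxy : x ≠ y) (hyz : y ≠ z) : isMid S x y z ↔ cnbr S.graph S.verts y = {x, y, z} := by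
  simp only [isMid, Bool.and_eq_true, List.all_eq_true, Bool.or_eq_true, beq_iff_eq]
  rw [cnbr_eq hy]
  constructor
  · rintro ⟨h1, h2, h3⟩
    ext t
    simp only [Finset.mem_insert, List.mem_toFinset, Finset.mem_singleton]
    constructor
    · rintro (rfl | h)
      · simp
      · have := h1 t h; tauto
    · rintro (rfl | rfl | rfl)
      · exact Or.inr (mem_nbrList.2 ⟨hx, h2⟩)
      · exact Or.inl rfl
      · exact Or.inr (mem_nbrList.2 ⟨hz, h3⟩)
  · intro h
    have h' : ∀ t, t = y ∨ t ∈ nbrList S y ↔ t = x ∨ t = y ∨ t = z := fun t => by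
      have := congrArg (t ∈ ·) h
      simpa using this
    refine ⟨fun t ht => ?_, ?_, ?_⟩
    · have h1 := (h' t).1 (Or.inr ht)
      have h2 : t ≠ y := (mem_nbrList.1 ht).2.ne'
      tauto
    · exact (mem_nbrList.1 (((h' x).2 (Or.inl rfl)).resolve_left hxy)).2
    · exact (mem_nbrList.1 (((h' z).2 (Or.inr (Or.inr rfl))).resolve_left hyz.symm)).2

theorem nodup_iff_getD {c : List ℕ} :
    c.Nodup ↔ ∀ i < c.length, ∀ j < i, c.getD i 0 ≠ c.getD j 0 := by
  rw [List.nodup_iff_injective_get]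
  constructor
  · intro h i hi j hj hij
    rw [List.getD_eq_getElem _ _ hi, List.getD_eq_getElem _ _ (hj.trans hi)] at hij
    have := @h ⟨i, hi⟩ ⟨j, hj.trans hi⟩ hij
    simp at this
    omega
  · intro h i j hij
    rcases lt_trichotomy i.1 j.1 with h1 | h1 | h1
    · refine absurd ?_ (h j j.2 i h1)
      rw [List.getD_eq_getElem _ _ j.2, List.getD_eq_getElem _ _ i.2]
      exact hij.symm
    · exact Fin.ext h1
    · refine absurd ?_ (h i i.2 j h1)
      rw [List.getD_eq_getElem _ _ j.2, List.getD_eq_getElem _ _ i.2]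
      exact hij

theorem isThreadB_iff {c : List ℕ} (hc : ∀ x ∈ c, x ∈ S.verts) :
    isThreadB S c ↔ c.Nodup ∧ IsThread S.graph S.verts c := by
  unfold isThreadB
  rw [Bool.and_eq_true]
  simp only [List.all_eq_true, List.mem_range, Bool.not_eq_true', beq_eq_false_iff_ne]
  rw [← nodup_iff_getD]
  refine and_congr_right fun hnd => ?_
  have key : ∀ i, i + 2 < c.length → c = c.take i ++ c.getD i 0 :: c.getD (i + 1) 0 ::
      c.getD (i + 2) 0 :: c.drop (i + 3) := by
    intro i hi
    rw [List.getD_eq_getElem _ _ (by omega), List.getD_eq_getElem _ _ (by omega),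
      List.getD_eq_getElem _ _ (by omega)]
    conv_lhs => rw [← List.take_append_drop i c]
    rw [List.drop_eq_getElem_cons (by omega), List.drop_eq_getElem_cons (by omega),
      List.drop_eq_getElem_cons (by omega)]
  have hmid : ∀ P x y z Q, c = P ++ x :: y :: z :: Q →
      (isMid S x y z ↔ cnbr S.graph S.verts y = {x, y, z}) := by
    intro P x y z Q h
    rw [h] at hnd
    have h2 := (List.nodup_append.1 hnd).2.1
    simp only [List.nodup_cons, List.mem_cons, not_or] at h2
    exact isMid_iff (hc x (by simp [h])) (hc y (by simp [h])) (hc z (by simp [h])) h2.1.1 h2.2.1.1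
  constructor
  · intro h P x y z Q hL
    rw [← hmid P x y z Q hL]
    have := h P.length (by rw [hL]; simp; omega)
    rw [hL] at this
    simpa [List.getD_eq_getElem?_getD, List.getElem?_append_right] using this
  · intro h i hi
    have h1 := key i (by omega)
    exact (hmid _ _ _ _ _ h1).2 (h _ _ _ _ _ h1)

theorem Valid.notMem (hS : S.Valid) : S.2.2 ∉ S.1 := (List.nodup_cons.1 hS).1

theorem Valid.of_sublist {S' : GameState} (hS : S.Valid) (h1 : S'.1.Sublist S.1)
    (h2 : S'.2.2 = S.2.2) : S'.Valid := by
  unfold Valid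
  rw [h2]
  exact List.Nodup.sublist (h1.cons_cons _) hS

/-- What a reduction step does. -/
structure StepSpec (S S' : GameState) : Prop where
  valid : S'.Valid
  wins : S'.Wins ↔ S.Wins
  feedback : ∀ k, S.Feedback k → S'.Feedback k

theorem StepSpec.rfl (hS : S.Valid) : StepSpec S S := ⟨hS, Iff.rfl, fun _ h => h⟩

theorem StepSpec.trans {S' S'' : GameState} (h : StepSpec S S') (h' : StepSpec S' S'') :
    StepSpec S S'' :=
  ⟨h'.valid, h'.wins.trans h.wins, fun k hk => h'.feedback k (h.feedback k hk)⟩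

theorem length_filter_lt {L : List ℕ} {u w : ℕ} (hu : u ∈ L) :
    (L.filter fun y => !(y == u || y == w)).length < L.length :=
  List.length_filter_lt_length_iff_exists.2 ⟨u, hu, by simp⟩

/-- One operation covers both leaf rules. Dominator's vertex is not in the list of free vertices, so
if it is the neighbour of the leaf, only the leaf disappears. -/
theorem delete_spec (hS : S.Valid) {u : ℕ} (hu : u ∈ leaves S) :
    StepSpec S (delete S u ((nbrList S u).headD 0)) ∧
      (delete S u ((nbrList S u).headD 0)).1.length < S.1.length := by
  simp only [leaves, List.mem_filter, beq_iff_eq] at hu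
  obtain ⟨huL, hlen⟩ := hu
  obtain ⟨w, hw⟩ := List.length_eq_one_iff.1 hlen
  have huv : u ∈ S.verts := mem_verts.2 (Or.inr huL)
  have hne : u ≠ S.2.2 := fun h => hS.notMem (h ▸ huL)
  have hwm : w ∈ S.verts ∧ S.graph.Adj u w := mem_nbrList.1 (by rw [hw]; simp)
  have hN : cnbr S.graph S.verts u = {u, w} := by
    rw [cnbr_eq huv, hw]; rfl
  rw [hw]
  refine ⟨?_, length_filter_lt huL⟩
  have hval : (delete S u w).Valid := hS.of_sublist List.filter_sublist rfl
  show StepSpec S (delete S u w)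
  have hvs : ∀ x, x ∈ (delete S u w).verts ↔ x = S.2.2 ∨ x ∈ S.1 ∧ x ≠ u ∧ x ≠ w := by
    intro x
    rw [mem_verts]
    simp [delete]
  refine ⟨hval, ?_, fun k hk => FeedbackLE.mono hk fun x hx => ?_⟩
  · show Win S.graph (delete S u w).verts S.2.2 ↔ Win S.graph S.verts S.2.2
    by_cases hwv : w = S.2.2
    · rw [Win.leaf_claimed huv (mem_verts.2 (Or.inl rfl)) hne (hwv ▸ hN)]
      have : (delete S u w).verts = S.verts \ {u} := by
        ext x
        rw [hvs, Finset.mem_sdiff, mem_verts, Finset.mem_singleton]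
        have := hS.notMem
        constructor
        · rintro (rfl | h)
          · exact ⟨Or.inl rfl, hne.symm⟩
          · tauto
        · rintro ⟨h | h, h2⟩
          · exact Or.inl h
          · exact Or.inr ⟨h, h2, fun h3 => this (hwv ▸ h3 ▸ h)⟩
      rw [this]
    · rw [Win.leaf huv hwm.1 hwm.2.ne hne hwv hN]
      have : (delete S u w).verts = S.verts \ {u, w} := by
        ext x
        rw [hvs, Finset.mem_sdiff, mem_verts, Finset.mem_insert, Finset.mem_singleton]
        constructor
        · rintro (rfl | h)
          · exact ⟨Or.inl rfl, fun h => h.elim (fun h => hne h.symm) fun h => hwv h.symm⟩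
          · tauto
        · tauto
      rw [this]
  · rw [hvs] at hx
    exact mem_verts.2 (hx.imp_right And.left)

theorem contract_spec (hS : S.Valid) {c : List ℕ} (hc : c ∈ threads S) :
    StepSpec S (contract S c) ∧ (contract S c).1.length < S.1.length := by
  obtain ⟨h1, h2⟩ := List.mem_filter.1 hc
  obtain ⟨hlen, hmem⟩ := mem_listsOver.1 h1
  have hmem' : ∀ x ∈ c, x ∈ S.verts := fun x hx => mem_verts.2 (Or.inr (hmem x hx))
  obtain ⟨hnd, hth⟩ := (isThreadB_iff hmem').1 h2
  -- `16 = 1 + 5 + 4 + 5 + 1`: the parts of a `Contraction`, with `p`, `u`, `w`, `q` at the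
  -- positions `6` to `9`.
  obtain ⟨a, A, p, u, w, q, B, b, rfl, hA, hB⟩ : ∃ a A p u w q B b,
      c = a :: A ++ [p, u, w, q] ++ (B ++ [b]) ∧ A.length = 5 ∧ B.length = 5 := by
    rcases c with _ | ⟨c0, _ | ⟨c1, _ | ⟨c2, _ | ⟨c3, _ | ⟨c4, _ | ⟨c5, _ | ⟨c6, _ | ⟨c7, _ | ⟨c8, _ |
      ⟨c9, _ | ⟨c10, _ | ⟨c11, _ | ⟨c12, _ | ⟨c13, _ | ⟨c14, _ | ⟨c15, _ | ⟨c16, c⟩⟩⟩⟩⟩⟩⟩⟩⟩⟩⟩⟩⟩⟩⟩⟩⟩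
    case cons.cons.cons.cons.cons.cons.cons.cons.cons.cons.cons.cons.cons.cons.cons.cons.nil =>
      exact ⟨c0, [c1, c2, c3, c4, c5], c6, c7, c8, c9, [c10, c11, c12, c13, c14], c15, rfl, rfl, rfl⟩
    all_goals simp at hlen
  have hget : ∀ i, (a :: A ++ [p, u, w, q] ++ (B ++ [b])).getD (i + 6) 0 =
      ([p, u, w, q] ++ (B ++ [b])).getD i 0 := by
    intro i
    rw [List.append_assoc, List.getD_append_right _ _ _ _ (by simp [hA])]
    simp [hA]
  have hcon : contract S (a :: A ++ [p, u, w, q] ++ (B ++ [b])) =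
      ((delete S u w).1, (p, q) :: S.2.1, S.2.2) := by
    unfold contract
    rw [hget 0, hget 1, hget 2, hget 3]
    rfl
  rw [hcon]
  have huL : u ∈ S.1 := hmem u (by simp)
  have hwL : w ∈ S.1 := hmem w (by simp)
  refine ⟨?_, length_filter_lt huL⟩
  have hval : GameState.Valid ((delete S u w).1, (p, q) :: S.2.1, S.2.2) :=
    hS.of_sublist List.filter_sublist rfl
  have hpq : p ≠ q := by
    have := (List.nodup_append.1 (List.nodup_append.1 hnd).1).2.1
    simp only [List.nodup_cons, List.mem_cons, not_or] at this
    exact this.1.2.2.1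
  have hvs : verts ((delete S u w).1, (p, q) :: S.2.1, S.2.2) = S.verts \ {u, w} := by
    ext x
    rw [Finset.mem_sdiff, mem_verts, mem_verts, Finset.mem_insert, Finset.mem_singleton]
    have hv := hS.notMem
    simp only [delete, List.mem_filter, Bool.not_eq_true', Bool.or_eq_false_iff,
      beq_eq_false_iff_ne]
    constructor
    · rintro (rfl | h)
      · exact ⟨Or.inl rfl, fun h => h.elim (fun h => hv (h ▸ huL)) fun h => hv (h ▸ hwL)⟩
      · exact ⟨Or.inr h.1, not_or.2 h.2⟩
    · rintro ⟨h | h, h2⟩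
      · exact Or.inl h
      · exact Or.inr ⟨h, not_or.1 h2⟩
  have hC : Contraction S.graph (listGraph ((p, q) :: S.2.1)) S.verts S.2.2 a A p u w q B b := by
    refine ⟨hnd, hth, fun x hx => ⟨hmem' x hx, fun h => hS.notMem (h ▸ hmem x hx)⟩, ?_⟩
    intro x _ y _
    unfold graph
    rw [listGraph_adj, listGraph_adj]
    simp only [List.mem_cons, Prod.mk.injEq]
    constructor
    · rintro ⟨h1, (h2 | h2) | (h2 | h2)⟩
      · exact Or.inr (Or.inl h2)
      · exact Or.inl ⟨h1, Or.inl h2⟩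
      · exact Or.inr (Or.inr ⟨h2.2, h2.1⟩)
      · exact Or.inl ⟨h1, Or.inr h2⟩
    · rintro (⟨h1, h2 | h2⟩ | ⟨rfl, rfl⟩ | ⟨rfl, rfl⟩)
      · exact ⟨h1, Or.inl (Or.inr h2)⟩
      · exact ⟨h1, Or.inr (Or.inr h2)⟩
      · exact ⟨hpq, Or.inl (Or.inl ⟨rfl, rfl⟩)⟩
      · exact ⟨hpq.symm, Or.inr (Or.inl ⟨rfl, rfl⟩)⟩
  refine ⟨hval, ?_, fun k hk => ?_⟩
  · unfold Wins
    rw [hC.win_iff hA.ge hB.ge, hvs]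
    rfl
  · unfold Feedback
    rw [hvs]
    exact hC.feedbackLE hk

theorem step_spec (hS : S.Valid) : StepSpec S (step S) ∧
    ((step S).1.length < S.1.length ∨ (leaves S = [] ∧ threads S = [])) := by
  unfold step
  split_ifs with h1 h2
  · exact ⟨.rfl hS, Or.inr ⟨by simpa using h1, by simpa using h2⟩⟩
  · obtain ⟨h3, h4⟩ := contract_spec hS (headD_threads_mem h2)
    exact ⟨h3, Or.inl h4⟩
  · have : (leaves S).headD 0 ∈ leaves S := by
      cases hl : leaves S with
      | nil => simp [hl] at h1
      | cons a l => simp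
    obtain ⟨h3, h4⟩ := delete_spec hS this
    exact ⟨h3, Or.inl h4⟩

theorem step_eq_self (h1 : leaves S = []) (h2 : threads S = []) : step S = S := by
  simp [step, h1, h2]

/-- A step either uses up a free vertex or is at a fixed point without leaves and threads, so as
many steps as there are free vertices suffice. -/
theorem iterate_step_spec (n : ℕ) : ∀ {S : GameState}, S.Valid → S.1.length ≤ n →
    StepSpec S (step^[n] S) ∧ leaves (step^[n] S) = [] ∧ threads (step^[n] S) = [] := by
  induction n with
  | zero =>
    intro S hS hn
    have : S.1 = [] := List.eq_nil_of_length_eq_zero (Nat.le_zero.1 hn)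
    exact ⟨.rfl hS, by simp [leaves, this], by simp [threads, this, listsOver]⟩
  | succ n ih =>
    intro S hS hn
    obtain ⟨h1, h2⟩ := step_spec hS
    rw [Function.iterate_succ_apply]
    rcases h2 with h2 | ⟨h2, h3⟩
    · obtain ⟨h3, h4⟩ := ih h1.valid (by omega)
      exact ⟨h1.trans h3, h4⟩
    · rw [step_eq_self h2 h3, Function.iterate_fixed (step_eq_self h2 h3)]
      exact ⟨.rfl hS, h2, h3⟩

theorem reduce_spec (hS : S.Valid) : StepSpec S (reduce S) ∧ leaves (reduce S) = [] ∧
    threads (reduce S) = [] := iterate_step_spec _ hS le_rfl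

theorem card_le_of_irreducible {k : ℕ} (hS : S.Valid) (hk : S.Feedback k) (hl : leaves S = [])
    (ht : threads S = []) (hi : ∀ u ∈ S.1, nbrList S u ≠ []) :
    S.verts.card ≤ 154 * k + 123 ∧ ∑ x ∈ S.verts, (nbrs S.graph S.verts x).card ≤ 310 * k + 246 := by
  have hmem : ∀ x ∈ S.verts, x ≠ S.2.2 → x ∈ S.1 := fun x hx hxv =>
    (mem_verts.1 hx).resolve_left hxv
  refine card_le_of_reduced (v := S.2.2) (mem_verts.2 (Or.inl rfl)) (fun x hx hxv => ?_)
    (fun l hlen hnd hl hth => ?_) hk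
  · rw [card_nbrs hS]
    have h1 := hi x (hmem x hx hxv)
    have h2 : x ∉ leaves S := by rw [hl]; simp
    simp only [leaves, List.mem_filter, hmem x hx hxv, true_and, beq_iff_eq] at h2
    have h3 := List.length_pos_iff.2 h1
    omega
  · have : l ∈ threads S := List.mem_filter.2
      ⟨mem_listsOver.2 ⟨hlen, fun x hx => hmem x (hl x hx).1 (hl x hx).2⟩,
        (isThreadB_iff fun x hx => (hl x hx).1).2 ⟨hnd, hth⟩⟩
    rw [ht] at this
    simp at this

theorem not_wins_of_isolated (hS : S.Valid) {u : ℕ} (hu : u ∈ S.1) (hN : nbrList S u = []) :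
    ¬ S.Wins := by
  have huv : u ∈ S.verts := mem_verts.2 (Or.inr hu)
  refine not_win_of_isolated huv (fun h => hS.notMem (h ▸ hu)) ?_
  rw [cnbr_eq huv, hN]
  rfl

end GameState


/-! ### Translation between adjacency matrices and games -/

open DEnc (enc)

namespace FinGraph

open Classical in
/-- The rows of the adjacency matrix. -/
noncomputable def rows (G : FinGraph) : List (List Bool) :=
  List.ofFn fun i : Fin G.n => List.ofFn fun j : Fin G.n => decide (G.graph.Adj i j)

theorem encode_eq (G : FinGraph) : G.encode = enc G.rows := by
  have h : ∀ {n : ℕ} {α : Type} [DEnc α] (f : Fin n → α),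
      enc (List.ofFn f) = Data.ofList (List.ofFn fun i => enc (f i)) := by
    intro n α _ f
    show Data.ofList ((List.ofFn f).map enc) = _
    rw [List.map_ofFn]
    rfl
  unfold rows
  rw [h]
  simp_rw [h]
  rfl

end FinGraph

theorem StartedInstance.encode_eq (x : StartedInstance) : x.encode = enc (x.G.rows, x.v.val) := by
  show Data.cons _ _ = Data.cons _ _
  rw [x.G.encode_eq]
  rfl

/-- The edges of the graph with a given adjacency matrix. -/
def matrixEdges (M : List (List Bool)) : List (ℕ × ℕ) :=
  (List.range M.length).flatMap fun i =>
    ((List.range M.length).filter fun j => (M.getD i []).getD j false).map fun j => (i, j)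

theorem PT.matrixEdges {α : Type} [DEnc α] {M : α → List (List Bool)} (hM : PT M) :
    PT fun x => matrixEdges (M x) := by
  have hR : PT fun x => List.range (M x).length := .range (.length hM)
  refine PT.flatMap hR (g := fun x i => ((List.range (M x).length).filter fun j =>
    ((M x).getD i []).getD j false).map fun j => (i, j)) ?_
  refine PT.map (L := fun p : α × ℕ => (List.range (M p.1).length).filter fun j =>
    ((M p.1).getD p.2 []).getD j false) (g := fun p j => (p.2, j)) ?_ ((PT.snd.comp .fst).pair .snd)
  exact PT.filter (hR.comp .fst) (g := fun p j => ((M p.1).getD p.2 []).getD j false)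
    (((hM.comp (PT.fst.comp .fst)).getD (PT.snd.comp .fst) (.const [])).getD .snd (.const false))

theorem FinGraph.length_rows (G : FinGraph) : G.rows.length = G.n := by
  simp [FinGraph.rows]

theorem FinGraph.listGraph_adj (G : FinGraph) {i j : ℕ} :
    (listGraph (matrixEdges G.rows)).Adj i j ↔
      ∃ (hi : i < G.n) (hj : j < G.n), G.graph.Adj ⟨i, hi⟩ ⟨j, hj⟩ := by
  have hmem : ∀ i j, (i, j) ∈ matrixEdges G.rows ↔
      ∃ (hi : i < G.n) (hj : j < G.n), G.graph.Adj ⟨i, hi⟩ ⟨j, hj⟩ := by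
    intro i j
    simp only [matrixEdges, List.mem_flatMap, List.mem_map, List.mem_filter, List.mem_range,
      G.length_rows, Prod.mk.injEq]
    have hget : ∀ (hi : i < G.n) (hj : j < G.n), (G.rows.getD i []).getD j false = true ↔
        G.graph.Adj ⟨i, hi⟩ ⟨j, hj⟩ := by
      intro hi hj
      classical
      have h1 : G.rows.getD i [] = List.ofFn fun j : Fin G.n => decide (G.graph.Adj ⟨i, hi⟩ j) := by
        rw [List.getD_eq_getElem G.rows [] (by rw [G.length_rows]; exact hi)]
        simp only [FinGraph.rows, List.getElem_ofFn]
      rw [h1, List.getD_eq_getElem _ _ (by rw [List.length_ofFn]; exact hj)]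
      simp
    constructor
    · rintro ⟨a, ha, b, ⟨hb, h⟩, rfl, rfl⟩
      exact ⟨ha, hb, (hget ha hb).1 h⟩
    · rintro ⟨hi, hj, h⟩
      exact ⟨i, hi, j, ⟨hj, (hget hi hj).2 h⟩, rfl, rfl⟩
  rw [MBDom.listGraph_adj, hmem, hmem]
  constructor
  · rintro ⟨-, h | ⟨hj, hi, h⟩⟩
    · exact h
    · exact ⟨hi, hj, h.symm⟩
  · rintro ⟨hi, hj, h⟩
    exact ⟨fun hij => h.ne (Fin.ext hij), Or.inl ⟨hi, hj, h⟩⟩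

namespace GameState

/-- The game on the graph with a given adjacency matrix, after Dominator has claimed `v`. -/
def ofMatrix (M : List (List Bool)) (v : ℕ) : GameState :=
  ((List.range M.length).filter fun u => !(u == v), matrixEdges M, v)

end GameState

theorem PT.ofMatrix {α : Type} [DEnc α] {M : α → List (List Bool)} {v : α → ℕ} (hM : PT M)
    (hv : PT v) : PT fun x => GameState.ofMatrix (M x) (v x) :=
  (PT.filter (PT.range (.length hM)) (g := fun x u => !(u == v x))
    (PT.snd.beq (hv.comp .fst)).not).pair ((PT.matrixEdges hM).pair hv)

namespace GameState

/-- The game `S` is played on a copy of the graph `G`. -/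
structure Copy {n : ℕ} (G : SimpleGraph (Fin n)) (v : Fin n) (S : GameState) (f : Fin n → ℕ) :
    Prop where
  inj : Function.Injective f
  image : Finset.univ.image f = S.verts
  claimed : f v = S.2.2
  adj : ∀ i j, G.Adj i j ↔ S.graph.Adj (f i) (f j)

variable {n : ℕ} {G : SimpleGraph (Fin n)} {v : Fin n} {S : GameState} {f : Fin n → ℕ}

theorem Copy.wins_iff (h : Copy G v S f) :
    DominatorWins G Player.staller {v} ∅ ↔ S.Wins := by
  rw [dominatorWins_singleton_iff, Wins, ← h.image, ← h.claimed]
  exact Win.iff_of_iso (Finset.mem_univ v) h.inj.injOn fun x _ y _ => h.adj x y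

theorem Copy.feedback_iff (h : Copy G v S f) {k : ℕ} :
    feedbackEdgeNumber G ≤ k ↔ S.Feedback k := by
  rw [feedbackEdgeNumber_le_iff, Feedback, ← h.image]
  constructor
  · intro hk
    have : Nonempty (Fin n) := ⟨v⟩
    have hinv : ∀ i, Function.invFun f (f i) = i := Function.leftInverse_invFun h.inj
    refine hk.map (Function.invFun f) ?_ (fun _ _ => Finset.mem_univ _) ?_
    · intro x hx y hy hxy
      obtain ⟨i, -, rfl⟩ := Finset.mem_image.1 (Finset.mem_coe.1 hx)
      obtain ⟨j, -, rfl⟩ := Finset.mem_image.1 (Finset.mem_coe.1 hy)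
      rw [hinv, hinv] at hxy
      rw [hxy]
    · intro x hx y hy hxy
      obtain ⟨i, -, rfl⟩ := Finset.mem_image.1 hx
      obtain ⟨j, -, rfl⟩ := Finset.mem_image.1 hy
      rw [hinv, hinv]
      exact (h.adj i j).2 hxy
  · intro hk
    exact hk.map f h.inj.injOn (fun i _ => Finset.mem_image_of_mem f (Finset.mem_univ i))
      fun i _ j _ hij => (h.adj i j).1 hij

/-- The degree sum counts every edge twice; the factor two is given away. -/
theorem Copy.ncard_edgeSet_le (h : Copy G v S f) :
    G.edgeSet.ncard ≤ ∑ x ∈ S.verts, (nbrs S.graph S.verts x).card := by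
  classical
  have h1 := G.sum_degrees_eq_twice_card_edges
  have h2 : ∑ i, G.degree i ≤ ∑ x ∈ S.verts, (nbrs S.graph S.verts x).card := by
    rw [← h.image, Finset.sum_image h.inj.injOn]
    refine Finset.sum_le_sum fun i _ => ?_
    rw [← G.card_neighborFinset_eq_degree, ← Finset.card_image_of_injective _ h.inj]
    refine Finset.card_le_card fun y hy => ?_
    obtain ⟨j, hj, rfl⟩ := Finset.mem_image.1 hy
    rw [SimpleGraph.mem_neighborFinset] at hj
    exact mem_nbrs.2 ⟨Finset.mem_image_of_mem f (Finset.mem_univ j), (h.adj i j).1 hj⟩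
  rw [Set.ncard_eq_toFinset_card']
  have h3 : G.edgeSet.toFinset = G.edgeFinset := rfl
  rw [h3]
  omega

theorem Copy.card_eq (h : Copy G v S f) : n = S.verts.card := by
  rw [← h.image, Finset.card_image_of_injective _ h.inj, Finset.card_univ, Fintype.card_fin]

theorem ofMatrix_valid (M : List (List Bool)) (v : ℕ) : (ofMatrix M v).Valid := by
  refine List.nodup_cons.2 ⟨?_, List.Nodup.filter _ List.nodup_range⟩
  simp [ofMatrix]

theorem copy_ofMatrix (G : FinGraph) (v : Fin G.n) :
    Copy G.graph v (ofMatrix G.rows v) (Fin.val : Fin G.n → ℕ) := by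
  refine ⟨Fin.val_injective, ?_, rfl, fun i j => ?_⟩
  · ext x
    simp only [Finset.mem_image, Finset.mem_univ, true_and, mem_verts, ofMatrix, List.mem_filter,
      List.mem_range, G.length_rows, Bool.not_eq_true', beq_eq_false_iff_ne]
    constructor
    · rintro ⟨i, rfl⟩
      have := i.2
      by_cases h : i.val = v.val
      · exact Or.inl h
      · exact Or.inr ⟨this, h⟩
    · rintro (rfl | h)
      · exact ⟨v, rfl⟩
      · exact ⟨⟨x, h.1⟩, rfl⟩
  · show _ ↔ (listGraph (matrixEdges G.rows)).Adj i j
    rw [G.listGraph_adj]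
    exact ⟨fun h => ⟨i.2, j.2, h⟩, fun ⟨_, _, h⟩ => h⟩

/-- The graph of a game, with vertices `0, …, n - 1`. -/
def toFin (S : GameState) : FinGraph :=
  ⟨(S.2.2 :: S.1).length, S.graph.comap fun i => (S.2.2 :: S.1).get i⟩

/-- Dominator's vertex. -/
def claimedFin (S : GameState) : Fin S.toFin.n := ⟨0, Nat.succ_pos _⟩

theorem copy_toFin (hS : S.Valid) :
    Copy S.toFin.graph S.claimedFin S fun i => (S.2.2 :: S.1).get i := by
  refine ⟨List.nodup_iff_injective_get.1 hS, ?_, rfl, fun i j => Iff.rfl⟩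
  ext x
  simp only [Finset.mem_image, Finset.mem_univ, true_and, verts, List.mem_toFinset]
  exact List.mem_iff_get.symm

theorem rows_toFin (S : GameState) : S.toFin.rows = matrix S := by
  have h : ∀ {β : Type} (l : List ℕ) (g : ℕ → β), List.ofFn (fun i => g (l.get i)) = l.map g := by
    intro β l g
    conv_rhs => rw [← List.ofFn_get l, List.map_ofFn]
    rfl
  unfold FinGraph.rows matrix
  rw [← h]
  congr 1
  funext i
  rw [← h]
  congr 1
  funext j
  classical
  rw [Bool.eq_iff_iff]
  exact decide_eq_true_iff

theorem lost_valid : lost.Valid := by simp [lost, Valid]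

theorem not_lost_wins : ¬ lost.Wins :=
  not_wins_of_isolated lost_valid (u := 1) (by simp [lost]) (by decide)

theorem feedback_of_nil {S : GameState} (h : S.2.1 = []) (k : ℕ) : S.Feedback k := by
  refine ⟨∅, by simp, ?_⟩
  have : (res S.graph S.verts).deleteEdges ((∅ : Finset (Sym2 ℕ)) : Set (Sym2 ℕ)) = ⊥ := by
    ext x y
    simp only [Finset.coe_empty, SimpleGraph.deleteEdges_empty, SimpleGraph.bot_adj, iff_false]
    rintro ⟨-, -, hxy⟩
    exact absurd (listGraph_adj.1 hxy).2 (by simp [h])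
  rw [this]
  exact SimpleGraph.isAcyclic_bot

/-- What the kernel of a game is. -/
structure KernelSpec (S S' : GameState) : Prop where
  valid : S'.Valid
  wins : S'.Wins ↔ S.Wins
  feedback : ∀ k, S.Feedback k → S'.Feedback k
  size_le : ∀ k, S.Feedback k → S'.toFin.size ≤ 464 * k + 369

theorem kernel_spec (hS : S.Valid) : KernelSpec S (kernel S) := by
  obtain ⟨h1, h2, h3⟩ := reduce_spec hS
  by_cases hi : (reduce S).1.any fun u => (nbrList (reduce S) u).isEmpty
  · obtain ⟨u, hu, hN⟩ := List.any_eq_true.1 hi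
    rw [kernel, if_pos hi]
    refine ⟨lost_valid, ?_, fun k _ => feedback_of_nil rfl k, fun k _ => ?_⟩
    · rw [← h1.wins]
      exact iff_of_false not_lost_wins
        (not_wins_of_isolated h1.valid hu (List.isEmpty_iff.1 hN))
    · have h4 := (copy_toFin lost_valid).ncard_edgeSet_le
      have h5 : ∑ x ∈ lost.verts, (nbrs lost.graph lost.verts x).card = 0 := by
        refine Finset.sum_eq_zero fun x hx => ?_
        rw [card_nbrs lost_valid]
        have : x = 0 ∨ x = 1 := by simpa [lost, mem_verts] using hx
        rcases this with rfl | rfl <;> decide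
      have h6 : lost.toFin.n = 2 := rfl
      unfold FinGraph.size
      omega
  · rw [kernel, if_neg hi]
    refine ⟨h1.valid, h1.wins, h1.feedback, fun k hk => ?_⟩
    have h4 := (copy_toFin h1.valid).ncard_edgeSet_le
    have h5 := (copy_toFin h1.valid).card_eq
    -- `464 * k + 369` is the sum of the bounds for the vertices and for the degrees.
    have h6 := card_le_of_irreducible h1.valid (h1.feedback k hk) h2 h3 fun u hu hN =>
      hi (List.any_eq_true.2 ⟨u, hu, by rw [hN]; rfl⟩)
    unfold FinGraph.size
    omega

end GameState

theorem PB.exists_polynomial {α : Type} [DEnc α] {b : α → ℕ} (hb : PB b) :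
    ∃ p : Polynomial ℕ, ∀ x, b x ≤ p.eval (enc x).size := by
  obtain ⟨d, hd⟩ := hb
  exact ⟨(Polynomial.X + 2) ^ d, fun x => by simpa [sz] using hd x⟩

open GameState in
theorem hasLinearKernel : HasLinearKernel StartedInstance.encode StartedInstance.DominatorWins
    StartedInstance.fen StartedInstance.size := by
  -- The matrix of a game lists Dominator's vertex first, so in the kernel this vertex always has
  -- the number `0`.
  have hPT : PT fun p : List (List Bool) × ℕ => (matrix (kernel (ofMatrix p.1 p.2)), 0) :=
    (PT.matrix (.kernel (.ofMatrix .fst .snd))).pair (.const 0)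
  obtain ⟨c, b, hb, hc⟩ := hPT
  obtain ⟨p, hp⟩ := hb.exists_polynomial
  refine ⟨c, p, 464, 369, fun x => ?_⟩
  have hcopy := copy_ofMatrix x.G x.v
  have hK := kernel_spec (ofMatrix_valid x.G.rows x.v)
  set S := kernel (ofMatrix x.G.rows x.v) with hSdef
  have hk := hcopy.feedback_iff.1 le_rfl
  obtain ⟨t, ht, hrun⟩ := hc (x.G.rows, x.v.val)
  refine ⟨⟨S.toFin, S.claimedFin⟩, t, ?_, ?_, ?_, ?_, hK.size_le _ hk⟩
  · rw [StartedInstance.encode_eq, StartedInstance.encode_eq, rows_toFin]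
    exact hrun
  · rw [StartedInstance.encode_eq]
    exact ht.trans (hp _)
  · exact ((copy_toFin hK.valid).wins_iff.trans hK.wins).trans hcopy.wins_iff.symm
  · exact (copy_toFin hK.valid).feedback_iff.2 (hK.feedback _ hk)


open DEnc (enc)

/-! ### Solving small games -/

namespace GameState

/-- The list, if it has at most `Z` elements. -/
def cap {α : Type} (Z : ℕ) (l : List α) : List α := if decide (l.length ≤ Z) then l else []

/-- The sublists of a list, if there are at most `Z`. -/
def sublistsB (Z : ℕ) (L : List ℕ) : List (List ℕ) :=
  L.reverse.foldl (fun acc a => cap Z (acc ++ acc.map fun l => a :: l)) [[]]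

/-- Every vertex has a neighbour in `D` or is adjacent or equal to Dominator's first vertex. -/
def isDominated (S : GameState) (D : List ℕ) : Bool :=
  (S.2.2 :: S.1).all fun x => (S.2.2 :: D).any fun d => d == x || adjB S.2.1 x d

/-- Two lists have the same elements. -/
def sameElems (l m : List ℕ) : Bool := l.all (fun x => m.contains x) && m.all fun x => l.contains x

/-- The table contains a position with the same free vertices and the same vertices claimed by
Dominator. -/
def lookup (T : List (List ℕ × List ℕ)) (U D : List ℕ) : Bool :=
  T.any fun q => sameElems q.1 U && sameElems q.2 D

/-- Dominator has won, or she has a reply to every move of Staller that leads to a position in the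
table. -/
def goodPosition (S : GameState) (T : List (List ℕ × List ℕ)) (q : List ℕ × List ℕ) : Bool :=
  isDominated S q.2 || (!q.1.isEmpty && q.1.all fun s => q.1.any fun d =>
    !(d == s) && lookup T (q.1.filter fun x => !(x == s || x == d)) (d :: q.2))

/-- All positions. -/
def positions (Z : ℕ) (S : GameState) : List (List ℕ × List ℕ) :=
  (sublistsB Z S.1).flatMap fun U => (sublistsB Z S.1).map fun D => (U, D)

/-- The positions that Dominator wins, computed in rounds. -/
def table (Z : ℕ) (S : GameState) : ℕ → List (List ℕ × List ℕ) :=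
  fun i => (fun T => (positions Z S).filter (goodPosition S T))^[i] []

/-- Decide whether Dominator wins; the bound `Z` has to be at least `2 ^ n`. -/
def solve (Z : ℕ) (S : GameState) : Bool := lookup (table Z S (S.1.length + 1)) S.1 []

/-- The cap keeps the list short for every `Z`, even a useless one, so the running time is bounded
unconditionally. The `+ 1` allows for the initial list if `Z = 0`. -/
theorem sublistsB_invariant (Z : ℕ) (l : List ℕ) :
    let m := l.foldl (fun acc a => cap Z (acc ++ acc.map fun l => a :: l)) [[]]
    m.length ≤ Z + 1 ∧ ∀ x ∈ m, x.Sublist l.reverse := by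
  induction l using List.reverseRecOn with
  | nil => simp
  | append_singleton l a ih =>
    simp only [List.foldl_append, List.foldl_cons, List.foldl_nil] at ih ⊢
    generalize l.foldl (fun acc a => cap Z (acc ++ acc.map fun l => a :: l)) [[]] = m at ih
    unfold cap
    split_ifs with h
    · refine ⟨(of_decide_eq_true h).trans (Nat.le_succ Z), fun x hx => ?_⟩
      rw [List.reverse_append]
      rcases List.mem_append.1 hx with hx | hx
      · exact (ih.2 x hx).cons a
      · obtain ⟨y, hy, rfl⟩ := List.mem_map.1 hx
        exact (ih.2 y hy).cons_cons a
    · simp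

/-- If `Z` is at least the number of all sublists, the cap never takes effect. -/
theorem mem_sublistsB {Z : ℕ} {L : List ℕ} (hZ : 2 ^ L.length ≤ Z) {l : List ℕ}
    (hl : l.Sublist L) : l ∈ sublistsB Z L := by
  have key : ∀ M : List ℕ, M.length ≤ L.length →
      let m := M.reverse.foldl (fun acc a => cap Z (acc ++ acc.map fun l => a :: l)) [[]]
      m.length = 2 ^ M.length ∧ ∀ x, x.Sublist M → x ∈ m := by
    intro M
    induction M with
    | nil => simp
    | cons a M ih =>
      intro hM
      simp only [List.length_cons] at hM
      have ih := ih (by omega)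
      simp only [List.reverse_cons, List.foldl_append, List.foldl_cons, List.foldl_nil] at ih ⊢
      generalize M.reverse.foldl (fun acc a => cap Z (acc ++ acc.map fun l => a :: l)) [[]] = m at ih
      have hlen : (m ++ m.map fun l => a :: l).length = 2 ^ (a :: M).length := by
        simp [ih.1, pow_succ]
        omega
      have hle : (m ++ m.map fun l => a :: l).length ≤ Z := by
        rw [hlen]
        exact (Nat.pow_le_pow_right (by omega) (by simpa using hM)).trans hZ
      unfold cap
      rw [if_pos (decide_eq_true hle)]
      refine ⟨hlen, fun x hx => ?_⟩
      rw [List.mem_append, List.mem_map]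
      rcases hx with _ | h | h
      · exact Or.inl (ih.2 x ‹_›)
      · exact Or.inr ⟨_, ih.2 _ ‹_›, rfl⟩
  exact (key L le_rfl).2 l hl

theorem isDominated_iff {S : GameState} {D : List ℕ} (hD : ∀ d ∈ D, d ∈ S.1) :
    isDominated S D ↔
      ∀ e, e ∉ {e | e ∈ openNbhds S.graph S.verts S.2.2 ∧ ∀ y ∈ e, y ∉ D} := by
  simp only [isDominated, List.all_eq_true, List.any_eq_true, Bool.or_eq_true, beq_iff_eq]
  constructor
  · rintro h e ⟨⟨x, hx, rfl, hv⟩, hdis⟩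
    obtain ⟨d, hd, hdx⟩ := h x (by simpa [verts] using hx)
    have hmem : d ∈ cnbr S.graph S.verts x := by
      refine mem_cnbr.2 ⟨?_, hdx⟩
      rw [mem_verts]
      rcases List.mem_cons.1 hd with rfl | hd
      · exact Or.inl rfl
      · exact Or.inr (hD d hd)
    rcases List.mem_cons.1 hd with rfl | hd
    · exact hv hmem
    · exact hdis d hmem hd
  · intro h x hx
    by_contra hcon
    push Not at hcon
    refine h (cnbr S.graph S.verts x) ⟨⟨x, by simpa [verts] using hx, rfl, fun hv => ?_⟩,
      fun y hy hyD => ?_⟩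
    · have := hcon S.2.2 (by simp)
      rcases (mem_cnbr.1 hv).2 with h2 | h2
      · exact this.1 h2
      · exact this.2 h2
    · have := hcon y (by simp [hyD])
      rcases (mem_cnbr.1 hy).2 with h2 | h2
      · exact this.1 h2
      · exact this.2 h2

theorem sameElems_iff {l m : List ℕ} : sameElems l m ↔ ∀ x, x ∈ l ↔ x ∈ m := by
  simp only [sameElems, Bool.and_eq_true, List.all_eq_true, List.contains_iff_mem]
  exact ⟨fun h x => ⟨h.1 x, h.2 x⟩, fun h => ⟨fun x => (h x).1, fun x => (h x).2⟩⟩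

/-- The closed neighbourhoods in which Dominator has not claimed a vertex. -/
def unhit (S : GameState) (D : List ℕ) : Set (Finset ℕ) :=
  {e | e ∈ openNbhds S.graph S.verts S.2.2 ∧ ∀ y ∈ e, y ∉ D}

theorem avoid_unhit {S : GameState} {D : List ℕ} {d : ℕ} :
    avoid (unhit S D) d = unhit S (d :: D) := by
  ext e
  constructor
  · rintro ⟨⟨h1, h2⟩, h3⟩
    refine ⟨h1, fun y hy hyD => ?_⟩
    rcases List.mem_cons.1 hyD with rfl | h
    · exact h3 hy
    · exact h2 y hy h
  · rintro ⟨h1, h2⟩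
    exact ⟨⟨h1, fun y hy hyD => h2 y hy (by simp [hyD])⟩, fun h => h2 d h (by simp)⟩

theorem unhit_congr {S : GameState} {D D' : List ℕ} (h : ∀ x, x ∈ D ↔ x ∈ D') :
    unhit S D = unhit S D' := by
  unfold unhit
  simp only [h]

theorem table_succ (Z : ℕ) (S : GameState) (i : ℕ) :
    table Z S (i + 1) = (positions Z S).filter (goodPosition S (table Z S i)) :=
  Function.iterate_succ_apply' _ _ _

theorem mem_positions {Z : ℕ} {S : GameState} {q : List ℕ × List ℕ} :
    q ∈ positions Z S ↔ q.1 ∈ sublistsB Z S.1 ∧ q.2 ∈ sublistsB Z S.1 := by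
  obtain ⟨U, D⟩ := q
  simp only [positions, List.mem_flatMap, List.mem_map, Prod.mk.injEq]
  constructor
  · rintro ⟨a, ha, b, hb, rfl, rfl⟩; exact ⟨ha, hb⟩
  · rintro ⟨h1, h2⟩; exact ⟨U, h1, D, h2, rfl, rfl⟩

theorem sublist_of_mem_sublistsB {Z : ℕ} {L l : List ℕ} (h : l ∈ sublistsB Z L) : l.Sublist L := by
  have := (sublistsB_invariant Z L.reverse).2 l h
  rwa [List.reverse_reverse] at this

theorem toFinset_filter_ne {U : List ℕ} {s d : ℕ} :
    (U.filter fun x => !(x == s || x == d)).toFinset = (U.toFinset.erase s).erase d := by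
  ext x
  simp only [List.mem_toFinset, List.mem_filter, Bool.not_eq_true', Bool.or_eq_false_iff,
    beq_eq_false_iff_ne, Finset.mem_erase]
  tauto

/-- Soundness needs neither a large `Z` nor many rounds, since every entry is justified by entries
of the previous round. -/
theorem lookup_table {Z : ℕ} {S : GameState} : ∀ (i : ℕ) {U D : List ℕ},
    lookup (table Z S i) U D → DW U.toFinset (unhit S D) := by
  intro i
  induction i with
  | zero => intro U D h; simp [table, lookup] at h
  | succ i ih =>
    intro U D h
    obtain ⟨q, hq, h1⟩ := List.any_eq_true.1 h
    rw [Bool.and_eq_true, sameElems_iff, sameElems_iff] at h1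
    rw [table_succ, List.mem_filter] at hq
    obtain ⟨hpos, hgood⟩ := hq
    have hsub := sublist_of_mem_sublistsB (mem_positions.1 hpos).2
    have hU : U.toFinset = q.1.toFinset := by
      ext x; simp [h1.1 x]
    rw [hU, ← unhit_congr h1.2]
    rw [goodPosition, Bool.or_eq_true] at hgood
    rcases hgood with hgood | hgood
    · exact DW.done _ _ ((isDominated_iff fun d hd => hsub.subset hd).1 hgood)
    · simp only [Bool.and_eq_true, Bool.not_eq_true', List.isEmpty_eq_false_iff, List.all_eq_true,
        List.any_eq_true, beq_eq_false_iff_ne] at hgood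
      obtain ⟨hne, hrep⟩ := hgood
      refine DW.of_replies ?_ fun s hs => ?_
      · rwa [List.toFinset_nonempty_iff]
      · obtain ⟨d, hd, hds, hl⟩ := hrep s (by simpa using hs)
        refine ⟨d, by simp [hds, hd], ?_⟩
        have := ih hl
        rwa [toFinset_filter_ne, ← avoid_unhit] at this

/-- Every round of the game uses up free vertices, so a won position is found once the number of
rounds of the table exceeds the number of its free vertices. -/
theorem DW.lookup {Z : ℕ} {S : GameState} (hZ : 2 ^ S.1.length ≤ Z) : ∀ (i : ℕ) {U D : List ℕ},
    (∀ x ∈ U, x ∈ S.1) → (∀ x ∈ D, x ∈ S.1) → U.toFinset.card < i → DW U.toFinset (unhit S D) →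
      GameState.lookup (table Z S i) U D := by
  intro i
  induction i with
  | zero => intro U D _ _ h; simp at h
  | succ i ih =>
    intro U D hU hD hi h
    have hmem : ∀ {l : List ℕ}, (∀ x ∈ l, x ∈ S.1) →
        ∀ x, x ∈ S.1.filter (fun y => l.contains y) ↔ x ∈ l := by
      intro l hl x
      rw [List.mem_filter, List.contains_iff_mem]
      exact ⟨And.right, fun h => ⟨hl x h, h⟩⟩
    -- The table consists of sublists of `S.1`; `U'` and `D'` are the representatives of `U` and `D`
    -- as sets.
    set U' := S.1.filter fun y => U.contains y with hU'
    set D' := S.1.filter fun y => D.contains y with hD'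
    refine List.any_eq_true.2 ⟨(U', D'), ?_, by
      rw [Bool.and_eq_true, sameElems_iff, sameElems_iff]; exact ⟨hmem hU, hmem hD⟩⟩
    rw [table_succ, List.mem_filter, mem_positions]
    refine ⟨⟨mem_sublistsB hZ List.filter_sublist, mem_sublistsB hZ List.filter_sublist⟩, ?_⟩
    have hUU : U.toFinset = U'.toFinset := by
      ext x; rw [List.mem_toFinset, List.mem_toFinset, hmem hU]
    rw [hUU] at hi h
    rw [← unhit_congr (hmem hD)] at h
    rw [goodPosition, Bool.or_eq_true]
    cases h with
    | done _ _ h => exact Or.inl ((isDominated_iff fun d hd => hD d ((hmem hD d).1 hd)).2 h)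
    | move _ _ hne r h1 h2 =>
      right
      simp only [Bool.and_eq_true, Bool.not_eq_true', List.isEmpty_eq_false_iff, List.all_eq_true,
        List.any_eq_true, beq_eq_false_iff_ne]
      refine ⟨(List.toFinset_nonempty_iff _).1 hne, fun s hs => ?_⟩
      have hs' : s ∈ U'.toFinset := by simpa using hs
      have h3 := h1 s hs'
      have h4 := h2 s hs'
      rw [Finset.mem_erase, List.mem_toFinset] at h3
      refine ⟨r s, h3.2, h3.1, ih ?_ ?_ ?_ ?_⟩
      · intro x hx
        exact hU x ((hmem hU x).1 (List.mem_filter.1 hx).1)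
      · intro x hx
        rcases List.mem_cons.1 hx with rfl | hx
        · exact hU _ ((hmem hU _).1 h3.2)
        · exact hD x ((hmem hD x).1 hx)
      · rw [toFinset_filter_ne]
        have h5 := Finset.card_erase_lt_of_mem hs'
        have h6 := Finset.card_le_card (Finset.erase_subset (r s) (U'.toFinset.erase s))
        omega
      · rwa [toFinset_filter_ne, ← avoid_unhit]

theorem solve_iff {S : GameState} (hS : S.Valid) {Z : ℕ} (hZ : 2 ^ S.1.length ≤ Z) :
    solve Z S ↔ S.Wins := by
  have h1 : S.verts.erase S.2.2 = S.1.toFinset := by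
    ext x
    rw [Finset.mem_erase, mem_verts, List.mem_toFinset]
    have := hS.notMem
    constructor
    · tauto
    · intro h
      exact ⟨fun h2 => this (h2 ▸ h), Or.inr h⟩
  have h2 : openNbhds S.graph S.verts S.2.2 = unhit S [] := by
    ext e; simp [unhit]
  unfold Wins Win
  rw [h1, h2]
  refine ⟨fun h => lookup_table _ h, fun h => DW.lookup hZ _ (fun _ h => h) (by simp) ?_ h⟩
  have := S.1.toFinset_card_le
  omega

end GameState

/-! ### The solver is polynomial in its bound and its input -/

section SolvePT

variable {α : Type} [DEnc α]

theorem PT.sublistsB {Z : α → ℕ} {L : α → List ℕ} (hZ : PT Z) (hL : PT L) :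
    PT fun x => GameState.sublistsB (Z x) (L x) := by
  refine PT.foldl (f := fun x acc a => GameState.cap (Z x) (acc ++ acc.map fun l => a :: l))
    (init := fun _ => [[]]) (B := fun x => (sz (Z x) + 1) * (sz (L x) + 1) + 1)
    hL.reverse (.const [[]]) ?_
    (((hZ.pb.add (.const 1)).mul (hL.pb.add (.const 1))).add (.const 1)) ?_
  · have hacc : PT fun p : α × List (List ℕ) × ℕ => p.2.1 := PT.fst.comp .snd
    have hm : PT fun p : α × List (List ℕ) × ℕ => p.2.1 ++ p.2.1.map fun l => p.2.2 :: l :=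
      hacc.append (PT.map hacc (g := fun p l => p.2.2 :: l)
        (.cons (PT.snd.comp (PT.snd.comp .fst)) .snd))
    exact .ite ((PT.length hm).ble (hZ.comp .fst)) hm (.const [])
  · intro x l₁ h
    obtain ⟨h1, h2⟩ := GameState.sublistsB_invariant (Z x) l₁
    refine sz_list_le (h1.trans ?_) fun l hl => ?_
    · have := sz_nat (Z x)
      omega
    · have h3 := sz_le_of_sublist (h2 l hl)
      have h4 := sz_le_of_sublist h.sublist
      rw [sz_reverse] at h3 h4
      exact h3.trans h4

theorem PT.isDominated {S : α → GameState} {D : α → List ℕ} (hS : PT S) (hD : PT D) :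
    PT fun x => GameState.isDominated (S x) (D x) := by
  have hv : PT fun x => (S x).2.2 := PT.snd.comp (PT.snd.comp hS)
  refine PT.all (.cons hv (PT.fst.comp hS)) (g := fun x y => ((S x).2.2 :: D x).any fun d =>
    d == y || MBDom.adjB (S x).2.1 y d) (PT.any (PT.cons (hv.comp .fst) (hD.comp .fst))
      (g := fun p d => d == p.2 || MBDom.adjB (S p.1).2.1 p.2 d) ?_)
  exact (PT.snd.beq (PT.snd.comp .fst)).or
    (.adjB (PT.fst.comp (PT.snd.comp (hS.comp (PT.fst.comp .fst)))) (PT.snd.comp .fst) .snd)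

theorem PT.sameElems {l m : α → List ℕ} (hl : PT l) (hm : PT m) :
    PT fun x => GameState.sameElems (l x) (m x) :=
  (PT.all hl (g := fun x y => (m x).contains y) ((hm.comp .fst).contains .snd)).and
    (PT.all hm (g := fun x y => (l x).contains y) ((hl.comp .fst).contains .snd))

theorem PT.lookup {T : α → List (List ℕ × List ℕ)} {U D : α → List ℕ} (hT : PT T) (hU : PT U)
    (hD : PT D) : PT fun x => GameState.lookup (T x) (U x) (D x) :=
  PT.any hT (g := fun x (q : List ℕ × List ℕ) => GameState.sameElems q.1 (U x) && GameState.sameElems q.2 (D x))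
    ((PT.sameElems (PT.fst.comp .snd) (hU.comp .fst)).and
      (.sameElems (PT.snd.comp .snd) (hD.comp .fst)))

theorem PT.goodPosition {S : α → GameState} {T : α → List (List ℕ × List ℕ)}
    {q : α → List ℕ × List ℕ} (hS : PT S) (hT : PT T) (hq : PT q) :
    PT fun x => GameState.goodPosition (S x) (T x) (q x) := by
  have hU : PT fun x => (q x).1 := PT.fst.comp hq
  have hD : PT fun x => (q x).2 := PT.snd.comp hq
  refine (PT.isDominated hS hD).or (hU.isEmpty.not.and (PT.all hU
    (g := fun x s => (q x).1.any fun d => !(d == s) && GameState.lookup (T x)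
      ((q x).1.filter fun y => !(y == s || y == d)) (d :: (q x).2))
    (PT.any (hU.comp .fst) (g := fun p d => !(d == p.2) && GameState.lookup (T p.1)
      ((q p.1).1.filter fun y => !(y == p.2 || y == d)) (d :: (q p.1).2)) ?_)))
  have hx : PT fun p : (α × ℕ) × ℕ => p.1.1 := PT.fst.comp .fst
  have hs : PT fun p : (α × ℕ) × ℕ => p.1.2 := PT.snd.comp .fst
  refine (PT.snd.beq hs).not.and (.lookup (hT.comp hx) (PT.filter (hU.comp hx)
    (g := fun p y => !(y == p.1.2 || y == p.2)) ?_) (.cons .snd (hD.comp hx)))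
  exact ((PT.snd.beq (hs.comp .fst)).or (PT.snd.beq (PT.snd.comp .fst))).not

/-- After the first round the table is always a sublist of the fixed list of positions, which bounds
its size. -/
theorem PT.solve {Z : α → ℕ} {S : α → GameState} (hZ : PT Z) (hS : PT S) :
    PT fun x => GameState.solve (Z x) (S x) := by
  have hL : PT fun x => (S x).1 := PT.fst.comp hS
  have hsub := PT.sublistsB hZ hL
  have hpos : PT fun x => GameState.positions (Z x) (S x) :=
    PT.flatMap hsub (g := fun x U => (GameState.sublistsB (Z x) (S x).1).map fun D => (U, D))
      (PT.map (hsub.comp .fst) (g := fun p D => (p.2, D)) ((PT.snd.comp .fst).pair .snd))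
  refine PT.lookup (PT.iterate (n := fun x => (S x).1.length + 1) (init := fun _ => [])
    (g := fun x T => (GameState.positions (Z x) (S x)).filter (GameState.goodPosition (S x) T))
    (B := fun x => sz (GameState.positions (Z x) (S x))) (.succ (.length hL)) (.const []) ?_
    hpos.pb ?_) hL (.const [])
  · exact PT.filter (hpos.comp .fst) (g := fun p q => GameState.goodPosition (S p.1) p.2 q)
      (.goodPosition (hS.comp (PT.fst.comp .fst)) (PT.snd.comp .fst) .snd)
  · intro x i _
    cases i with
    | zero => exact one_le_sz _
    | succ i =>
      rw [Function.iterate_succ_apply']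
      exact sz_le_of_sublist List.filter_sublist

end SolvePT


/-! ### Fixed-parameter tractability -/

open DEnc (enc)

namespace GameState

/-- The game on the graph with a given adjacency matrix, with Staller to move first: an isolated
vertex claimed by Dominator is added. -/
def freeStart (M : List (List Bool)) : GameState := (List.range M.length, matrixEdges M, M.length)

theorem freeStart_valid (M : List (List Bool)) : (freeStart M).Valid :=
  List.nodup_cons.2 ⟨by simp [freeStart], List.nodup_range⟩

theorem mem_verts_freeStart {G : FinGraph} {x : ℕ} : x ∈ (freeStart G.rows).verts ↔ x ≤ G.n := by
  rw [mem_verts]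
  simp only [freeStart, List.mem_range, G.length_rows]
  omega

theorem freeStart_adj {G : FinGraph} {i j : ℕ} : (freeStart G.rows).graph.Adj i j ↔
    ∃ (hi : i < G.n) (hj : j < G.n), G.graph.Adj ⟨i, hi⟩ ⟨j, hj⟩ := G.listGraph_adj

/-- The added vertex is isolated and contributes no edge. -/
theorem freeStart_feedback {G : FinGraph} {k : ℕ} (hk : feedbackEdgeNumber G.graph ≤ k) :
    (freeStart G.rows).Feedback k := by
  rcases Nat.eq_zero_or_pos G.n with h0 | h0
  · refine feedback_of_nil ?_ k
    have : G.rows.length = 0 := G.length_rows.trans h0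
    simp [freeStart, matrixEdges, this]
  · have h1 := (copy_ofMatrix G ⟨0, h0⟩).feedback_iff.1 hk
    have h2 : res (freeStart G.rows).graph (freeStart G.rows).verts =
        res (ofMatrix G.rows 0).graph (ofMatrix G.rows 0).verts := by
      ext x y
      have hv : ∀ z, z < G.n → z ∈ (ofMatrix G.rows 0).verts := by
        intro z hz
        rw [← (copy_ofMatrix G ⟨0, h0⟩).image]
        exact Finset.mem_image.2 ⟨⟨z, hz⟩, Finset.mem_univ _, rfl⟩
      constructor
      · rintro ⟨-, -, h⟩
        obtain ⟨hx, hy, -⟩ := freeStart_adj.1 h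
        exact ⟨hv x hx, hv y hy, h⟩
      · rintro ⟨-, -, h⟩
        obtain ⟨hx, hy, -⟩ := freeStart_adj.1 h
        exact ⟨mem_verts_freeStart.2 hx.le, mem_verts_freeStart.2 hy.le, h⟩
    unfold Feedback FeedbackLE at h1 ⊢
    rw [h2]
    exact h1

/-- The neighbourhood of the added vertex is hit from the start, and those of the other vertices are
the neighbourhoods in `G`. -/
theorem freeStart_wins_iff (G : FinGraph) : (freeStart G.rows).Wins ↔
    DominatorWins G.graph Player.staller ∅ ∅ := by
  rw [dominatorWins_staller_iff]
  have hU : ∀ x, x ∈ (freeStart G.rows).verts.erase (freeStart G.rows).2.2 ↔ x < G.n := by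
    intro x
    rw [Finset.mem_erase, mem_verts_freeStart]
    simp only [freeStart, G.length_rows]
    omega
  have hadj : ∀ i j : Fin G.n, (freeStart G.rows).graph.Adj i j ↔ G.graph.Adj i j := fun i j =>
    freeStart_adj.trans ⟨fun ⟨_, _, h⟩ => h, fun h => ⟨i.2, j.2, h⟩⟩
  have hopen : ∀ i : Fin G.n, cnbr (freeStart G.rows).graph (freeStart G.rows).verts i ∈
      openNbhds (freeStart G.rows).graph (freeStart G.rows).verts (freeStart G.rows).2.2 := by
    intro i
    refine ⟨i, mem_verts_freeStart.2 i.2.le, rfl, fun h => ?_⟩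
    have h1 : G.rows.length ∉ Finset.range G.n := by simp [G.length_rows]
    rcases (mem_cnbr.1 h).2 with h2 | h2
    · exact h1 (Finset.mem_range.2 (lt_of_eq_of_lt h2 i.2))
    · obtain ⟨-, h3, -⟩ := freeStart_adj.1 h2
      exact h1 (Finset.mem_range.2 h3)
  constructor
  · intro h
    rcases Nat.eq_zero_or_pos G.n with h0 | h0
    · refine DW.done _ _ ?_
      rintro e ⟨x, -⟩
      exact absurd x.2 (by omega)
    · let g : ℕ → Fin G.n := fun i => if hi : i < G.n then ⟨i, hi⟩ else ⟨0, h0⟩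
      have hg : ∀ i (hi : i < G.n), g i = ⟨i, hi⟩ := fun i hi => dif_pos hi
      have himg : ((freeStart G.rows).verts.erase (freeStart G.rows).2.2).image g =
          Finset.univ := by
        refine Finset.eq_univ_of_forall fun i => ?_
        exact Finset.mem_image.2 ⟨i, (hU i).2 i.2, hg i i.2⟩
      have key := DW.image h g (H' := {e | ∃ x, e = cnbr G.graph Finset.univ x}) ?_ ?_
      · rwa [himg] at key
      · intro x hx y hy hxy
        rw [hg x ((hU x).1 hx), hg y ((hU y).1 hy)] at hxy
        exact congrArg Fin.val hxy
      · rintro e ⟨x, rfl⟩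
        refine ⟨_, hopen x, fun y hy hyU => ?_⟩
        have hyn := (hU y).1 hyU
        rw [hg y hyn, mem_cnbr]
        refine ⟨Finset.mem_univ _, ?_⟩
        rcases (mem_cnbr.1 hy).2 with h2 | h2
        · exact Or.inl (Fin.ext h2)
        · exact Or.inr ((hadj x ⟨y, hyn⟩).1 h2)
  · intro h
    have himg : (Finset.univ : Finset (Fin G.n)).image Fin.val =
        (freeStart G.rows).verts.erase (freeStart G.rows).2.2 := by
      ext x
      rw [hU, Finset.mem_image]
      exact ⟨fun ⟨i, _, hi⟩ => hi ▸ i.2, fun hx => ⟨⟨x, hx⟩, Finset.mem_univ _, rfl⟩⟩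
    unfold Wins Win
    rw [← himg]
    refine h.image Fin.val Fin.val_injective.injOn ?_
    rintro e ⟨x, hx, rfl, hv⟩
    have hx' : x < G.n := by
      rw [← hU, Finset.mem_erase]
      refine ⟨fun h => hv ?_, hx⟩
      exact mem_cnbr.2 ⟨mem_verts.2 (Or.inl rfl), Or.inl h.symm⟩
    refine ⟨_, ⟨⟨x, hx'⟩, rfl⟩, fun y hy _ => ?_⟩
    refine mem_cnbr.2 ⟨mem_verts_freeStart.2 y.2.le, ?_⟩
    rcases (mem_cnbr.1 hy).2 with h2 | h2
    · exact Or.inl (congrArg Fin.val h2)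
    · exact Or.inr ((hadj ⟨x, hx'⟩ y).2 h2)

/-- Games with Staller to move, one of which Dominator wins if and only if she wins the given game;
the Boolean is true if Dominator moves first. -/
def starts (p : Bool × List (List Bool)) : List GameState :=
  if !p.1 || p.2.isEmpty then [freeStart p.2] else (List.range p.2.length).map (ofMatrix p.2)

/-- The largest number of free vertices. -/
def maxFree (l : List GameState) : ℕ :=
  l.foldl (fun N S => if decide (N ≤ S.1.length) then S.1.length else N) 0

theorem maxFree_spec (l : List GameState) :
    (∀ S ∈ l, S.1.length ≤ maxFree l) ∧ ∀ n, (∀ S ∈ l, S.1.length ≤ n) → maxFree l ≤ n := by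
  unfold maxFree
  induction l using List.reverseRecOn with
  | nil => simp
  | append_singleton l S ih =>
    simp only [List.foldl_append, List.foldl_cons, List.foldl_nil, List.mem_append,
      List.mem_singleton]
    generalize l.foldl _ 0 = N at ih
    obtain ⟨h1, h2⟩ := ih
    refine ⟨?_, fun n hn => ?_⟩
    · rintro T (hT | rfl)
      · have := h1 T hT
        split_ifs with h
        · exact this.trans (of_decide_eq_true h)
        · exact this
      · split_ifs with h
        · exact le_rfl
        · simp at h; omega
    · split_ifs with h
      · exact hn S (Or.inr rfl)
      · exact h2 n fun T hT => hn T (Or.inl hT)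

end GameState

open GameState

/-- The input of the decision algorithm. -/
noncomputable def GameInstance.input (x : GameInstance) : Bool × List (List Bool) :=
  (match x.first with
    | Player.dominator => true
    | Player.staller => false, x.G.rows)

theorem GameInstance.encode_eq (x : GameInstance) : x.encode = enc x.input := by
  obtain ⟨G, p⟩ := x
  cases p <;> (show Data.cons _ _ = Data.cons _ _; rw [G.encode_eq]; rfl)

/-- If Dominator begins, she wins exactly if one of her first moves does. On the empty graph she has
no move but has already won, which `freeStart` reflects. -/
theorem starts_spec (x : GameInstance) :
    (∀ S ∈ starts x.input, S.Valid ∧ S.Feedback x.fen) ∧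
      (x.DominatorWins ↔ ∃ S ∈ starts x.input, S.Wins) := by
  obtain ⟨G, p⟩ := x
  have hfree : (freeStart G.rows).Valid ∧ (freeStart G.rows).Feedback (feedbackEdgeNumber G.graph) :=
    ⟨freeStart_valid _, freeStart_feedback le_rfl⟩
  cases p with
  | staller =>
    have h : starts (GameInstance.input ⟨G, Player.staller⟩) = [freeStart G.rows] := rfl
    rw [h]
    refine ⟨fun S hS => ?_, ?_⟩
    · rw [List.mem_singleton.1 hS]
      exact hfree
    · simp only [List.mem_singleton, exists_eq_left]
      exact (freeStart_wins_iff G).symm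
  | dominator =>
    rcases Nat.eq_zero_or_pos G.n with h0 | h0
    · have hemp : G.rows = [] := List.eq_nil_of_length_eq_zero (G.length_rows.trans h0)
      have h : starts (GameInstance.input ⟨G, Player.dominator⟩) = [freeStart G.rows] := by
        simp [starts, GameInstance.input, hemp]
      rw [h]
      refine ⟨fun S hS => ?_, ?_⟩
      · rw [List.mem_singleton.1 hS]
        exact hfree
      · simp only [List.mem_singleton, exists_eq_left]
        rw [freeStart_wins_iff]
        have hdom : IsDominating G.graph ∅ := fun v => absurd v.2 (by omega)
        exact iff_of_true (DominatorWins.dominating _ _ _ hdom) (DominatorWins.dominating _ _ _ hdom)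
    · have hne : G.rows ≠ [] := fun h => by
        have := G.length_rows
        rw [h, List.length_nil] at this
        omega
      have h : starts (GameInstance.input ⟨G, Player.dominator⟩) =
          (List.range G.n).map (ofMatrix G.rows) := by
        simp [starts, GameInstance.input, hne, G.length_rows]
      rw [h]
      refine ⟨fun S hS => ?_, ?_⟩
      · obtain ⟨v, hv, rfl⟩ := List.mem_map.1 hS
        exact ⟨ofMatrix_valid _ _,
          (copy_ofMatrix G ⟨v, List.mem_range.1 hv⟩).feedback_iff.1 le_rfl⟩
      · refine (dominatorWins_dominator_iff G.graph).trans ?_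
        constructor
        · rintro (h | ⟨v, h⟩)
          · exact h.elim ⟨0, h0⟩
          · exact ⟨_, List.mem_map_of_mem (List.mem_range.2 v.2), (copy_ofMatrix G v).wins_iff.1 h⟩
        · rintro ⟨S, hS, h⟩
          obtain ⟨v, hv, rfl⟩ := List.mem_map.1 hS
          exact Or.inr ⟨⟨v, List.mem_range.1 hv⟩,
            (copy_ofMatrix G ⟨v, List.mem_range.1 hv⟩).wins_iff.2 h⟩

theorem PT.kernels : PT fun p : Bool × List (List Bool) => (starts p).map GameState.kernel := by
  refine PT.map (L := starts) ?_ (g := fun _ S => GameState.kernel S) (.kernel .snd)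
  refine .ite ((PT.not .fst).or (.isEmpty .snd)) ?_ ?_
  · have hn : PT fun p : Bool × List (List Bool) => p.2.length := .length .snd
    exact .cons (hn.range.pair ((PT.matrixEdges .snd).pair hn)) (.const [])
  · exact PT.map (L := fun p : Bool × List (List Bool) => List.range p.2.length)
      (.range (.length .snd)) (g := fun p v => GameState.ofMatrix p.2 v)
      (.ofMatrix (PT.snd.comp .fst) .snd)

theorem PT.maxFree {α : Type} [DEnc α] {l : α → List GameState} (hl : PT l) :
    PT fun x => maxFree (l x) := by
  have h1 : PT fun p : α × ℕ × GameState => p.2.1 := PT.fst.comp .snd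
  have h2 : PT fun p : α × ℕ × GameState => p.2.2.1.length :=
    .length (PT.fst.comp (PT.snd.comp .snd))
  refine PT.foldl (f := fun _ N S => if decide (N ≤ S.1.length) then S.1.length else N)
    (B := fun x => 2 * sz (l x) + 1) hl (.const 0)
    (.ite (h1.ble h2) h2 h1) (((PB.const 2).mul hl.pb).add (.const 1)) fun x l₁ h => ?_
  have := (maxFree_spec l₁).2 (sz (l x)) fun S hS => by
    have h3 := sz_le_of_mem (h.subset hS)
    have h4 : sz S = sz S.1 + sz S.2 + 1 := rfl
    have h5 := length_le_sz S.1
    omega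
  unfold GameState.maxFree at this
  rw [sz_nat]
  omega

/-- A program that computes `2 ^ n`, in time polynomial in the result. -/
theorem exists_runsLE_two_pow {β : Type} [DEnc β] : ∃ (c : Code) (b : (β × ℕ) × ℕ → ℕ), PB b ∧
    ∀ y : β × ℕ, RunsLE c (enc y) (enc (y, 2 ^ y.2)) (b (y, 2 ^ y.2)) := by
  have hadd : PT fun p : (β × ℕ) × ℕ × Unit => p.2.1 + p.2.1 :=
    PT.add (PT.fst.comp .snd) (PT.fst.comp .snd)
  have hunits : PT fun y : β × ℕ => List.replicate y.2 () := PT.units .snd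
  obtain ⟨c₀, b₀, hb₀, h₀⟩ := hunits
  obtain ⟨c₁, b₁, hb₁, h₁⟩ := PT.const (α := β × ℕ) (1 : ℕ)
  obtain ⟨c, b, ⟨d, hd⟩, h⟩ := hadd
  have hfold : ∀ l : List Unit, l.foldl (fun z _ => z + z) 1 = 2 ^ l.length := by
    intro l
    induction l using List.reverseRecOn with
    | nil => rfl
    | append_singleton l a ih => simp [ih, pow_succ, mul_two]
  -- All bounds may depend on the result `2 ^ y.2`, which is the second component of `q`. Doubling
  -- in unary is exponential in `y.2` but polynomial in this result.
  let s : (β × ℕ) × ℕ → ℕ := fun q => 2 * sz q + 6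
  have hs : PB s := ((PB.const 2).mul .size).add (.const 6)
  let K : (β × ℕ) × ℕ → ℕ := fun q => s q ^ d + s q
  have hK : PB K := (hs.pow d).add hs
  have hfst : PB fun q : (β × ℕ) × ℕ => sz q.1 := PT.fst.pb
  refine ⟨.cons .id (foldCode c₀ c₁ c), fun q => sz q.1 + sz q.1 + (3 * (b₀ q.1 + b₁ q.1) +
    3 * sz q.1 + (sz q.1 + 1) * (30 * K q + 30) + 3 * K q + 20) + 1, ?_, fun y => ?_⟩
  · exact ((hfst.add hfst).add ((((((PB.const 3).mul ((hb₀.comp hfst).add (hb₁.comp hfst))).add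
      ((PB.const 3).mul hfst)).add ((hfst.add (.const 1)).mul (((PB.const 30).mul hK).add
      (.const 30)))).add ((PB.const 3).mul hK)).add (.const 20))).add (.const 1)
  · have hlen : (List.replicate y.2 ()).length = y.2 := List.length_replicate
    have hpow : ∀ {l₁ l₂ : List Unit}, List.replicate y.2 () = l₁ ++ l₂ →
        sz (l₁.foldl (fun z _ => z + z) 1) ≤ sz (2 ^ y.2) ∧ sz l₂ ≤ sz y := by
      intro l₁ l₂ hl
      have h1 : l₁.length + l₂.length = y.2 := by rw [← List.length_append, ← hl, hlen]
      constructor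
      · rw [hfold, sz_nat, sz_nat]
        have := Nat.pow_le_pow_right (n := 2) (by omega) (show l₁.length ≤ y.2 by omega)
        omega
      · refine (sz_list_le (b := 1) (n := y.2) (by omega) fun _ _ => le_rfl).trans ?_
        have h2 : sz y = sz y.1 + sz y.2 + 1 := rfl
        rw [sz_nat] at h2
        omega
    have hs' : s (y, 2 ^ y.2) = 2 * (sz y + sz (2 ^ y.2) + 1) + 6 := rfl
    have hrun := RunsLE.foldl (f := fun (z : ℕ) (_ : Unit) => z + z) (K := K (y, 2 ^ y.2))
      ((h₀ y).mono (Nat.le_add_right _ (b₁ y))) ((h₁ y).mono (Nat.le_add_left _ (b₀ y)))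
      (fun l₁ a l₂ hl => (h (y, l₁.foldl (fun z _ => z + z) 1, a)).mono ((hd _).trans (by
        refine le_trans (Nat.pow_le_pow_left ?_ d) (Nat.le_add_right _ _)
        have h1 := (hpow hl).1
        have h2 : sz a = 1 := rfl
        have h3 : sz (y, l₁.foldl (fun z _ => z + z) 1, a) =
          sz y + (sz (l₁.foldl (fun z _ => z + z) 1) + sz a + 1) + 1 := rfl
        rw [h3, hs', h2]
        omega)))
      (fun l₁ l₂ hl => by
        have h1 := hpow hl
        show sz y + (sz l₂ + sz (l₁.foldl (fun z _ => z + z) 1) + 1) + 1 ≤ _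
        refine le_trans ?_ (Nat.le_add_left (s (y, 2 ^ y.2)) _)
        rw [hs']
        omega)
    rw [hfold, hlen] at hrun
    refine (RunsLE.id.cons hrun).mono ?_
    have h1 : y.2 ≤ sz y := by
      have h2 : sz y = sz y.1 + sz y.2 + 1 := rfl
      rw [sz_nat] at h2
      omega
    have h2 := Nat.mul_le_mul_right (30 * K (y, 2 ^ y.2) + 30) (Nat.succ_le_succ h1)
    simp only [sz, Nat.succ_eq_add_one] at h2 ⊢
    omega

theorem computable_two_pow (a b c d : ℕ) : Computable fun k => (2 ^ (a * k + b) + c) ^ d := by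
  have hpow : Primrec₂ fun a b : ℕ => a ^ b := Primrec₂.unpaired'.1 Nat.Primrec.pow
  have h1 : Primrec fun k : ℕ => a * k + b :=
    Primrec.nat_add.comp (Primrec.nat_mul.comp (Primrec.const a) Primrec.id) (Primrec.const b)
  exact (hpow.comp (Primrec.nat_add.comp (hpow.comp (Primrec.const 2) h1) (Primrec.const c))
    (Primrec.const d)).to_comp

/-- Polynomial time with access to `2 ^ n`, where `n` is computed from the input. -/
theorem PT.exists_two_pow {α β γ : Type} [DEnc α] [DEnc β] [DEnc γ] {f : α → β × ℕ}
    {g : (β × ℕ) × ℕ → γ} (hf : PT f) (hg : PT g) : ∃ (c : Code) (d : ℕ), ∀ x,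
      RunsLE c (enc x) (enc (g (f x, 2 ^ (f x).2))) ((sz (x, 2 ^ (f x).2) + 2) ^ d) := by
  have hfs : PB fun q : α × ℕ => sz (f q.1, q.2) := ((hf.comp .fst).pair .snd).pb
  have hfst : PB fun q : α × ℕ => sz q.1 := PT.fst.pb
  obtain ⟨c₁, b₁, hb₁, h₁⟩ := hf
  obtain ⟨c₂, b₂, hb₂, h₂⟩ := exists_runsLE_two_pow (β := β)
  obtain ⟨c₃, b₃, hb₃, h₃⟩ := hg
  obtain ⟨d, hd⟩ := (((hb₁.comp hfst).add (hb₂.comp hfs)).add (.const 1)).add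
    ((hb₃.comp hfs).add (.const 1))
  exact ⟨.comp c₃ (.comp c₂ c₁), d, fun x =>
    (((h₁ x).comp (h₂ (f x))).comp (h₃ (f x, 2 ^ (f x).2))).mono (hd (x, 2 ^ (f x).2))⟩

/-- The kernels of the games that have to be solved, and the largest number of free vertices. -/
def allKernels (p : Bool × List (List Bool)) : List GameState × ℕ :=
  ((starts p).map kernel, maxFree ((starts p).map kernel))

/-- Dominator wins one of the games. -/
def solveAny (q : (List GameState × ℕ) × ℕ) : Bool := q.1.1.any fun S => solve q.2 S

theorem PT.allKernels : PT allKernels := PT.kernels.pair (.maxFree .kernels)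

theorem PT.solveAny : PT solveAny := by
  have h1 : PT fun q : (List GameState × ℕ) × ℕ => q.1.1 := PT.fst.comp .fst
  have key : ∀ f : ℕ → GameState → Bool,
      (PT fun p : ((List GameState × ℕ) × ℕ) × GameState => f p.1.2 p.2) →
        PT fun q : (List GameState × ℕ) × ℕ => q.1.1.any fun S => f q.2 S :=
    fun f hf => PT.any h1 (g := fun q S => f q.2 S) hf
  have hZ : PT fun p : ((List GameState × ℕ) × ℕ) × GameState => p.1.2 := PT.snd.comp .fst
  exact key _ (.solve hZ .snd)

/-- Kernelization comes first, so the only quantity that is not polynomial in the input is `2 ^ N`,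
and it is bounded in terms of the parameter. -/
theorem isFPT : IsFPT GameInstance.encode GameInstance.DominatorWins GameInstance.fen := by
  obtain ⟨c, d, hc⟩ := PT.exists_two_pow PT.allKernels PT.solveAny
  -- A kernel has at most `464 * k + 369` vertices. Written in unary, `2 ^ N` has size `2 * 2 ^ N +
  -- 1`, and the factor two raises the exponent by one.
  refine ⟨c, fun k => (2 ^ (464 * k + 370) + 2) ^ d, (Polynomial.X + 2) ^ d,
    computable_two_pow _ _ _ _, fun x => ?_⟩
  set p := x.input with hp
  obtain ⟨hst, hwin⟩ := starts_spec x
  have hspec : ∀ S ∈ starts p, KernelSpec S (kernel S) := fun S hS => kernel_spec (hst S hS).1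
  have hmax := maxFree_spec ((starts p).map kernel)
  obtain ⟨t, ht, hrun⟩ := hc p
  have hN2 : (allKernels p).2 = maxFree ((starts p).map kernel) := rfl
  generalize (allKernels p).2 = N at hN2 ht hrun
  rw [← hN2] at hmax
  have hNle : N ≤ 464 * x.fen + 369 := by
    refine hmax.2 _ fun S' hS' => ?_
    obtain ⟨S, hS, rfl⟩ := List.mem_map.1 hS'
    have h4 := (hspec S hS).size_le _ (hst S hS).2
    have h5 : (kernel S).toFin.n = (kernel S).1.length + 1 := rfl
    unfold FinGraph.size at h4
    omega
  refine ⟨solveAny (allKernels p, 2 ^ N), t, ?_, ?_, ?_⟩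
  · rw [x.encode_eq]
    exact hrun
  · rw [hwin, solveAny, List.any_eq_true]
    constructor
    · rintro ⟨S', hS', h⟩
      have hZ := Nat.pow_le_pow_right (n := 2) (by omega) (hmax.1 S' hS')
      obtain ⟨S, hS, rfl⟩ := List.mem_map.1 hS'
      exact ⟨S, hS, (hspec S hS).wins.1 ((solve_iff (hspec S hS).valid hZ).1 h)⟩
    · rintro ⟨S, hS, h⟩
      have hS' : kernel S ∈ (starts p).map kernel := List.mem_map_of_mem hS
      have hZ := Nat.pow_le_pow_right (n := 2) (by omega) (hmax.1 _ hS')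
      exact ⟨_, hS', (solve_iff (hspec S hS).valid hZ).2 ((hspec S hS).wins.2 h)⟩
  · rw [x.encode_eq, Polynomial.eval_pow, ← mul_pow]
    refine ht.trans (Nat.pow_le_pow_left ?_ d)
    have h5 : 2 ^ N ≤ 2 ^ (464 * x.fen + 369) := Nat.pow_le_pow_right (by omega) hNle
    have h6 : 2 ^ (464 * x.fen + 370) = 2 * 2 ^ (464 * x.fen + 369) := pow_succ' _ _
    have h7 : Polynomial.eval (enc p).size (Polynomial.X + 2 : Polynomial ℕ) = sz p + 2 := by
      simp [sz]
    rw [h7, sz_pair, sz_nat, h6]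
    generalize 2 ^ (464 * x.fen + 369) = Q at h5
    have h8 : (2 * Q + 2) * (sz p + 2) = 2 * (Q * sz p) + 4 * Q + 2 * sz p + 4 := by ring
    rw [h8]
    omega

end MBDom

theorem mainTheorem8 :
    MBDom.HasLinearKernel MBDom.StartedInstance.encode MBDom.StartedInstance.DominatorWins
      MBDom.StartedInstance.fen MBDom.StartedInstance.size ∧
    MBDom.IsFPT MBDom.GameInstance.encode MBDom.GameInstance.DominatorWins
      MBDom.GameInstance.fen := by
  exact ⟨MBDom.hasLinearKernel, MBDom.isFPT⟩
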